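/- Let $(X_k)_{k\ge 1}$ be i.i.d. random variables with values in $\mathbb{Z}$, defined on a probability space $(\Omega',\mathcal{A},P)$ with expectation $E$, and let $S_0=0$, $S_n=\sum_{k=1}^n X_k$. Suppose that the support of the law of $X_1$ is a set of positive integers with greatest common divisor $1$ (so that $S$ is an aperiodic renewal process), that $m:=E[X_1]<+\infty$, and that $E[X_1^2]<+\infty$. Let $\omega=(\omega_x)_{x\in\mathbb{Z}}$ be i.i.d. real random variables (the scenery) defined on another probability space $(\Omega,\mathcal{F},\mathbb{P})$ with expectation $\mathbb{E}$, such that $\omega_0$ and $-\omega_0$ have the same law, $\mathbb{E}[|\omega_0|^k]<+\infty$ for all integers $k\ge 1$, and $\mathbb{E}[\omega_0^2]=1$. For $n\ge 1$ let $$Z_n=\sum_{k=1}^n \omega_{S_k}.$$ Then for $\mathbb{P}$-almost every realization of $\omega$, the random variables $Z_n$ are $P$-integrable for all $n\ge 1$, and, as $n\to\infty$, the law under $P$ of $$\frac{Z_n-E[Z_n]}{\sqrt n}$$ converges weakly to the Gaussian law $\mathcal{N}(0,\,1-1/m)$ (the Dirac mass at $0$ if $m=1$). -/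

import Mathlib

open MeasureTheory ProbabilityTheory Filter

/-- The walk `S` on `ℤ` with increments `X`, started at `0`. Increments are numbered from `0`:
`X k` is the `(k+1)`-st step, so that `S_n` is the sum of the first `n` steps. -/
def walk {Ω' : Type*} (X : ℕ → Ω' → ℤ) (n : ℕ) (w : Ω') : ℤ :=
  ∑ k ∈ Finset.range n, X k w

/-- The random walk in random scenery `Z_n = ω_{S_1} + ⋯ + ω_{S_n}`, for a fixed realization
`ξ : ℤ → ℝ` of the scenery, as a random variable on the sample space of the walk. -/
def sceneryWalk {Ω' : Type*} (ξ : ℤ → ℝ) (X : ℕ → Ω' → ℤ) (n : ℕ) (w : Ω') : ℝ :=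
  ∑ k ∈ Finset.Icc 1 n, ξ (walk X k w)

/-- A set of integers is aperiodic if its greatest common divisor is `1`: the only natural number
dividing all its elements is `1`. -/
def IsAperiodic (A : Set ℤ) : Prop :=
  ∀ d : ℕ, (∀ k ∈ A, (d : ℤ) ∣ k) → d = 1

/-!
Almost every path of the walk is strictly increasing, so `Z_n` is a sum of `n` distinct scenery
variables. For a fixed scenery its quenched mean is approximately `(ω_1 + ⋯ + ω_N) / m` with
`N = ⌊n m⌋`, because a site far from the origin is visited with probability about `1 / m`. Let `Y_n`
be `Z_n` minus this proxy (`centredWalk`).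

The quenched characteristic function of `Y_n / √n` is compared with that of the Gaussian law in mean
square over the scenery. The square of an expectation over the path is an expectation over two
independent paths (`integral_norm_sq_integral_le_of_memLp`), and for two fixed paths the scenery
average is nearly Gaussian (`IsScenery.exists_norm_integral_exp_sum_sub_le`), with variances given
by the number of sites that the two paths share. Two independent walks of length `n` share `n / m +
O(n ^ (3 / 4))` sites (`exists_integral_abs_overlap_sub_le`); this makes the two copies decouple,
each with variance `1 - 1 / m`, and gives a mean square error `O(n ^ (-1 / 4))`
(`exists_integral_norm_sq_charFun_sub_le`). The same computation shows that the proxy is close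
enough to the quenched mean (`exists_integral_sq_integral_centredWalk_le`).

The overlap estimate rests on the square summability of `u(x) - 1 / m`, where `u(x)` is the
probability that the walk visits `x` (`exists_sum_sq_renewalProb_sub_le`). The generating function
of this sequence is bounded on the unit disk, by aperiodicity and the second moment of the steps,
and Bessel's inequality applies.

Along `n = k ^ 5` the errors are summable, so convergence holds almost surely. Between these times,
the moment of order `20` of `Z_n / √n - Z_k / √k` is small enough to be summable over all `n`
(`exists_integral_normalizedDiff_pow_le`); this uses the symmetry and the moments of the scenery. By
Fubini's theorem almost every scenery has convergence of characteristic functions for almost every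
`t`, which extends to every `t` (`tendsto_charFun_of_ae`), and Lévy's continuity theorem concludes.
-/

open scoped Topology

/-! ### Square sums of power series coefficients -/

/-- One half of Parseval's identity: the sum of a power series with summable coefficients,
restricted to the unit circle, is a continuous function whose Fourier coefficients are the `b n`, so
Bessel's inequality bounds them by its supremum norm. -/
theorem sum_norm_sq_le_of_circle_bound {b : ℕ → ℂ} (hb : Summable fun n => ‖b n‖) {C : ℝ}
    (hC : ∀ z : ℂ, ‖z‖ = 1 → ‖∑' n, b n * z ^ n‖ ≤ C) (s : Finset ℕ) :
    ∑ n ∈ s, ‖b n‖ ^ 2 ≤ C ^ 2 := by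
  have : Fact (0 < (1 : ℝ)) := ⟨one_pos⟩
  have hC0 : 0 ≤ C := (norm_nonneg _).trans (hC 1 (by simp))
  let F : ℕ → C(AddCircle (1 : ℝ), ℂ) := fun n => b n • fourier (n : ℤ)
  have hF : Summable F := by
    refine Summable.of_norm ?_
    simpa [F, norm_smul, fourier_norm] using hb
  let f : C(AddCircle (1 : ℝ), ℂ) := ∑' n, F n
  have hf : ‖f‖ ≤ C := by
    rw [ContinuousMap.norm_le _ hC0]
    intro x
    have h1 : f x = ∑' n, b n * (fourier 1 x : ℂ) ^ n := by
      have := (hF.hasSum.map (ContinuousMap.evalCLM ℂ x) (ContinuousMap.evalCLM ℂ x).continuous)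
      rw [show f x = ContinuousMap.evalCLM ℂ x (∑' n, F n) from rfl, ← this.tsum_eq]
      congr 1
      ext n
      simp [F, fourier_apply, AddCircle.toCircle_nsmul]
    rw [h1]
    apply hC
    rw [fourier_apply]
    exact Circle.norm_coe _
  have hcoef : ∀ n : ℕ, inner ℂ (fourierLp (T := 1) 2 (n : ℤ))
      (ContinuousMap.toLp 2 AddCircle.haarAddCircle ℂ f) = b n := by
    intro n
    let L := (innerSL ℂ (fourierLp (T := (1 : ℝ)) 2 (n : ℤ))).comp
      (ContinuousMap.toLp (E := ℂ) 2 (AddCircle.haarAddCircle (T := (1 : ℝ))) ℂ)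
    have h1 : HasSum (fun k => L (F k)) (L f) := hF.hasSum.map L L.continuous
    have h2 : ∀ k, L (F k) = if k = n then b n else 0 := by
      intro k
      have := orthonormal_iff_ite.1 (orthonormal_fourier (T := (1 : ℝ))) (n : ℤ) (k : ℤ)
      have h3 : L (F k) = b k * inner ℂ (fourierLp (T := (1 : ℝ)) 2 (n : ℤ))
          (fourierLp (T := (1 : ℝ)) 2 (k : ℤ)) := by
        simp [L, F, fourierLp]
      rw [h3, this]
      by_cases h : k = n
      · simp [h]
      · have : n ≠ k := fun h' => h h'.symm
        simp [h, this]
    simp_rw [h2] at h1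
    exact h1.unique (hasSum_ite_eq n (b n))
  have hbessel := (orthonormal_fourier (T := (1 : ℝ))).sum_inner_products_le
    (s := s.map ⟨fun n : ℕ => (n : ℤ), Nat.cast_injective⟩)
    (ContinuousMap.toLp 2 AddCircle.haarAddCircle ℂ f)
  rw [Finset.sum_map] at hbessel
  simp only [Function.Embedding.coeFn_mk, hcoef] at hbessel
  refine hbessel.trans ?_
  gcongr
  have := ContinuousMap.toLp_norm_le (p := 2) (μ := AddCircle.haarAddCircle (T := (1 : ℝ)))
    (E := ℂ) (𝕜 := ℂ)
  calc _ ≤ ‖ContinuousMap.toLp (E := ℂ) 2 (AddCircle.haarAddCircle (T := (1 : ℝ))) ℂ‖ * ‖f‖ :=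
        ContinuousLinearMap.le_opNorm _ _
    _ ≤ 1 * C := by
        gcongr
        simpa [measureUnivNNReal] using this
    _ = C := one_mul _

/-- A power series bounded by `C` on the open unit disk has coefficients of square sum at most `C ^
2`: Bessel's inequality on the circles of radius `r < 1`, then `r → 1`. -/
theorem sum_sq_le_of_disk_bound {a : ℕ → ℝ} {A : ℝ} (ha : ∀ n, |a n| ≤ A) {C : ℝ}
    (hC : ∀ z : ℂ, ‖z‖ < 1 → ‖∑' n, (a n : ℂ) * z ^ n‖ ≤ C) (s : Finset ℕ) :
    ∑ n ∈ s, a n ^ 2 ≤ C ^ 2 := by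
  have key : ∀ r : ℝ, 0 ≤ r → r < 1 → ∑ n ∈ s, (a n * r ^ n) ^ 2 ≤ C ^ 2 := by
    intro r hr0 hr1
    have := sum_norm_sq_le_of_circle_bound (b := fun n => ((a n * r ^ n : ℝ) : ℂ)) (C := C) ?_ ?_ s
    · simpa only [Complex.norm_real, Real.norm_eq_abs, sq_abs] using this
    · refine Summable.of_nonneg_of_le (fun _ => norm_nonneg _) (fun n => ?_)
        ((summable_geometric_of_lt_one hr0 hr1).mul_left A)
      rw [Complex.norm_real, Real.norm_eq_abs, abs_mul, abs_of_nonneg (pow_nonneg hr0 n)]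
      exact mul_le_mul_of_nonneg_right (ha n) (pow_nonneg hr0 n)
    · intro z hz
      have := hC (r * z) (by simp [hz, abs_of_nonneg hr0, hr1])
      simpa [mul_pow, mul_assoc] using this
  have hlim : Tendsto (fun r : ℝ => ∑ n ∈ s, (a n * r ^ n) ^ 2) (nhdsWithin 1 (Set.Iio 1))
      (nhds (∑ n ∈ s, (a n * 1 ^ n) ^ 2)) := by
    have : Continuous (fun r : ℝ => ∑ n ∈ s, (a n * r ^ n) ^ 2) := by fun_prop
    exact (this.tendsto 1).mono_left nhdsWithin_le_nhds
  simp only [one_pow, mul_one] at hlim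
  refine le_of_tendsto hlim ?_
  have : Set.Ioo (0 : ℝ) 1 ∈ nhdsWithin (1 : ℝ) (Set.Iio 1) := Ioo_mem_nhdsLT one_pos
  filter_upwards [this] with r hr using key r hr.1.le hr.2

/-! ### The renewal function -/

/-- The increments of a renewal process: measurable, independent, identically distributed and almost
surely positive. Aperiodicity and the moment conditions are kept as separate hypotheses, since only
the renewal estimates need them. Positivity is stated for all increments at once, which makes almost
every path strictly increasing. -/
structure IsRenewalSteps {Ω' : Type*} [MeasurableSpace Ω'] (P : Measure Ω')
    (X : ℕ → Ω' → ℤ) : Prop where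
  meas : ∀ k, Measurable (X k)
  indep : iIndepFun X P
  ident : ∀ k, IdentDistrib (X k) (X 0) P P
  pos : ∀ᵐ w ∂P, ∀ k, 0 < X k w

section Path

variable {Ω' : Type*} {X : ℕ → Ω' → ℤ} {w : Ω'}

theorem walk_zero : walk X 0 w = 0 := by simp [walk]

theorem walk_succ (n : ℕ) : walk X (n + 1) w = walk X n w + X n w := by
  simp [walk, Finset.sum_range_succ]

theorem walk_add (k l : ℕ) :
    walk X (k + l) w = walk X k w + walk (fun i => X (k + i)) l w := by
  simp [walk, Finset.sum_range_add]

theorem walk_strictMono (hw : ∀ k, 0 < X k w) : StrictMono fun n => walk X n w :=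
  strictMono_nat_of_lt_succ fun n => by have := hw n; rw [walk_succ]; omega

theorem natCast_le_walk (hw : ∀ k, 0 < X k w) (n : ℕ) : (n : ℤ) ≤ walk X n w := by
  induction n with
  | zero => simp [walk_zero]
  | succ n ih => have := hw n; rw [walk_succ]; push_cast; omega

theorem measurable_walk [MeasurableSpace Ω'] (hX : ∀ k, Measurable (X k)) (n : ℕ) :
    Measurable (walk X n) := by
  unfold walk
  exact Finset.measurable_fun_sum _ fun k _ => hX k

end Path

/-- The event that the walk visits the site `x`. The starting time `0` counts, so the site `0` is
always visited. -/
def visitEvent {Ω' : Type*} (X : ℕ → Ω' → ℤ) (x : ℤ) : Set Ω' := {w | ∃ k, walk X k w = x}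

/-- The renewal function: the probability that the walk visits the site `x`. -/
noncomputable def renewalProb {Ω' : Type*} [MeasurableSpace Ω'] (P : Measure Ω')
    (X : ℕ → Ω' → ℤ) (x : ℤ) : ℝ := P.real (visitEvent X x)

section Renewal

variable {Ω' : Type*} [MeasurableSpace Ω'] {P : Measure Ω'} {X : ℕ → Ω' → ℤ}

theorem measurableSet_visitEvent (hX : ∀ k, Measurable (X k)) (x : ℤ) :
    MeasurableSet (visitEvent X x) := by
  have : visitEvent X x = ⋃ k, walk X k ⁻¹' {x} := by ext w; simp [visitEvent]
  rw [this]
  exact MeasurableSet.iUnion fun k => measurable_walk hX k (measurableSet_singleton x)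

/-- The generating function `F z = E[z ^ X]` of the step law. The exponent is read off with
`Int.toNat`, which changes nothing for positive steps. -/
noncomputable def stepGen (P : Measure Ω') (X : ℕ → Ω' → ℤ) (z : ℂ) : ℂ :=
  ∫ w, z ^ (X 0 w).toNat ∂P

theorem integrable_pow_toNat [IsProbabilityMeasure P] {Y : Ω' → ℤ} (hY : Measurable Y) {z : ℂ}
    (hz : ‖z‖ ≤ 1) : Integrable (fun w => z ^ (Y w).toNat) P := by
  refine Integrable.of_bound (C := 1) ?_ ?_
  · exact ((measurable_from_top (f := fun k : ℤ => z ^ k.toNat)).comp hY).aestronglyMeasurable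
  · exact Eventually.of_forall fun w => by simpa using pow_le_one₀ (norm_nonneg _) hz

theorem integral_pow_walk [IsProbabilityMeasure P] (h : IsRenewalSteps P X) (z : ℂ) (n : ℕ) :
    ∫ w, z ^ (walk X n w).toNat ∂P = stepGen P X z ^ n := by
  have h1 : ∀ᵐ w ∂P, z ^ (walk X n w).toNat = ∏ k : Fin n, z ^ (X k w).toNat := by
    filter_upwards [h.pos] with w hw
    rw [Finset.prod_pow_eq_pow_sum]
    congr 1
    have : ((walk X n w).toNat : ℤ) = ∑ k : Fin n, ((X k w).toNat : ℤ) := by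
      rw [Int.toNat_of_nonneg ((Int.natCast_nonneg n).trans (natCast_le_walk hw n)), walk,
        Finset.sum_range]
      exact Finset.sum_congr rfl fun k _ => (Int.toNat_of_nonneg (hw k).le).symm
    exact_mod_cast this
  have hf : Measurable fun k : ℤ => z ^ k.toNat := measurable_from_top
  rw [integral_congr_ae h1,
    (h.indep.precomp (g := fun k : Fin n => (k : ℕ)) Fin.val_injective).integral_fun_prod_comp
      (f := fun _ k => z ^ k.toNat) (fun k => (h.meas k).aemeasurable)
      (fun k => hf.aestronglyMeasurable)]
  have h2 : ∀ k : ℕ, ∫ w, z ^ (X k w).toNat ∂P = stepGen P X z := fun k =>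
    ((h.ident k).comp hf).integral_eq
  simp [h2]

theorem norm_stepGen_le [IsProbabilityMeasure P] (h : IsRenewalSteps P X) {z : ℂ}
    (hz : ‖z‖ ≤ 1) : ‖stepGen P X z‖ ≤ ‖z‖ := by
  have := norm_integral_le_of_norm_le_const (μ := P) (C := ‖z‖) (f := fun w => z ^ (X 0 w).toNat) ?_
  · simpa [stepGen] using this
  · filter_upwards [h.pos] with w hw
    have h0 := hw 0
    rw [norm_pow]
    exact pow_le_of_le_one (norm_nonneg _) hz (by omega)

/-- The generating function of the renewal function is `1 / (1 - F)`: along a strictly increasing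
path the sum of `z ^ x` over the visited sites `x` is `∑ n, z ^ S_n`, with mean `∑ n, (F z) ^ n`. -/
theorem tsum_renewalProb [IsProbabilityMeasure P] (h : IsRenewalSteps P X) {z : ℂ}
    (hz : ‖z‖ < 1) :
    ∑' x : ℕ, (renewalProb P X x : ℂ) * z ^ x = (1 - stepGen P X z)⁻¹ := by
  classical
  have hpt : ∀ᵐ w ∂P, ∑' x : ℕ, (visitEvent X (x : ℤ)).indicator (fun _ => z ^ x) w
      = ∑' n : ℕ, z ^ (walk X n w).toNat := by
    filter_upwards [h.pos] with w hw
    have hnn : ∀ n, ((walk X n w).toNat : ℤ) = walk X n w := fun n =>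
      Int.toNat_of_nonneg ((Int.natCast_nonneg n).trans (natCast_le_walk hw n))
    have hinj : Function.Injective fun n => (walk X n w).toNat := by
      intro i j hij
      apply (walk_strictMono hw).injective
      simp only at hij ⊢
      rw [← hnn i, ← hnn j, hij]
    rw [← hinj.tsum_eq]
    · refine tsum_congr fun n => ?_
      rw [Set.indicator_of_mem]
      exact ⟨n, (hnn n).symm⟩
    · intro x hx
      rw [Function.mem_support] at hx
      have : w ∈ visitEvent X (x : ℤ) := by
        by_contra hc
        exact hx (Set.indicator_of_notMem hc _)
      obtain ⟨k, hk⟩ := this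
      exact ⟨k, by simp [hk]⟩
  have hl := hasSum_integral_of_summable_integral_norm (μ := P)
    (F := fun (x : ℕ) w => (visitEvent X (x : ℤ)).indicator (fun _ => z ^ x) w)
    (fun x => (integrable_const _).indicator (measurableSet_visitEvent h.meas x)) (by
      refine Summable.of_nonneg_of_le (fun x => integral_nonneg fun w => norm_nonneg _)
        (fun x => ?_) (summable_geometric_of_lt_one (norm_nonneg z) hz)
      have : ∀ w, ‖(visitEvent X (x : ℤ)).indicator (fun _ => z ^ x) w‖ ≤ ‖z‖ ^ x := fun w => by
        refine (norm_indicator_le_norm_self _ _).trans ?_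
        simp
      calc _ ≤ ∫ w, ‖z‖ ^ x ∂P := integral_mono_of_nonneg (Eventually.of_forall fun w =>
            norm_nonneg _) (integrable_const _) (Eventually.of_forall this)
        _ = ‖z‖ ^ x := by simp)
  have hr := hasSum_integral_of_summable_integral_norm (μ := P)
    (F := fun (n : ℕ) w => z ^ (walk X n w).toNat)
    (fun n => integrable_pow_toNat (measurable_walk h.meas n) hz.le) (by
      refine Summable.of_nonneg_of_le (fun x => integral_nonneg fun w => norm_nonneg _)
        (fun n => ?_) (summable_geometric_of_lt_one (norm_nonneg z) hz)
      have : ∀ᵐ w ∂P, ‖z ^ (walk X n w).toNat‖ ≤ ‖z‖ ^ n := by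
        filter_upwards [h.pos] with w hw
        have := natCast_le_walk hw n
        rw [norm_pow]
        exact pow_le_pow_of_le_one (norm_nonneg _) hz.le (by omega)
      calc _ ≤ ∫ w, ‖z‖ ^ n ∂P := integral_mono_of_nonneg (Eventually.of_forall fun w =>
            norm_nonneg _) (integrable_const _) this
        _ = ‖z‖ ^ n := by simp)
  rw [integral_congr_ae hpt] at hl
  have h3 := hl.tsum_eq.trans hr.tsum_eq.symm
  simp_rw [integral_pow_walk h] at h3
  rw [tsum_geometric_of_norm_lt_one ((norm_stepGen_le h hz.le).trans_lt hz)] at h3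
  rw [← h3]
  refine tsum_congr fun x => ?_
  rw [integral_indicator_const _ (measurableSet_visitEvent h.meas x)]
  simp [renewalProb]

/-- The quotient `(1 - F z) / (1 - z)` of the step generating function `F`, written as the
expectation of `1 + z + ⋯ + z ^ (X - 1)`. In this form it makes sense at `z = 1`, with value the
mean step. -/
noncomputable def stepQuot (P : Measure Ω') (X : ℕ → Ω' → ℤ) (z : ℂ) : ℂ :=
  ∫ w, ∑ i ∈ Finset.range (X 0 w).toNat, z ^ i ∂P

theorem norm_geom_sum_le {z : ℂ} (hz : ‖z‖ ≤ 1) (n : ℕ) :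
    ‖∑ i ∈ Finset.range n, z ^ i‖ ≤ n := by
  refine (norm_sum_le _ _).trans ?_
  refine (Finset.sum_le_sum (g := fun _ => (1 : ℝ)) fun i _ => ?_).trans (by simp)
  simpa using pow_le_one₀ (norm_nonneg _) hz

theorem integrable_geom_sum [IsProbabilityMeasure P] (h : IsRenewalSteps P X)
    (hint : Integrable (fun w => (X 0 w : ℝ)) P) {z : ℂ} (hz : ‖z‖ ≤ 1) :
    Integrable (fun w => ∑ i ∈ Finset.range (X 0 w).toNat, z ^ i) P := by
  refine hint.mono ?_ ?_
  · exact ((measurable_from_top (f := fun k : ℤ => ∑ i ∈ Finset.range k.toNat, z ^ i)).comp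
      (h.meas 0)).aestronglyMeasurable
  · refine Eventually.of_forall fun w => (norm_geom_sum_le hz _).trans ?_
    rw [Real.norm_eq_abs]
    have : ((X 0 w).toNat : ℤ) ≤ |X 0 w| := by
      rcases le_total 0 (X 0 w) with h0 | h0
      · rw [Int.toNat_of_nonneg h0]; exact le_abs_self _
      · rw [Int.toNat_of_nonpos h0]; simp
    exact_mod_cast this

theorem stepQuot_mul [IsProbabilityMeasure P] (h : IsRenewalSteps P X) {z : ℂ} (hz : ‖z‖ ≤ 1) :
    stepQuot P X z * (1 - z) = 1 - stepGen P X z := by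
  rw [stepQuot, ← integral_mul_const, stepGen]
  simp_rw [geom_sum_mul_neg]
  rw [integral_sub (integrable_const _) (integrable_pow_toNat (h.meas 0) hz)]
  simp

theorem toNat_ae_eq (h : IsRenewalSteps P X) :
    ∀ᵐ w ∂P, (((X 0 w).toNat : ℕ) : ℝ) = (X 0 w : ℝ) := by
  filter_upwards [h.pos] with w hw
  exact_mod_cast congrArg (Int.cast (R := ℝ)) (Int.toNat_of_nonneg (hw 0).le)

/-- Aperiodicity on the closed disk: equality in the triangle inequality forces `z ^ k = 1` for
every `k` in the support of the step law, so the order of `z` divides all of them. -/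
theorem eq_one_of_stepGen_eq_one [IsProbabilityMeasure P] (h : IsRenewalSteps P X)
    (haper : IsAperiodic (P.map (X 0)).support) {z : ℂ} (hz : ‖z‖ ≤ 1)
    (h1 : stepGen P X z = 1) : z = 1 := by
  have hi := integrable_pow_toNat (P := P) (h.meas 0) hz
  have hre : ∫ w, (1 - (z ^ (X 0 w).toNat).re) ∂P = 0 := by
    have hire : Integrable (fun w => (z ^ (X 0 w).toNat).re) P := hi.re
    rw [integral_sub (integrable_const _) hire]
    have : ∫ w, (z ^ (X 0 w).toNat).re ∂P = (stepGen P X z).re := integral_re hi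
    rw [this, h1]; simp
  have hn : ∀ w, ‖z ^ (X 0 w).toNat‖ ≤ 1 := fun w => by
    simpa using pow_le_one₀ (norm_nonneg _) hz
  rw [integral_eq_zero_iff_of_nonneg] at hre
  · have hae : ∀ᵐ w ∂P, z ^ (X 0 w).toNat = 1 := by
      filter_upwards [hre] with w hw
      have h2 : (z ^ (X 0 w).toNat).re = 1 := by simp at hw; linarith
      have h3 := hn w
      have h4 : Complex.normSq (z ^ (X 0 w).toNat) ≤ 1 := by
        rw [Complex.normSq_eq_norm_sq]; exact pow_le_one₀ (norm_nonneg _) h3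
      rw [Complex.normSq_apply, h2] at h4
      apply Complex.ext
      · simpa using h2
      · simp only [Complex.one_im]; nlinarith
    have hord := haper (orderOf z) fun k hk => by
      have hpos : 0 < (P.map (X 0)) {k} := by
        rw [Measure.mem_support_iff_forall] at hk
        exact hk _ (by simp)
      rw [Measure.map_apply (h.meas 0) (measurableSet_singleton k)] at hpos
      obtain ⟨w, hwk, hw1, hw2⟩ : ∃ w, X 0 w = k ∧ z ^ (X 0 w).toNat = 1 ∧ ∀ k, 0 < X k w := by
        by_contra hc
        push Not at hc
        have : P (X 0 ⁻¹' {k}) = 0 := by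
          refine measure_mono_null (t := {w | ¬ (z ^ (X 0 w).toNat = 1 ∧ ∀ k, 0 < X k w)}) ?_
            (ae_iff.1 (hae.and h.pos))
          intro w hw hcon
          obtain ⟨j, hj⟩ := hc w hw hcon.1
          exact absurd (hcon.2 j) (by omega)
        exact hpos.ne' this
      rw [← orderOf_dvd_iff_pow_eq_one] at hw1
      rw [← hwk, ← Int.toNat_of_nonneg (hw2 0).le]
      exact_mod_cast hw1
    exact orderOf_eq_one_iff.1 hord
  · intro w
    have := (Complex.re_le_norm (z ^ (X 0 w).toNat)).trans (hn w)
    simp only [Pi.zero_apply]; linarith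
  · exact (integrable_const _).sub hi.re

/-- By compactness it suffices that the quotient has no zero in the closed disk. Away from `z = 1`
this is aperiodicity; at `z = 1` the value is the mean step, which is positive. -/
theorem exists_le_norm_stepQuot [IsProbabilityMeasure P] (h : IsRenewalSteps P X)
    (haper : IsAperiodic (P.map (X 0)).support)
    (hint : Integrable (fun w => (X 0 w : ℝ)) P) :
    ∃ c > 0, ∀ z : ℂ, ‖z‖ ≤ 1 → c ≤ ‖stepQuot P X z‖ := by
  have hcont : ContinuousOn (stepQuot P X) (Metric.closedBall 0 1) := by
    refine continuousOn_of_dominated (bound := fun w => ((X 0 w).toNat : ℝ)) ?_ ?_ ?_ ?_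
    · intro z hz
      exact (integrable_geom_sum h hint (by simpa using hz)).aestronglyMeasurable
    · intro z hz
      exact Eventually.of_forall fun w => norm_geom_sum_le (by simpa using hz) _
    · exact hint.congr ((toNat_ae_eq h).mono fun w hw => hw.symm)
    · exact Eventually.of_forall fun w => by fun_prop
  obtain ⟨z₀, hz₀, hmin⟩ := (isCompact_closedBall (0 : ℂ) 1).exists_isMinOn ⟨0, by simp⟩ hcont.norm
  refine ⟨‖stepQuot P X z₀‖, ?_, fun z hz => hmin (by simpa using hz)⟩
  rw [gt_iff_lt, norm_pos_iff]
  intro h0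
  have hz1 : ‖z₀‖ ≤ 1 := by simpa using hz₀
  have h1 := stepQuot_mul h hz1
  rw [h0, zero_mul] at h1
  have := eq_one_of_stepGen_eq_one h haper hz1 (sub_eq_zero.1 h1.symm).symm
  rw [this, stepQuot] at h0
  simp only [one_pow, Finset.sum_const, Finset.card_range, nsmul_eq_mul, mul_one] at h0
  have h2 : ∫ w, ((X 0 w).toNat : ℝ) ∂P = 0 := by
    have : (∫ w, (((X 0 w).toNat : ℝ) : ℂ) ∂P) = 0 := by simpa using h0
    rw [integral_complex_ofReal] at this
    exact_mod_cast this
  have h3 : (1 : ℝ) ≤ ∫ w, ((X 0 w).toNat : ℝ) ∂P := by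
    have := integral_mono_ae (μ := P) (f := fun _ => (1 : ℝ)) (g := fun w => ((X 0 w).toNat : ℝ))
      (integrable_const _) (hint.congr ((toNat_ae_eq h).mono fun w hw => hw.symm)) (by
        filter_upwards [h.pos] with w hw
        have := hw 0
        exact_mod_cast (by omega : 1 ≤ (X 0 w).toNat))
    simpa using this
  linarith

theorem norm_one_sub_pow_le {z : ℂ} (hz : ‖z‖ ≤ 1) (n : ℕ) : ‖1 - z ^ n‖ ≤ n * ‖1 - z‖ := by
  rw [← mul_neg_geom_sum, norm_mul, mul_comm]
  exact mul_le_mul_of_nonneg_right (norm_geom_sum_le hz n) (norm_nonneg _)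

/-- A Lipschitz bound at `z = 1`. This is where the second moment of the steps is needed. -/
theorem norm_mean_sub_stepQuot_le [IsProbabilityMeasure P] (h : IsRenewalSteps P X)
    (hint : Integrable (fun w => (X 0 w : ℝ)) P) (hsq : Integrable (fun w => (X 0 w : ℝ) ^ 2) P)
    {z : ℂ} (hz : ‖z‖ ≤ 1) :
    ‖((∫ w, (X 0 w : ℝ) ∂P : ℝ) : ℂ) - stepQuot P X z‖ ≤ (∫ w, (X 0 w : ℝ) ^ 2 ∂P) * ‖1 - z‖ := by
  have hint' : Integrable (fun w => ((X 0 w : ℝ) : ℂ)) P := hint.ofReal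
  rw [← integral_complex_ofReal, stepQuot, ← integral_sub hint' (integrable_geom_sum h hint hz),
    ← integral_mul_const]
  refine norm_integral_le_of_norm_le (hsq.mul_const _) ?_
  filter_upwards [toNat_ae_eq h] with w hw
  rw [← hw]
  set n := (X 0 w).toNat
  have : (((n : ℝ) : ℂ) - ∑ i ∈ Finset.range n, z ^ i) = ∑ i ∈ Finset.range n, (1 - z ^ i) := by
    simp
  rw [this]
  calc ‖∑ i ∈ Finset.range n, (1 - z ^ i)‖ ≤ ∑ i ∈ Finset.range n, ‖1 - z ^ i‖ := norm_sum_le _ _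
    _ ≤ ∑ i ∈ Finset.range n, (n : ℝ) * ‖1 - z‖ := by
        refine Finset.sum_le_sum fun i hi => (norm_one_sub_pow_le hz i).trans ?_
        have : (i : ℝ) ≤ n := by exact_mod_cast (Finset.mem_range.1 hi).le
        gcongr
    _ = (n : ℝ) ^ 2 * ‖1 - z‖ := by simp; ring

theorem one_le_mean [IsProbabilityMeasure P] (h : IsRenewalSteps P X)
    (hint : Integrable (fun w => (X 0 w : ℝ)) P) : 1 ≤ ∫ w, (X 0 w : ℝ) ∂P := by
  have := integral_mono_ae (μ := P) (f := fun _ => (1 : ℝ)) (g := fun w => (X 0 w : ℝ))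
    (integrable_const _) hint (by
      filter_upwards [h.pos] with w hw
      exact_mod_cast hw 0)
  simpa using this

theorem renewalProb_nonneg (x : ℤ) : 0 ≤ renewalProb P X x := measureReal_nonneg

theorem renewalProb_le_one [IsProbabilityMeasure P] (x : ℤ) : renewalProb P X x ≤ 1 :=
  measureReal_le_one

/-- A quantitative renewal theorem: the error `u(x) - 1 / m` is square summable. Its generating
function is `1 / (1 - F) - 1 / (m (1 - z)) = (m - Q) / (m Q (1 - z))` with `Q = (1 - F) / (1 - z)`.
The numerator is `O(|1 - z|)` and `Q` is bounded away from `0`, so the function is bounded on the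
disk. -/
theorem exists_sum_sq_renewalProb_sub_le [IsProbabilityMeasure P] (h : IsRenewalSteps P X)
    (haper : IsAperiodic (P.map (X 0)).support)
    (hint : Integrable (fun w => (X 0 w : ℝ)) P) (hsq : Integrable (fun w => (X 0 w : ℝ) ^ 2) P)
    {m : ℝ} (hm : m = ∫ w, (X 0 w : ℝ) ∂P) :
    ∃ C : ℝ, 0 ≤ C ∧ ∀ s : Finset ℕ, ∑ x ∈ s, (renewalProb P X x - 1 / m) ^ 2 ≤ C ^ 2 := by
  have hm1 : 1 ≤ m := hm ▸ one_le_mean h hint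
  have hm0 : (m : ℂ) ≠ 0 := by exact_mod_cast (by linarith : m ≠ 0)
  obtain ⟨c, hc, hcle⟩ := exists_le_norm_stepQuot h haper hint
  set V := ∫ w, (X 0 w : ℝ) ^ 2 ∂P
  have hV : 0 ≤ V := integral_nonneg fun w => sq_nonneg _
  refine ⟨V / (m * c), by positivity, sum_sq_le_of_disk_bound (A := 1) (fun n => ?_) fun z hz => ?_⟩
  · have h0 := renewalProb_nonneg (P := P) (X := X) n
    have h1 := renewalProb_le_one (P := P) (X := X) n
    have h2 : 0 ≤ 1 / m := by positivity
    have h3 : 1 / m ≤ 1 := by rw [div_le_one (by linarith)]; exact hm1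
    rw [abs_le]; constructor <;> linarith
  · have hz1 : (1 : ℂ) - z ≠ 0 := by
      intro h0
      rw [← sub_eq_zero.1 h0] at hz
      simp at hz
    have hq0 : stepQuot P X z ≠ 0 := by
      rw [← norm_pos_iff]; exact hc.trans_le (hcle z hz.le)
    have hsum : Summable fun x : ℕ => (renewalProb P X x : ℂ) * z ^ x := by
      refine Summable.of_norm_bounded (summable_geometric_of_lt_one (norm_nonneg z) hz) fun x => ?_
      rw [norm_mul, norm_pow, Complex.norm_real, Real.norm_of_nonneg (renewalProb_nonneg _)]
      exact mul_le_of_le_one_left (by positivity) (renewalProb_le_one _)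
    have hsum2 : Summable fun x : ℕ => (1 / m : ℂ) * z ^ x :=
      (summable_geometric_of_norm_lt_one hz).mul_left _
    have hval : ∑' n : ℕ, ((renewalProb P X n - 1 / m : ℝ) : ℂ) * z ^ n
        = (m - stepQuot P X z) / (m * stepQuot P X z * (1 - z)) := by
      push_cast
      simp_rw [sub_mul]
      rw [hsum.tsum_sub hsum2, tsum_renewalProb h hz, tsum_mul_left,
        tsum_geometric_of_norm_lt_one hz, ← stepQuot_mul h hz.le]
      field_simp
    rw [hval, norm_div, norm_mul, norm_mul, Complex.norm_real, Real.norm_of_nonneg (by linarith)]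
    have hb := norm_mean_sub_stepQuot_le h hint hsq hz.le
    rw [← hm] at hb
    have hz2 : 0 < ‖1 - z‖ := norm_pos_iff.2 hz1
    calc _ ≤ V * ‖1 - z‖ / (m * c * ‖1 - z‖) := by
          gcongr
          exact hcle z hz.le
      _ = V / (m * c) := by field_simp

end Renewal

/-! ### Second moment of the number of common sites -/

section Overlap

/-- The indicator that both walks of a pair visit `x`, minus a constant `q`. The relevant value is
`q = 1 / m ^ 2`, the limiting probability of a common visit of two independent copies. -/
noncomputable def jointVisit {Ω' : Type*} (X : ℕ → Ω' → ℤ) (q : ℝ) (x : ℤ) (p : Ω' × Ω') : ℝ :=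
  (visitEvent X x ×ˢ visitEvent X x).indicator (fun _ => (1 : ℝ)) p - q

theorem abs_jointVisit_le {Ω' : Type*} {X : ℕ → Ω' → ℤ} {q : ℝ} (hq0 : 0 ≤ q) (hq1 : q ≤ 1)
    (x : ℤ) (p : Ω' × Ω') :
    |jointVisit X q x p| ≤ 1 := by
  unfold jointVisit
  by_cases hp : p ∈ visitEvent X x ×ˢ visitEvent X x
  · rw [Set.indicator_of_mem hp, abs_le]; constructor <;> linarith
  · rw [Set.indicator_of_notMem hp, abs_le]; constructor <;> linarith

variable {Ω' : Type*} [MeasurableSpace Ω'] {P : Measure Ω'} {X : ℕ → Ω' → ℤ}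

theorem measure_walk_eq_and_walk_add_eq [IsProbabilityMeasure P] (h : IsRenewalSteps P X)
    (k l : ℕ) (x y : ℤ) :
    P {w | walk X k w = x ∧ walk X (k + l) w = y}
      = P {w | walk X k w = x} * P {w | walk X l w = y - x} := by
  have hset : {w | walk X k w = x ∧ walk X (k + l) w = y}
      = walk X k ⁻¹' {x} ∩ walk (fun i => X (k + i)) l ⁻¹' {y - x} := by
    ext w
    simp only [Set.mem_ofPred_eq, walk_add, Set.mem_inter_iff, Set.mem_preimage,
      Set.mem_singleton_iff]
    constructor
    · rintro ⟨h1, h2⟩; exact ⟨h1, by omega⟩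
    · rintro ⟨h1, h2⟩; exact ⟨h1, by omega⟩
  have hind : IndepFun (walk X k) (walk (fun i => X (k + i)) l) P := by
    have h1 := h.indep.indepFun_finset (Finset.range k) (Finset.Ico k (k + l))
      (by
        rw [Finset.disjoint_left]; intro a ha hb
        simp at ha hb; omega) h.meas
    have h2 := h1.comp (φ := fun v => ∑ i, v i) (ψ := fun v => ∑ i, v i)
      (by fun_prop) (by fun_prop)
    convert! h2 using 1
    · ext w
      simp only [walk, Function.comp]
      exact (Finset.sum_coe_sort (Finset.range k) fun i => X i w).symm
    · ext w
      simp only [walk, Function.comp]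
      rw [Finset.sum_coe_sort (Finset.Ico k (k + l)) fun i => X i w, Finset.sum_Ico_eq_sum_range]
      simp
  have hlaw : IdentDistrib (walk (fun i => X (k + i)) l) (walk X l) P P := by
    have h1 := IdentDistrib.pi (fun i : ℕ => (h.ident (k + i)).trans (h.ident i).symm)
      (h.indep.precomp (g := fun i => k + i) (add_right_injective k)) h.indep
    exact h1.comp (u := fun v : ℕ → ℤ => ∑ i ∈ Finset.range l, v i) (by fun_prop)
  rw [hset, hind.measure_inter_preimage_eq_mul _ _ (measurableSet_singleton _)
    (measurableSet_singleton _), hlaw.measure_preimage_eq (measurableSet_singleton _)]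
  rfl

theorem measure_visitEvent (h : IsRenewalSteps P X) (x : ℤ) :
    P (visitEvent X x) = ∑' k, P {w | walk X k w = x} := by
  have : visitEvent X x = ⋃ k, {w | walk X k w = x} := by ext w; simp [visitEvent]
  rw [this, measure_iUnion₀]
  · intro i j hij
    refine measure_mono_null ?_ (ae_iff.1 h.pos)
    rintro w ⟨hi, hj⟩ hw
    simp only [Set.mem_ofPred_eq] at hi hj
    exact hij ((walk_strictMono hw).injective (hi.trans hj.symm))
  · exact fun k => (measurable_walk h.meas k (measurableSet_singleton x)).nullMeasurableSet

/-- The renewal property at a visited site. -/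
theorem measure_visitEvent_inter [IsProbabilityMeasure P] (h : IsRenewalSteps P X) {x y : ℤ}
    (hxy : x ≤ y) :
    P (visitEvent X x ∩ visitEvent X y) = P (visitEvent X x) * P (visitEvent X (y - x)) := by
  have hset : (visitEvent X x ∩ visitEvent X y : Set Ω') =ᵐ[P]
      ⋃ p : ℕ × ℕ, {w | walk X p.1 w = x ∧ walk X (p.1 + p.2) w = y} := by
    refine Filter.eventuallyEq_set.2 ?_
    filter_upwards [h.pos] with w hw
    simp only [visitEvent, Set.mem_inter_iff, Set.mem_ofPred_eq, Set.mem_iUnion, Prod.exists]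
    constructor
    · rintro ⟨⟨k, hk⟩, ⟨l, hl⟩⟩
      have hkl : k ≤ l := (walk_strictMono hw).le_iff_le.1 (by simp only [hk, hl, hxy])
      exact ⟨k, l - k, hk, by rw [Nat.add_sub_cancel' hkl]; exact hl⟩
    · rintro ⟨k, l, h1, h2⟩
      exact ⟨⟨k, h1⟩, ⟨k + l, h2⟩⟩
  rw [measure_congr hset, measure_iUnion₀]
  · rw [ENNReal.tsum_prod']
    simp_rw [measure_walk_eq_and_walk_add_eq h, ENNReal.tsum_mul_left, ENNReal.tsum_mul_right]
    rw [measure_visitEvent h, measure_visitEvent h]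
  · intro p q hpq
    refine measure_mono_null ?_ (ae_iff.1 h.pos)
    rintro w ⟨hi, hj⟩ hw
    simp only [Set.mem_ofPred_eq] at hi hj
    have h1 := (walk_strictMono hw).injective (hi.1.trans hj.1.symm)
    have h2 := (walk_strictMono hw).injective (hi.2.trans hj.2.symm)
    exact hpq (Prod.ext h1 (by omega))
  · exact fun p => ((measurable_walk h.meas _ (measurableSet_singleton x)).inter
      (measurable_walk h.meas _ (measurableSet_singleton y))).nullMeasurableSet

theorem measurable_jointVisit (hX : ∀ k, Measurable (X k)) (q : ℝ) (x : ℤ) :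
    Measurable (jointVisit X q x) :=
  (measurable_const.indicator
    ((measurableSet_visitEvent hX x).prod (measurableSet_visitEvent hX x))).sub_const q

theorem integrable_jointVisit_mul [IsProbabilityMeasure P] (hX : ∀ k, Measurable (X k)) {q : ℝ}
    (hq0 : 0 ≤ q) (hq1 : q ≤ 1) (x y : ℤ) :
    Integrable (fun p => jointVisit X q x p * jointVisit X q y p) (P.prod P) := by
  refine Integrable.of_bound (C := 1) ((measurable_jointVisit hX q x).mul
    (measurable_jointVisit hX q y)).aestronglyMeasurable (Eventually.of_forall fun p => ?_)
  rw [Real.norm_eq_abs, abs_mul]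
  exact mul_le_one₀ (abs_jointVisit_le hq0 hq1 x p) (abs_nonneg _) (abs_jointVisit_le hq0 hq1 y p)

theorem integral_jointVisit_mul [IsProbabilityMeasure P] (h : IsRenewalSteps P X) (q : ℝ)
    {x y : ℤ} (hxy : x ≤ y) :
    ∫ p, jointVisit X q x p * jointVisit X q y p ∂(P.prod P)
      = (renewalProb P X x * renewalProb P X (y - x)) ^ 2 - q * renewalProb P X x ^ 2
        - q * renewalProb P X y ^ 2 + q ^ 2 := by
  set A := visitEvent X x
  set B := visitEvent X y
  have hA : MeasurableSet (A ×ˢ A) :=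
    (measurableSet_visitEvent h.meas x).prod (measurableSet_visitEvent h.meas x)
  have hB : MeasurableSet (B ×ˢ B) :=
    (measurableSet_visitEvent h.meas y).prod (measurableSet_visitEvent h.meas y)
  have hpt : ∀ p, jointVisit X q x p * jointVisit X q y p =
      ((A ∩ B) ×ˢ (A ∩ B)).indicator (fun _ => (1 : ℝ)) p
        - q * (A ×ˢ A).indicator (fun _ => (1 : ℝ)) p
        - q * (B ×ˢ B).indicator (fun _ => (1 : ℝ)) p + q ^ 2 := by
    intro p
    have : ((A ∩ B) ×ˢ (A ∩ B)).indicator (fun _ => (1 : ℝ)) p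
        = (A ×ˢ A).indicator (fun _ => (1 : ℝ)) p * (B ×ˢ B).indicator (fun _ => (1 : ℝ)) p := by
      rw [← Set.prod_inter_prod]
      by_cases h1 : p ∈ A ×ˢ A <;> by_cases h2 : p ∈ B ×ˢ B <;>
        simp only [Set.indicator, Set.mem_inter_iff, h1, h2, and_true, and_false, if_true,
          if_false, mul_one, mul_zero]
    rw [this]
    unfold jointVisit
    ring
  have hAB : MeasurableSet ((A ∩ B) ×ˢ (A ∩ B)) := by
    rw [← Set.prod_inter_prod]; exact hA.inter hB
  have i1 : ∀ {S : Set (Ω' × Ω')}, MeasurableSet S →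
      Integrable (S.indicator (fun _ => (1 : ℝ))) (P.prod P) :=
    fun hS => (integrable_const _).indicator hS
  have i2 : Integrable (fun p => ((A ∩ B) ×ˢ (A ∩ B)).indicator (fun _ => (1 : ℝ)) p
      - q * (A ×ˢ A).indicator (fun _ => (1 : ℝ)) p) (P.prod P) :=
    (i1 hAB).sub ((i1 hA).const_mul q)
  have i3 : Integrable (fun p => ((A ∩ B) ×ˢ (A ∩ B)).indicator (fun _ => (1 : ℝ)) p
      - q * (A ×ˢ A).indicator (fun _ => (1 : ℝ)) p
      - q * (B ×ˢ B).indicator (fun _ => (1 : ℝ)) p) (P.prod P) :=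
    i2.sub ((i1 hB).const_mul q)
  simp_rw [hpt]
  rw [integral_add i3 (integrable_const _), integral_sub i2 ((i1 hB).const_mul q),
    integral_sub (i1 hAB) ((i1 hA).const_mul q), integral_const_mul, integral_const_mul,
    integral_indicator_const _ hAB, integral_indicator_const _ hA, integral_indicator_const _ hB]
  simp only [measureReal_prod_prod]
  have hjoint : P.real (A ∩ B) = renewalProb P X x * renewalProb P X (y - x) := by
    simp only [measureReal_def, renewalProb, A, B, measure_visitEvent_inter h hxy,
      ENNReal.toReal_mul]
  rw [hjoint]
  simp [renewalProb, A, B]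
  ring

theorem integral_sq_sum_range_succ {α : Type*} [MeasurableSpace α] {ν : Measure α}
    {f : ℕ → α → ℝ} (hf : ∀ i j, Integrable (fun p => f i p * f j p) ν) (M : ℕ) :
    ∫ p, (∑ i ∈ Finset.range (M + 1), f i p) ^ 2 ∂ν
      = ∫ p, (∑ i ∈ Finset.range M, f i p) ^ 2 ∂ν
        + 2 * ∑ i ∈ Finset.range M, ∫ p, f i p * f M p ∂ν + ∫ p, f M p * f M p ∂ν := by
  have h1 : ∀ p, (∑ i ∈ Finset.range (M + 1), f i p) ^ 2
      = (∑ i ∈ Finset.range M, f i p) ^ 2 + 2 * ∑ i ∈ Finset.range M, f i p * f M p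
        + f M p * f M p := by
    intro p
    rw [Finset.sum_range_succ, ← Finset.sum_mul]
    ring
  have h2 : Integrable (fun p => (∑ i ∈ Finset.range M, f i p) ^ 2) ν := by
    simp_rw [sq, Finset.sum_mul_sum]
    exact integrable_finsetSum _ fun i _ => integrable_finsetSum _ fun j _ => hf i j
  have h3 : Integrable (fun p => 2 * ∑ i ∈ Finset.range M, f i p * f M p) ν :=
    (integrable_finsetSum _ fun i _ => hf i M).const_mul 2
  have h4 : Integrable (fun p => (∑ i ∈ Finset.range M, f i p) ^ 2
      + 2 * ∑ i ∈ Finset.range M, f i p * f M p) ν := h2.add h3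
  simp_rw [h1]
  rw [integral_add h4 (hf M M), integral_add h2 h3, integral_const_mul,
    integral_finsetSum _ fun i _ => hf i M]

/-- Writing `u` for the renewal function and `q = 1 / m ^ 2`, the correlation of the centred joint
visits at sites `x < y` is `u(x)² (u(y - x)² - q) - q (u(y)² - q)`. The errors `|u(d)² - q|` are
square summable, so they sum over `d ≤ N` to `O(√N)` by Cauchy-Schwarz, and the second moment is
`O(N √N)`. -/
theorem exists_integral_sq_jointVisit_le [IsProbabilityMeasure P] (h : IsRenewalSteps P X)
    (haper : IsAperiodic (P.map (X 0)).support)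
    (hint : Integrable (fun w => (X 0 w : ℝ)) P) (hsq : Integrable (fun w => (X 0 w : ℝ) ^ 2) P)
    {m : ℝ} (hm : m = ∫ w, (X 0 w : ℝ) ∂P) :
    ∃ K : ℝ, 0 ≤ K ∧ ∀ N : ℕ,
      ∫ p, (∑ i ∈ Finset.range N, jointVisit X (1 / m ^ 2) ((i + 1 : ℕ) : ℤ) p) ^ 2 ∂(P.prod P)
        ≤ K * ((N + 1) * √(N + 1)) := by
  obtain ⟨C, hC0, hC⟩ := exists_sum_sq_renewalProb_sub_le h haper hint hsq hm
  have hm1 : 1 ≤ m := hm ▸ one_le_mean h hint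
  set q : ℝ := 1 / m ^ 2 with hq
  have hq0 : 0 ≤ q := by positivity
  have hq1 : q ≤ 1 := by rw [hq, div_le_one (by positivity)]; exact one_le_pow₀ hm1
  let u : ℕ → ℝ := fun d => renewalProb P X (d : ℤ)
  have hu0 : ∀ d, 0 ≤ u d := fun d => renewalProb_nonneg _
  have hu1 : ∀ d, u d ≤ 1 := fun d => renewalProb_le_one _
  let e : ℕ → ℝ := fun d => |u d ^ 2 - q|
  have he0 : ∀ d, 0 ≤ e d := fun d => abs_nonneg _
  refine ⟨2 + 8 * C, by positivity, fun N => ?_⟩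
  have hE : ∑ d ∈ Finset.range (N + 1), e d ≤ 2 * C * √(N + 1) := by
    have h1 : ∀ d, e d ≤ 2 * |u d - 1 / m| := by
      intro d
      have : u d ^ 2 - q = (u d + 1 / m) * (u d - 1 / m) := by rw [hq]; ring
      simp only [e]
      rw [this, abs_mul]
      gcongr
      have h2 : 0 ≤ 1 / m := by positivity
      have h3 : 1 / m ≤ 1 := by rw [div_le_one (by linarith)]; exact hm1
      rw [abs_of_nonneg (by linarith [hu0 d])]
      linarith [hu1 d]
    have h2 : (∑ d ∈ Finset.range (N + 1), |u d - 1 / m|) ≤ C * √(N + 1) := by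
      refine abs_le_of_sq_le_sq' (a := _) ?_ (by positivity) |>.2
      calc _ ≤ ((Finset.range (N + 1)).card : ℝ) * ∑ d ∈ Finset.range (N + 1), |u d - 1 / m| ^ 2 :=
            sq_sum_le_card_mul_sum_sq
        _ ≤ (N + 1) * C ^ 2 := by
            simp only [Finset.card_range, sq_abs]
            push_cast
            gcongr
            exact hC _
        _ = (C * √(N + 1)) ^ 2 := by rw [mul_pow, Real.sq_sqrt (by positivity)]; ring
    calc _ ≤ ∑ d ∈ Finset.range (N + 1), 2 * |u d - 1 / m| := Finset.sum_le_sum fun d _ => h1 d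
      _ = 2 * ∑ d ∈ Finset.range (N + 1), |u d - 1 / m| := by rw [Finset.mul_sum]
      _ ≤ _ := by linarith
  set E := ∑ d ∈ Finset.range (N + 1), e d with hEdef
  let f : ℕ → Ω' × Ω' → ℝ := fun i => jointVisit X q ((i + 1 : ℕ) : ℤ)
  have hf : ∀ i j, Integrable (fun p => f i p * f j p) (P.prod P) := fun i j =>
    integrable_jointVisit_mul h.meas hq0 hq1 _ _
  have hdiag : ∀ i, ∫ p, f i p * f i p ∂(P.prod P) ≤ 2 := by
    intro i
    have : ∫ p, f i p * f i p ∂(P.prod P) ≤ ∫ p, (1 : ℝ) ∂(P.prod P) := by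
      refine integral_mono (hf i i) (integrable_const _) fun p => ?_
      have := abs_jointVisit_le (X := X) hq0 hq1 ((i + 1 : ℕ) : ℤ) p
      simp only [f]
      rw [← abs_mul_abs_self]
      exact mul_le_one₀ this (abs_nonneg _) this
    simp at this
    linarith
  have hoff : ∀ i j, i < j → ∫ p, f i p * f j p ∂(P.prod P) ≤ e (j - i) + e (j + 1) := by
    intro i j hij
    simp only [f]
    rw [integral_jointVisit_mul h q (by push_cast; omega)]
    have hji : (((j + 1 : ℕ) : ℤ) - ((i + 1 : ℕ) : ℤ)) = ((j - i : ℕ) : ℤ) := by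
      push_cast [hij.le]; ring
    rw [hji]
    change (u (i + 1) * u (j - i)) ^ 2 - q * u (i + 1) ^ 2 - q * u (j + 1) ^ 2 + q ^ 2 ≤ _
    have h1 : (u (i + 1) * u (j - i)) ^ 2 - q * u (i + 1) ^ 2 - q * u (j + 1) ^ 2 + q ^ 2
        = u (i + 1) ^ 2 * (u (j - i) ^ 2 - q) - q * (u (j + 1) ^ 2 - q) := by ring
    rw [h1]
    have h2 : u (i + 1) ^ 2 * (u (j - i) ^ 2 - q) ≤ 1 * e (j - i) := by
      have h3 : u (i + 1) ^ 2 ≤ 1 := pow_le_one₀ (hu0 _) (hu1 _)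
      calc _ ≤ u (i + 1) ^ 2 * e (j - i) :=
            mul_le_mul_of_nonneg_left (le_abs_self _) (sq_nonneg _)
        _ ≤ _ := mul_le_mul_of_nonneg_right h3 (he0 _)
    have h4 : -(q * (u (j + 1) ^ 2 - q)) ≤ 1 * e (j + 1) := by
      rw [← mul_neg]
      calc _ ≤ q * e (j + 1) := mul_le_mul_of_nonneg_left (neg_le_abs _) hq0
        _ ≤ _ := mul_le_mul_of_nonneg_right hq1 (he0 _)
    linarith
  have hind : ∀ M, M ≤ N → ∫ p, (∑ i ∈ Finset.range M, f i p) ^ 2 ∂(P.prod P)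
      ≤ M * (2 + 2 * E) + 2 * N * ∑ j ∈ Finset.range M, e (j + 1) := by
    intro M
    induction M with
    | zero => intro _; simp
    | succ M ih =>
      intro hM
      rw [integral_sq_sum_range_succ hf]
      have h1 : ∑ i ∈ Finset.range M, ∫ p, f i p * f M p ∂(P.prod P) ≤ E + N * e (M + 1) := by
        calc _ ≤ ∑ i ∈ Finset.range M, (e (M - i) + e (M + 1)) :=
              Finset.sum_le_sum fun i hi => hoff i M (Finset.mem_range.1 hi)
          _ = ∑ i ∈ Finset.range M, e (M - i) + M * e (M + 1) := by
              rw [Finset.sum_add_distrib]; simp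
          _ ≤ E + N * e (M + 1) := by
              have h2 : ∑ i ∈ Finset.range M, e (M - i) = ∑ i ∈ Finset.range M, e (i + 1) := by
                rw [← Finset.sum_range_reflect (fun i => e (i + 1))]
                refine Finset.sum_congr rfl fun i hi => ?_
                have := Finset.mem_range.1 hi
                congr 1; omega
              have h3 : ∑ i ∈ Finset.range M, e (i + 1) ≤ E := by
                have h4 : ∑ i ∈ Finset.range M, e (i + 1) ≤ ∑ i ∈ Finset.range (M + 1), e i := by
                  rw [Finset.sum_range_succ']; linarith [he0 0]
                exact h4.trans (Finset.sum_le_sum_of_subset_of_nonneg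
                  (Finset.range_mono (by omega)) fun i _ _ => he0 i)
              rw [h2]
              have h5 : (M : ℝ) ≤ N := by exact_mod_cast (by omega : M ≤ N)
              have := mul_le_mul_of_nonneg_right h5 (he0 (M + 1))
              linarith
      have h2 := ih (by omega)
      have h3 := hdiag M
      rw [Finset.sum_range_succ]
      push_cast
      nlinarith
  have hfin := hind N le_rfl
  have hE2 : ∑ j ∈ Finset.range N, e (j + 1) ≤ E := by
    rw [hEdef, Finset.sum_range_succ']; linarith [he0 0]
  have hs1 : 1 ≤ √((N : ℝ) + 1) := by
    rw [Real.one_le_sqrt]; linarith [Nat.cast_nonneg (α := ℝ) N]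
  have hN : (0 : ℝ) ≤ N := Nat.cast_nonneg N
  calc _ ≤ N * (2 + 2 * E) + 2 * N * ∑ j ∈ Finset.range N, e (j + 1) := hfin
    _ ≤ N * (2 + 2 * E) + 2 * N * E := by gcongr
    _ = N * (2 + 4 * E) := by ring
    _ ≤ N * (2 + 4 * (2 * C * √(N + 1))) := by gcongr
    _ ≤ (N + 1) * (2 * √(N + 1) + 4 * (2 * C * √(N + 1))) := by
        gcongr
        · linarith
        · linarith
    _ = _ := by ring

end Overlap

/-! ### Overlap of two independent walks -/

/-- The set `{S_1, …, S_n}` of sites visited by the walk up to time `n`. The starting point is left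
out, as in the random walk in random scenery. -/
def visitedRange {Ω' : Type*} (X : ℕ → Ω' → ℤ) (n : ℕ) (w : Ω') : Finset ℤ :=
  (Finset.Icc 1 n).image fun k => walk X k w

open Classical in
/-- The sites of `{1, …, N}` that the walk visits at some time. -/
noncomputable def visitedSites {Ω' : Type*} (X : ℕ → Ω' → ℤ) (N : ℕ) (w : Ω') : Finset ℤ :=
  (Finset.Icc (1 : ℤ) N).filter fun x => w ∈ visitEvent X x

section Path

variable {Ω' : Type*} {X : ℕ → Ω' → ℤ} {w w' : Ω'}

theorem mem_visitedRange {n : ℕ} {x : ℤ} :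
    x ∈ visitedRange X n w ↔ ∃ k, (1 ≤ k ∧ k ≤ n) ∧ walk X k w = x := by
  simp [visitedRange]

theorem mem_visitedSites {N : ℕ} {x : ℤ} :
    x ∈ visitedSites X N w ↔ (1 ≤ x ∧ x ≤ N) ∧ ∃ k, walk X k w = x := by
  classical
  rw [visitedSites, Finset.mem_filter, Finset.mem_Icc]
  rfl

theorem card_visitedRange (hw : ∀ k, 0 < X k w) (n : ℕ) : (visitedRange X n w).card = n := by
  rw [visitedRange, Finset.card_image_of_injective _ (walk_strictMono hw).injective]
  simp

/-- A strictly increasing walk never revisits a site, so the random walk in random scenery is a sum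
of `n` distinct scenery variables. -/
theorem sceneryWalk_eq_sum (ξ : ℤ → ℝ) (hw : ∀ k, 0 < X k w) (n : ℕ) :
    sceneryWalk ξ X n w = ∑ x ∈ visitedRange X n w, ξ x := by
  rw [visitedRange, Finset.sum_image fun i _ j _ hij => (walk_strictMono hw).injective hij]
  rfl

theorem visitedRange_sdiff_subset (hw : ∀ k, 0 < X k w) (n N : ℕ) :
    visitedRange X n w \ Finset.Icc (1 : ℤ) N ⊆ Finset.Ioc (N : ℤ) (walk X n w) := by
  intro x hx
  simp only [Finset.mem_sdiff, mem_visitedRange, Finset.mem_Icc, not_and, not_le,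
    Finset.mem_Ioc] at hx ⊢
  obtain ⟨⟨k, ⟨hk1, hkn⟩, rfl⟩, h2⟩ := hx
  have := natCast_le_walk hw k
  exact ⟨h2 (by omega), (walk_strictMono hw).monotone hkn⟩

theorem visitedRange_sdiff_visitedSites (n N : ℕ) :
    visitedRange X n w \ visitedSites X N w = visitedRange X n w \ Finset.Icc (1 : ℤ) N := by
  ext x
  simp only [Finset.mem_sdiff, mem_visitedRange, mem_visitedSites, Finset.mem_Icc]
  constructor
  · rintro ⟨⟨k, hk, rfl⟩, h2⟩
    exact ⟨⟨k, hk, rfl⟩, fun h3 => h2 ⟨h3, k, rfl⟩⟩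
  · rintro ⟨h1, h2⟩
    exact ⟨h1, fun h3 => h2 h3.1⟩

theorem visitedSites_sdiff_subset (hw : ∀ k, 0 < X k w) (n N : ℕ) :
    visitedSites X N w \ visitedRange X n w ⊆ Finset.Ioc (walk X n w) (N : ℤ) := by
  intro x hx
  simp only [Finset.mem_sdiff, mem_visitedRange, mem_visitedSites, Finset.mem_Ioc, not_exists,
    not_and] at hx ⊢
  obtain ⟨⟨⟨h1, h2⟩, k, rfl⟩, h3⟩ := hx
  refine ⟨(walk_strictMono hw).lt_iff_lt.2 ?_, h2⟩
  by_contra hc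
  refine h3 k ⟨?_, by omega⟩ rfl
  by_contra h4
  obtain rfl : k = 0 := by omega
  simp [walk_zero] at h1

theorem card_Ioc_le_abs (a b : ℤ) : ((Finset.Ioc a b).card : ℝ) ≤ |(b : ℝ) - a| := by
  have : ((Finset.Ioc a b).card : ℤ) ≤ |b - a| := by
    rw [Int.card_Ioc, Int.toNat_eq_max]
    exact max_le (le_abs_self _) (abs_nonneg _)
  exact_mod_cast this

theorem card_visitedRange_sdiff_Icc_le (hw : ∀ k, 0 < X k w) (n N : ℕ) :
    ((visitedRange X n w \ Finset.Icc (1 : ℤ) N).card : ℝ) ≤ |(walk X n w : ℝ) - N| := by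
  refine (Nat.cast_le.2 (Finset.card_le_card (visitedRange_sdiff_subset hw n N))).trans ?_
  exact_mod_cast card_Ioc_le_abs (N : ℤ) (walk X n w)

theorem abs_card_visitedRange_inter_Icc_sub_le (hw : ∀ k, 0 < X k w) (n N : ℕ) :
    |((visitedRange X n w ∩ Finset.Icc (1 : ℤ) N).card : ℝ) - n| ≤ |(walk X n w : ℝ) - N| := by
  have h1 := Finset.card_inter_add_card_sdiff (visitedRange X n w) (Finset.Icc (1 : ℤ) N)
  rw [card_visitedRange hw] at h1
  have h2 : ((visitedRange X n w ∩ Finset.Icc (1 : ℤ) N).card : ℝ)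
      + ((visitedRange X n w \ Finset.Icc (1 : ℤ) N).card : ℝ) = n := by exact_mod_cast h1
  rw [← h2, sub_add_cancel_left, abs_neg, abs_of_nonneg (Nat.cast_nonneg _)]
  exact card_visitedRange_sdiff_Icc_le hw n N

theorem card_inter_le_add {α : Type*} [DecidableEq α] (A A' B B' : Finset α) :
    (A ∩ A').card ≤ (B ∩ B').card + (A \ B).card + (A' \ B').card := by
  refine (Finset.card_le_card (t := (B ∩ B') ∪ (A \ B) ∪ (A' \ B')) ?_).trans
    ((Finset.card_union_le _ _).trans (Nat.add_le_add_right (Finset.card_union_le _ _) _))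
  intro x hx
  simp only [Finset.mem_inter, Finset.mem_union, Finset.mem_sdiff] at hx ⊢
  tauto

/-- Comparison of stopping two walks after `n` steps with stopping them at the site `N`: the visited
sets of one walk differ only on sites between `S_n` and `N`. -/
theorem abs_card_inter_sub_le (hw : ∀ k, 0 < X k w) (hw' : ∀ k, 0 < X k w') (n N : ℕ) :
    |((visitedRange X n w ∩ visitedRange X n w').card : ℝ)
        - ((visitedSites X N w ∩ visitedSites X N w').card : ℝ)|
      ≤ |(walk X n w : ℝ) - N| + |(walk X n w' : ℝ) - N| := by
  have key : ∀ {v : Ω'}, (∀ k, 0 < X k v) →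
      ((visitedRange X n v \ visitedSites X N v).card : ℝ) ≤ |(walk X n v : ℝ) - N| ∧
      ((visitedSites X N v \ visitedRange X n v).card : ℝ) ≤ |(walk X n v : ℝ) - N| := by
    intro v hv
    constructor
    · rw [visitedRange_sdiff_visitedSites]
      exact card_visitedRange_sdiff_Icc_le hv n N
    · refine (Nat.cast_le.2 (Finset.card_le_card (visitedSites_sdiff_subset hv n N))).trans ?_
      rw [abs_sub_comm]
      exact_mod_cast card_Ioc_le_abs (walk X n v) (N : ℤ)
  have h1 : ((visitedRange X n w ∩ visitedRange X n w').card : ℝ)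
      ≤ ((visitedSites X N w ∩ visitedSites X N w').card : ℝ)
        + ((visitedRange X n w \ visitedSites X N w).card : ℝ)
        + ((visitedRange X n w' \ visitedSites X N w').card : ℝ) := by
    exact_mod_cast card_inter_le_add _ _ _ _
  have h2 : ((visitedSites X N w ∩ visitedSites X N w').card : ℝ)
      ≤ ((visitedRange X n w ∩ visitedRange X n w').card : ℝ)
        + ((visitedSites X N w \ visitedRange X n w).card : ℝ)
        + ((visitedSites X N w' \ visitedRange X n w').card : ℝ) := by
    exact_mod_cast card_inter_le_add _ _ _ _
  obtain ⟨h3, h4⟩ := key hw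
  obtain ⟨h5, h6⟩ := key hw'
  rw [abs_le]
  constructor <;> linarith

theorem sum_jointVisit (X : ℕ → Ω' → ℤ) (q : ℝ) (N : ℕ) (p : Ω' × Ω') :
    ∑ i ∈ Finset.range N, jointVisit X q ((i + 1 : ℕ) : ℤ) p
      = ((visitedSites X N p.1 ∩ visitedSites X N p.2).card : ℝ) - N * q := by
  classical
  have h1 : visitedSites X N p.1 ∩ visitedSites X N p.2
      = ((Finset.range N).image fun i : ℕ => ((i + 1 : ℕ) : ℤ)).filter
        fun x => p ∈ visitEvent X x ×ˢ visitEvent X x := by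
    ext x
    simp only [visitedSites, Finset.mem_inter, Finset.mem_filter, Finset.mem_Icc,
      Finset.mem_image, Finset.mem_range, Set.mem_prod]
    constructor
    · rintro ⟨⟨⟨h1, h2⟩, h3⟩, _, h4⟩
      exact ⟨⟨(x - 1).toNat, by omega, by omega⟩, h3, h4⟩
    · rintro ⟨⟨i, hi, rfl⟩, h3, h4⟩
      have : (1 : ℤ) ≤ ((i + 1 : ℕ) : ℤ) ∧ ((i + 1 : ℕ) : ℤ) ≤ N := by omega
      exact ⟨⟨this, h3⟩, this, h4⟩
  rw [h1, Finset.card_filter, Finset.sum_image (fun i _ j _ hij => by simpa using hij)]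
  simp [jointVisit, Finset.sum_sub_distrib, Set.indicator_apply]

end Path

section Measurability

variable {Ω' : Type*} [MeasurableSpace Ω'] {P : Measure Ω'} {X : ℕ → Ω' → ℤ}

/-- Any function of the visited sets is measurable, because it is a function of finitely many
integer positions. -/
theorem measurable_apply_visitedRange_prod (hX : ∀ k, Measurable (X k)) (n : ℕ)
    (g : Finset ℤ → Finset ℤ → ℝ) :
    Measurable fun p : Ω' × Ω' => g (visitedRange X n p.1) (visitedRange X n p.2) := by
  let G : (Fin (n + 1) → ℤ) → Finset ℤ := fun s =>
    ((Finset.univ : Finset (Fin (n + 1))).filter fun k : Fin (n + 1) => 1 ≤ (k : ℕ)).image s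
  have hG : ∀ w, visitedRange X n w = G fun k => walk X k w := by
    intro w
    ext x
    simp only [mem_visitedRange, G, Finset.mem_image, Finset.mem_filter, Finset.mem_univ, true_and]
    constructor
    · rintro ⟨k, hk, rfl⟩
      exact ⟨⟨k, by omega⟩, hk.1, rfl⟩
    · rintro ⟨k, hk, rfl⟩
      exact ⟨k, ⟨hk, by omega⟩, rfl⟩
  simp_rw [hG]
  have h1 : Measurable fun w : Ω' => fun k : Fin (n + 1) => walk X k w :=
    measurable_pi_lambda _ fun k => measurable_walk hX k
  have h2 : Measurable fun q : (Fin (n + 1) → ℤ) × (Fin (n + 1) → ℤ) => g (G q.1) (G q.2) :=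
    Measurable.of_discrete
  exact h2.comp ((h1.comp measurable_fst).prodMk (h1.comp measurable_snd))

theorem measurable_apply_visitedRange (hX : ∀ k, Measurable (X k)) (n : ℕ)
    (g : Finset ℤ → ℝ) : Measurable fun w : Ω' => g (visitedRange X n w) :=
  (measurable_apply_visitedRange_prod hX n fun A _ => g A).comp
    (measurable_id.prodMk measurable_id)

theorem integral_abs_le_sqrt [IsProbabilityMeasure P] {f : Ω' → ℝ} (hf : MemLp f 2 P) :
    ∫ w, |f w| ∂P ≤ √(∫ w, f w ^ 2 ∂P) := by
  have h := variance_nonneg |f| P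
  rw [variance_eq_sub hf.abs] at h
  simp only [Pi.pow_apply, Pi.abs_apply, sq_abs] at h
  exact Real.le_sqrt_of_sq_le (by linarith)

theorem memLp_step (h : IsRenewalSteps P X) (hsq : Integrable (fun w => (X 0 w : ℝ) ^ 2) P)
    (k : ℕ) : MemLp (fun w => (X k w : ℝ)) 2 P := by
  have h0 : MemLp (fun w => (X 0 w : ℝ)) 2 P :=
    (memLp_two_iff_integrable_sq
      ((measurable_from_top (f := fun z : ℤ => (z : ℝ))).comp
        (h.meas 0)).aestronglyMeasurable).2 hsq
  exact ((h.ident k).comp (u := fun z : ℤ => (z : ℝ)) measurable_from_top).memLp_iff.2 h0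

theorem memLp_walk (h : IsRenewalSteps P X) (hsq : Integrable (fun w => (X 0 w : ℝ) ^ 2) P)
    (n : ℕ) : MemLp (fun w => (walk X n w : ℝ)) 2 P := by
  simp only [walk, Int.cast_sum]
  exact memLp_finsetSum _ fun k _ => memLp_step h hsq k

theorem variance_walk [IsProbabilityMeasure P] (h : IsRenewalSteps P X)
    (hsq : Integrable (fun w => (X 0 w : ℝ) ^ 2) P) (n : ℕ) :
    Var[fun w => (walk X n w : ℝ); P] = n * Var[fun w => (X 0 w : ℝ); P] := by
  have h1 : (fun w => (walk X n w : ℝ)) = ∑ k ∈ Finset.range n, fun w => (X k w : ℝ) := by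
    ext w; simp [walk]
  have hc : Measurable fun z : ℤ => (z : ℝ) := measurable_from_top
  rw [h1, IndepFun.variance_sum fun k _ => memLp_step h hsq k]
  · have : ∀ k, Var[fun w => (X k w : ℝ); P] = Var[fun w => (X 0 w : ℝ); P] := fun k =>
      ((h.ident k).comp hc).variance_eq
    simp [this]
  · intro i _ j _ hij
    exact (h.indep.indepFun hij).comp hc hc

theorem integral_walk [IsProbabilityMeasure P] (h : IsRenewalSteps P X)
    (hint : Integrable (fun w => (X 0 w : ℝ)) P) (n : ℕ) :
    ∫ w, (walk X n w : ℝ) ∂P = n * ∫ w, (X 0 w : ℝ) ∂P := by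
  have hc : Measurable fun z : ℤ => (z : ℝ) := measurable_from_top
  have hid : ∀ k, IdentDistrib (fun w => (X k w : ℝ)) (fun w => (X 0 w : ℝ)) P P := fun k =>
    (h.ident k).comp hc
  simp only [walk, Int.cast_sum]
  rw [integral_finsetSum _ fun k _ => (hid k).integrable_iff.2 hint]
  simp [fun k => (hid k).integral_eq]

theorem integrable_abs_walk_sub [IsProbabilityMeasure P] (h : IsRenewalSteps P X)
    (hsq : Integrable (fun w => (X 0 w : ℝ) ^ 2) P) (n : ℕ) (a : ℝ) :
    Integrable (fun w => |(walk X n w : ℝ) - a|) P :=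
  (((memLp_walk h hsq n).integrable one_le_two).sub (integrable_const a)).abs

/-- By the variance bound, `S_n` is within `O(√n)` of its mean `n m` in the first moment. -/
theorem exists_integral_abs_walk_sub_le [IsProbabilityMeasure P] (h : IsRenewalSteps P X)
    (hint : Integrable (fun w => (X 0 w : ℝ)) P) (hsq : Integrable (fun w => (X 0 w : ℝ) ^ 2) P)
    {m : ℝ} (hm : m = ∫ w, (X 0 w : ℝ) ∂P) :
    ∃ C : ℝ, 0 ≤ C ∧ ∀ n : ℕ, 1 ≤ n →
      ∫ w, |(walk X n w : ℝ) - (⌊n * m⌋₊ : ℝ)| ∂P ≤ C * √n := by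
  have hm1 : 1 ≤ m := hm ▸ one_le_mean h hint
  refine ⟨√(Var[fun w => (X 0 w : ℝ); P]) + 1, by positivity, fun n hn => ?_⟩
  have h1 : ∫ w, |(walk X n w : ℝ) - n * m| ∂P ≤ √n * √(Var[fun w => (X 0 w : ℝ); P]) := by
    refine (integral_abs_le_sqrt ((memLp_walk h hsq n).sub (memLp_const (n * m)))).trans ?_
    rw [← Real.sqrt_mul (Nat.cast_nonneg n), ← variance_walk h hsq,
      variance_eq_integral (memLp_walk h hsq n).aestronglyMeasurable.aemeasurable,
      integral_walk h hint, ← hm]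
    rfl
  have h2 : ∀ w, |(walk X n w : ℝ) - (⌊n * m⌋₊ : ℝ)| ≤ |(walk X n w : ℝ) - n * m| + 1 := by
    intro w
    have h3 := Nat.floor_le (a := (n : ℝ) * m) (by positivity)
    have h4 := Nat.lt_floor_add_one ((n : ℝ) * m)
    calc _ = |((walk X n w : ℝ) - n * m) + (n * m - (⌊n * m⌋₊ : ℝ))| := by ring_nf
      _ ≤ _ + |n * m - (⌊n * m⌋₊ : ℝ)| := abs_add_le _ _
      _ ≤ _ := by
        gcongr
        rw [abs_le]; constructor <;> linarith
  have h3 : (1 : ℝ) ≤ √n := by rw [Real.one_le_sqrt]; exact_mod_cast hn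
  calc _ ≤ ∫ w, (|(walk X n w : ℝ) - n * m| + 1) ∂P :=
        integral_mono (integrable_abs_walk_sub h hsq n _)
          ((integrable_abs_walk_sub h hsq n _).add (integrable_const 1)) h2
    _ = ∫ w, |(walk X n w : ℝ) - n * m| ∂P + 1 := by
        rw [integral_add (integrable_abs_walk_sub h hsq n _) (integrable_const 1)]; simp
    _ ≤ √n * √(Var[fun w => (X 0 w : ℝ); P]) + √n := by linarith
    _ = _ := by ring

theorem integrable_abs_card_inter_Icc_sub [IsProbabilityMeasure P] (h : IsRenewalSteps P X)
    (hsq : Integrable (fun w => (X 0 w : ℝ) ^ 2) P) (n N : ℕ) :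
    Integrable (fun w => |((visitedRange X n w ∩ Finset.Icc (1 : ℤ) N).card : ℝ) - n|) P := by
  refine (integrable_abs_walk_sub h hsq n N).mono'
    (measurable_apply_visitedRange h.meas n
      fun A => |((A ∩ Finset.Icc (1 : ℤ) N).card : ℝ) - n|).aestronglyMeasurable ?_
  filter_upwards [h.pos] with w hw
  rw [Real.norm_eq_abs, abs_abs]
  exact abs_card_visitedRange_inter_Icc_sub_le hw n N

theorem exists_integral_abs_card_inter_Icc_sub_le [IsProbabilityMeasure P]
    (h : IsRenewalSteps P X)
    (hint : Integrable (fun w => (X 0 w : ℝ)) P) (hsq : Integrable (fun w => (X 0 w : ℝ) ^ 2) P)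
    {m : ℝ} (hm : m = ∫ w, (X 0 w : ℝ) ∂P) :
    ∃ C : ℝ, 0 ≤ C ∧ ∀ n : ℕ, 1 ≤ n →
      ∫ w, |((visitedRange X n w ∩ Finset.Icc (1 : ℤ) ⌊n * m⌋₊).card : ℝ) - n| ∂P ≤ C * √n := by
  obtain ⟨C, hC0, hC⟩ := exists_integral_abs_walk_sub_le h hint hsq hm
  refine ⟨C, hC0, fun n hn => (integral_mono_ae ?_ ?_ ?_).trans (hC n hn)⟩
  · exact integrable_abs_card_inter_Icc_sub h hsq n _
  · exact integrable_abs_walk_sub h hsq n _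
  · filter_upwards [h.pos] with w hw
    exact abs_card_visitedRange_inter_Icc_sub_le hw n _

theorem integrable_abs_overlap_sub [IsProbabilityMeasure P] (h : IsRenewalSteps P X) (n : ℕ)
    (a : ℝ) :
    Integrable (fun p : Ω' × Ω' =>
      |((visitedRange X n p.1 ∩ visitedRange X n p.2).card : ℝ) - a|) (P.prod P) := by
  refine Integrable.of_bound (C := n + |a|) (measurable_apply_visitedRange_prod h.meas n
      fun A B => |((A ∩ B).card : ℝ) - a|).aestronglyMeasurable (Eventually.of_forall fun p => ?_)
  rw [Real.norm_eq_abs, abs_abs]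
  refine (abs_sub _ _).trans ?_
  gcongr
  rw [abs_of_nonneg (Nat.cast_nonneg _)]
  have : (visitedRange X n p.1 ∩ visitedRange X n p.2).card ≤ n := by
    refine (Finset.card_le_card Finset.inter_subset_left).trans ?_
    refine Finset.card_image_le.trans ?_
    simp
  exact_mod_cast this

theorem ae_prod_pos [IsProbabilityMeasure P] (h : IsRenewalSteps P X) :
    ∀ᵐ p ∂(P.prod P), (∀ k, 0 < X k p.1) ∧ ∀ k, 0 < X k p.2 :=
  (Measure.quasiMeasurePreserving_fst.ae h.pos).and (Measure.quasiMeasurePreserving_snd.ae h.pos)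

/-- Two independent copies of the walk share `n / m + O (n ^ (3 / 4))` sites: they run up to the
site `N ≈ n m`, and a site is common with probability about `1 / m ^ 2`. -/
theorem exists_integral_abs_overlap_sub_le [IsProbabilityMeasure P] (h : IsRenewalSteps P X)
    (haper : IsAperiodic (P.map (X 0)).support)
    (hint : Integrable (fun w => (X 0 w : ℝ)) P) (hsq : Integrable (fun w => (X 0 w : ℝ) ^ 2) P)
    {m : ℝ} (hm : m = ∫ w, (X 0 w : ℝ) ∂P) :
    ∃ C : ℝ, 0 ≤ C ∧ ∀ n : ℕ, 1 ≤ n →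
      ∫ p, |((visitedRange X n p.1 ∩ visitedRange X n p.2).card : ℝ) - n / m| ∂(P.prod P)
        ≤ C * (n : ℝ) ^ (3 / 4 : ℝ) := by
  have hm1 : 1 ≤ m := hm ▸ one_le_mean h hint
  obtain ⟨K, hK0, hK⟩ := exists_integral_sq_jointVisit_le h haper hint hsq hm
  obtain ⟨C, hC0, hC⟩ := exists_integral_abs_walk_sub_le h hint hsq hm
  refine ⟨2 * C + √(K * ((m + 1) * √(m + 1))) + 1, by positivity, fun n hn => ?_⟩
  set N := ⌊n * m⌋₊ with hN
  have hn1 : (1 : ℝ) ≤ n := by exact_mod_cast hn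
  have hNle : (N : ℝ) ≤ n * m := Nat.floor_le (by positivity)
  have hNlt : (n : ℝ) * m < N + 1 := Nat.lt_floor_add_one _
  set q : ℝ := 1 / m ^ 2 with hq
  have hq0 : 0 ≤ q := by positivity
  have hq1 : q ≤ 1 := by rw [hq, div_le_one (by positivity)]; exact one_le_pow₀ hm1
  let J : Ω' × Ω' → ℝ := fun p => ∑ i ∈ Finset.range N, jointVisit X q ((i + 1 : ℕ) : ℤ) p
  have hJm : MemLp J 2 (P.prod P) := by
    refine memLp_finsetSum _ fun i _ => ?_
    exact MemLp.of_bound (measurable_jointVisit h.meas q _).aestronglyMeasurable 1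
      (Eventually.of_forall fun p => abs_jointVisit_le hq0 hq1 _ p)
  have hJ : ∫ p, |J p| ∂(P.prod P) ≤ √(K * ((m + 1) * √(m + 1))) * (n : ℝ) ^ (3 / 4 : ℝ) := by
    refine (integral_abs_le_sqrt hJm).trans ((Real.sqrt_le_sqrt (hK N)).trans ?_)
    have h1 : (N : ℝ) + 1 ≤ (m + 1) * n := by nlinarith
    have h2 : K * (((N : ℝ) + 1) * √((N : ℝ) + 1))
        ≤ K * ((m + 1) * √(m + 1)) * ((n : ℝ) * √n) := by
      calc _ ≤ K * (((m + 1) * n) * √((m + 1) * n)) := by gcongr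
        _ = _ := by rw [Real.sqrt_mul (by positivity)]; ring
    refine (Real.sqrt_le_sqrt h2).trans (le_of_eq ?_)
    rw [Real.sqrt_mul (by positivity)]
    congr 1
    rw [Real.sqrt_eq_rpow, Real.sqrt_eq_rpow]
    nth_rewrite 1 [← Real.rpow_one (n : ℝ)]
    rw [← Real.rpow_add (by positivity), ← Real.rpow_mul (by positivity)]
    norm_num
  have hpow1 : 1 ≤ (n : ℝ) ^ (3 / 4 : ℝ) := Real.one_le_rpow hn1 (by norm_num)
  have hpow2 : √(n : ℝ) ≤ (n : ℝ) ^ (3 / 4 : ℝ) := by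
    rw [Real.sqrt_eq_rpow]
    exact Real.rpow_le_rpow_of_exponent_le hn1 (by norm_num)
  let D : Ω' → ℝ := fun w => |(walk X n w : ℝ) - N|
  have hD : Integrable D P := integrable_abs_walk_sub h hsq n _
  have hD1 : Integrable (fun p : Ω' × Ω' => D p.1) (P.prod P) := hD.comp_fst P
  have hD2 : Integrable (fun p : Ω' × Ω' => D p.2) (P.prod P) := hD.comp_snd P
  have hJi : Integrable (fun p => |J p|) (P.prod P) := (hJm.integrable one_le_two).abs
  have hle : ∀ᵐ p ∂(P.prod P),
      |((visitedRange X n p.1 ∩ visitedRange X n p.2).card : ℝ) - n / m|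
        ≤ D p.1 + D p.2 + |J p| + 1 := by
    filter_upwards [ae_prod_pos h] with p hp
    have h1 := abs_card_inter_sub_le hp.1 hp.2 n N
    have h2 : J p = ((visitedSites X N p.1 ∩ visitedSites X N p.2).card : ℝ) - N * q :=
      sum_jointVisit X q N p
    have h3 : |N * q - n / m| ≤ 1 := by
      have : (n : ℝ) / m = n * m * q := by rw [hq]; field_simp
      rw [this, ← sub_mul, abs_mul, abs_of_nonneg hq0]
      refine mul_le_one₀ ?_ hq0 hq1
      rw [abs_le]; constructor <;> linarith
    set a := ((visitedRange X n p.1 ∩ visitedRange X n p.2).card : ℝ)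
    set b := ((visitedSites X N p.1 ∩ visitedSites X N p.2).card : ℝ)
    calc |a - n / m| = |(a - b) + J p + (N * q - n / m)| := by rw [h2]; ring_nf
      _ ≤ |a - b| + |J p| + |N * q - n / m| := abs_add_three _ _ _
      _ ≤ _ := by linarith
  have i2 : Integrable (fun p : Ω' × Ω' => D p.1 + D p.2) (P.prod P) := hD1.add hD2
  have i3 : Integrable (fun p : Ω' × Ω' => D p.1 + D p.2 + |J p|) (P.prod P) := i2.add hJi
  calc _ ≤ ∫ p, (D p.1 + D p.2 + |J p| + 1) ∂(P.prod P) :=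
        integral_mono_ae (integrable_abs_overlap_sub h n _) (i3.add (integrable_const 1)) hle
    _ = ∫ w, D w ∂P + ∫ w, D w ∂P + ∫ p, |J p| ∂(P.prod P) + 1 := by
        rw [integral_add i3 (integrable_const 1), integral_add i2 hJi, integral_add hD1 hD2,
          integral_fun_fst, integral_fun_snd]
        simp
    _ ≤ C * √n + C * √n + √(K * ((m + 1) * √(m + 1))) * (n : ℝ) ^ (3 / 4 : ℝ)
        + (n : ℝ) ^ (3 / 4 : ℝ) := by
        have := hC n hn
        gcongr
    _ ≤ _ := by
        have := mul_le_mul_of_nonneg_left hpow2 hC0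
        linarith

end Measurability

/-! ### Linear forms in the scenery: characteristic function -/

/-- A scenery: independent identically distributed symmetric real random variables indexed by `ℤ`,
with finite moments of all orders and unit variance. -/
structure IsScenery {Ω : Type*} [MeasurableSpace Ω] (μ : Measure Ω) (ω : ℤ → Ω → ℝ) : Prop where
  meas : ∀ x, Measurable (ω x)
  indep : iIndepFun ω μ
  ident : ∀ x, IdentDistrib (ω x) (ω 0) μ μ
  symm : IdentDistrib (ω 0) (fun a => -ω 0 a) μ μ
  mom : ∀ k : ℕ, 1 ≤ k → Integrable (fun a => |ω 0 a| ^ k) μ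
  var : ∫ a, (ω 0 a) ^ 2 ∂μ = 1

section Scenery

variable {Ω : Type*} [MeasurableSpace Ω] {μ : Measure Ω} {ω : ℤ → Ω → ℝ}

theorem memLp_natCast_of_integrable_abs_pow [IsFiniteMeasure μ] {f : Ω → ℝ}
    (hf : AEStronglyMeasurable f μ) (hi : ∀ k : ℕ, 1 ≤ k → Integrable (fun a => |f a| ^ k) μ)
    (k : ℕ) : MemLp f k μ := by
  rcases Nat.eq_zero_or_pos k with rfl | hk
  · simpa using hf
  · rw [← integrable_norm_rpow_iff hf (by exact_mod_cast hk.ne') (by simp)]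
    simpa using hi k hk

theorem integrable_pow_of_forall_memLp [IsFiniteMeasure μ] {f : Ω → ℝ}
    (hf : ∀ k : ℕ, MemLp f k μ) (k : ℕ) : Integrable (fun a => f a ^ k) μ := by
  refine ((hf k).integrable_norm_pow').mono ((hf k).aestronglyMeasurable.pow k) ?_
  exact Eventually.of_forall fun a => by simp

theorem IsScenery.memLp [IsProbabilityMeasure μ] (h : IsScenery μ ω) (x : ℤ) (k : ℕ) :
    MemLp (ω x) k μ :=
  (h.ident x).memLp_iff.2
    (memLp_natCast_of_integrable_abs_pow (h.meas 0).aestronglyMeasurable h.mom k)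

/-- Symmetry of the scenery kills all odd moments. -/
theorem IsScenery.integral_pow_odd (h : IsScenery μ ω) (x : ℤ) {k : ℕ} (hk : Odd k) :
    ∫ a, ω x a ^ k ∂μ = 0 := by
  have hp : Measurable fun y : ℝ => y ^ k := by fun_prop
  have h1 : ∫ a, ω x a ^ k ∂μ = ∫ a, ω 0 a ^ k ∂μ := ((h.ident x).comp hp).integral_eq
  have h2 : ∫ a, ω 0 a ^ k ∂μ = ∫ a, (-ω 0 a) ^ k ∂μ := (h.symm.comp hp).integral_eq
  simp_rw [hk.neg_pow, integral_neg] at h2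
  rw [h1]; linarith

theorem IsScenery.integral_eq_zero (h : IsScenery μ ω) (x : ℤ) : ∫ a, ω x a ∂μ = 0 := by
  simpa using h.integral_pow_odd x odd_one

theorem IsScenery.integral_sq (h : IsScenery μ ω) (x : ℤ) : ∫ a, ω x a ^ 2 ∂μ = 1 := by
  rw [← h.var]
  exact ((h.ident x).comp (u := fun y : ℝ => y ^ 2) (by fun_prop)).integral_eq

theorem IsScenery.integral_abs_pow (h : IsScenery μ ω) (x : ℤ) (k : ℕ) :
    ∫ a, |ω x a| ^ k ∂μ = ∫ a, |ω 0 a| ^ k ∂μ :=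
  ((h.ident x).comp (u := fun y : ℝ => |y| ^ k) (by fun_prop)).integral_eq

theorem norm_exp_mul_I_sub_le (x : ℝ) :
    ‖Complex.exp (x * Complex.I) - (1 + x * Complex.I - x ^ 2 / 2)‖ ≤ 4 * |x| ^ 3 := by
  have hn : ‖(x : ℂ) * Complex.I‖ = |x| := by simp
  rcases le_total |x| 1 with h | h
  · have := Complex.exp_bound (x := x * Complex.I) (by rw [hn]; exact h) (n := 3) (by norm_num)
    rw [hn] at this
    have h2 : ∑ m ∈ Finset.range 3, ((x : ℂ) * Complex.I) ^ m / (m.factorial : ℂ)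
        = 1 + x * Complex.I - x ^ 2 / 2 := by
      simp [Finset.sum_range_succ, Nat.factorial, mul_pow]
      ring
    rw [h2] at this
    refine this.trans ?_
    rw [mul_comm]
    gcongr
    norm_num [Nat.factorial]
  · have h1 : ‖Complex.exp (x * Complex.I)‖ = 1 := Complex.norm_exp_ofReal_mul_I x
    have h2 : ‖(1 + x * Complex.I - x ^ 2 / 2 : ℂ)‖ ≤ 1 + |x| + |x| ^ 2 / 2 := by
      refine (norm_sub_le _ _).trans (add_le_add ((norm_add_le _ _).trans ?_) ?_)
      · rw [hn]; simp
      · simp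
    have h3 : |x| ≤ |x| ^ 3 := le_self_pow₀ h (by norm_num)
    have h4 : |x| ^ 2 ≤ |x| ^ 3 := pow_le_pow_right₀ h (by norm_num)
    calc _ ≤ _ := norm_sub_le _ _
      _ ≤ 1 + (1 + |x| + |x| ^ 2 / 2) := add_le_add h1.le h2
      _ ≤ _ := by linarith

theorem abs_exp_neg_sub_le {y : ℝ} (hy : 0 ≤ y) : |Real.exp (-y) - (1 - y)| ≤ y ^ 2 := by
  rcases le_total y 1 with h | h
  · have := Real.abs_exp_sub_one_sub_id_le (x := -y) (by rw [abs_neg, abs_of_nonneg hy]; exact h)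
    rw [neg_sq] at this
    convert! this using 2
    ring
  · have h1 : Real.exp (-y) ≤ 1 := Real.exp_le_one_iff.2 (by linarith)
    have h2 := Real.exp_pos (-y)
    rw [abs_le]
    constructor <;> nlinarith

theorem IsScenery.exists_norm_charFun_sub_le [IsProbabilityMeasure μ] (h : IsScenery μ ω) :
    ∃ K : ℝ, 0 ≤ K ∧ ∀ (x : ℤ) (s : ℝ),
      ‖∫ a, Complex.exp ((s * ω x a : ℝ) * Complex.I) ∂μ - (Real.exp (-(s ^ 2 / 2)) : ℝ)‖
        ≤ K * (|s| ^ 3 + s ^ 4) := by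
  set M := ∫ a, |ω 0 a| ^ 3 ∂μ
  have hM : 0 ≤ M := integral_nonneg fun a => by positivity
  refine ⟨4 * M + 1, by positivity, fun x s => ?_⟩
  have i1 : Integrable (ω x) μ := by simpa using (h.memLp x 1).integrable (by simp)
  have i2 : Integrable (fun a => ω x a ^ 2) μ := integrable_pow_of_forall_memLp (h.memLp x) 2
  have i3 : Integrable (fun a => |ω x a| ^ 3) μ := by
    simpa using (h.memLp x 3).integrable_norm_pow'
  have iexp : Integrable (fun a => Complex.exp ((s * ω x a : ℝ) * Complex.I)) μ := by
    refine Integrable.of_bound (C := 1) ?_ (Eventually.of_forall fun a =>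
      (Complex.norm_exp_ofReal_mul_I _).le)
    have := h.meas x
    exact Measurable.aestronglyMeasurable (by fun_prop)
  have ipoly : Integrable (fun a => (1 + ((s * ω x a : ℝ) : ℂ) * Complex.I
      - ((s * ω x a : ℝ) : ℂ) ^ 2 / 2)) μ := by
    refine ((integrable_const _).add ((i1.const_mul s).ofReal.mul_const _)).sub ?_
    have := ((i2.const_mul (s ^ 2)).ofReal (𝕜 := ℂ)).div_const 2
    refine this.congr (Eventually.of_forall fun a => ?_)
    simp [mul_pow]
  have hpoly : ∫ a, (1 + ((s * ω x a : ℝ) : ℂ) * Complex.I - ((s * ω x a : ℝ) : ℂ) ^ 2 / 2) ∂μ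
      = ((1 - s ^ 2 / 2 : ℝ) : ℂ) := by
    have e1 : ∀ a, (1 + ((s * ω x a : ℝ) : ℂ) * Complex.I - ((s * ω x a : ℝ) : ℂ) ^ 2 / 2)
        = ((1 - s ^ 2 / 2 * ω x a ^ 2 : ℝ) : ℂ) + ((s * ω x a : ℝ) : ℂ) * Complex.I := by
      intro a; push_cast; ring
    simp_rw [e1]
    have j1 : Integrable (fun a => 1 - s ^ 2 / 2 * ω x a ^ 2) μ :=
      (integrable_const _).sub (i2.const_mul _)
    have j2 : Integrable (fun a => ((1 - s ^ 2 / 2 * ω x a ^ 2 : ℝ) : ℂ)) μ := j1.ofReal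
    have j3 : Integrable (fun a => ((s * ω x a : ℝ) : ℂ) * Complex.I) μ :=
      (i1.const_mul s).ofReal.mul_const _
    rw [integral_add j2 j3,
      integral_mul_const, integral_complex_ofReal, integral_complex_ofReal, integral_const_mul,
      h.integral_eq_zero, integral_sub (integrable_const _) (i2.const_mul _), integral_const_mul,
      h.integral_sq]
    simp
  have hA : ‖∫ a, Complex.exp ((s * ω x a : ℝ) * Complex.I) ∂μ - ((1 - s ^ 2 / 2 : ℝ) : ℂ)‖
      ≤ 4 * M * |s| ^ 3 := by
    rw [← hpoly, ← integral_sub iexp ipoly]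
    refine (norm_integral_le_of_norm_le (i3.const_mul (4 * |s| ^ 3))
      (Eventually.of_forall fun a => ?_)).trans ?_
    · refine (norm_exp_mul_I_sub_le (s * ω x a)).trans ?_
      rw [abs_mul, mul_pow, mul_assoc]
    · rw [integral_const_mul, h.integral_abs_pow]
      exact le_of_eq (by ring)
  have hB : ‖((1 - s ^ 2 / 2 : ℝ) : ℂ) - (Real.exp (-(s ^ 2 / 2)) : ℝ)‖ ≤ s ^ 4 := by
    rw [← Complex.ofReal_sub, Complex.norm_real, Real.norm_eq_abs, abs_sub_comm]
    refine (abs_exp_neg_sub_le (by positivity)).trans ?_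
    nlinarith [sq_nonneg (s ^ 2)]
  calc _ ≤ _ := norm_sub_le_norm_sub_add_norm_sub _ ((1 - s ^ 2 / 2 : ℝ) : ℂ) _
    _ ≤ 4 * M * |s| ^ 3 + s ^ 4 := add_le_add hA hB
    _ ≤ (4 * M + 1) * (|s| ^ 3 + s ^ 4) := by
        have h1 : 0 ≤ |s| ^ 3 := by positivity
        have h2 : 0 ≤ s ^ 4 := by positivity
        nlinarith [mul_nonneg hM h2]

theorem norm_prod_sub_prod_le_sum {ι : Type*} (F : Finset ι) (f g : ι → ℂ)
    (hf : ∀ i ∈ F, ‖f i‖ ≤ 1) (hg : ∀ i ∈ F, ‖g i‖ ≤ 1) :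
    ‖∏ i ∈ F, f i - ∏ i ∈ F, g i‖ ≤ ∑ i ∈ F, ‖f i - g i‖ := by
  classical
  induction F using Finset.induction_on with
  | empty => simp
  | insert i F hi ih =>
    rw [Finset.prod_insert hi, Finset.prod_insert hi, Finset.sum_insert hi]
    have h1 := ih (fun j hj => hf j (Finset.mem_insert_of_mem hj))
      (fun j hj => hg j (Finset.mem_insert_of_mem hj))
    have h2 : ‖∏ j ∈ F, f j‖ ≤ 1 := by
      rw [norm_prod]
      exact Finset.prod_le_one (fun _ _ => norm_nonneg _)
        fun j hj => hf j (Finset.mem_insert_of_mem hj)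
    have h3 := hg i (Finset.mem_insert_self i F)
    calc _ = ‖(f i - g i) * ∏ j ∈ F, f j + g i * (∏ j ∈ F, f j - ∏ j ∈ F, g j)‖ := by ring_nf
      _ ≤ ‖f i - g i‖ * ‖∏ j ∈ F, f j‖ + ‖g i‖ * ‖∏ j ∈ F, f j - ∏ j ∈ F, g j‖ := by
          refine (norm_add_le _ _).trans ?_
          rw [norm_mul, norm_mul]
      _ ≤ ‖f i - g i‖ * 1 + 1 * ‖∏ j ∈ F, f j - ∏ j ∈ F, g j‖ := by gcongr
      _ ≤ _ := by linarith

theorem IsScenery.integral_exp_sum (h : IsScenery μ ω) (F : Finset ℤ) (b : ℤ → ℝ) :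
    ∫ a, Complex.exp ((∑ x ∈ F, b x * ω x a : ℝ) * Complex.I) ∂μ
      = ∏ x ∈ F, ∫ a, Complex.exp ((b x * ω x a : ℝ) * Complex.I) ∂μ := by
  have h1 : ∀ a, Complex.exp ((∑ x ∈ F, b x * ω x a : ℝ) * Complex.I)
      = ∏ x : F, Complex.exp ((b x * ω x a : ℝ) * Complex.I) := by
    intro a
    rw [← Complex.exp_sum, ← Finset.sum_mul, ← Complex.ofReal_sum,
      Finset.sum_coe_sort F fun x => b x * ω x a]
  simp_rw [h1]
  have h2 : iIndepFun (fun x : F => ω x) μ := h.indep.precomp Subtype.val_injective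
  rw [h2.integral_fun_prod_comp (f := fun (x : F) y => Complex.exp ((b x * y : ℝ) * Complex.I))
    (fun x => (h.meas x).aemeasurable)
    (fun x => Measurable.aestronglyMeasurable (by fun_prop))]
  exact Finset.prod_coe_sort F fun x => ∫ a, Complex.exp ((b x * ω x a : ℝ) * Complex.I) ∂μ

/-- Gaussian approximation of the characteristic function of a linear form in the scenery, with an
error uniform over coefficients in `[-1, 1]`. -/
theorem IsScenery.exists_norm_integral_exp_sum_sub_le [IsProbabilityMeasure μ]
    (h : IsScenery μ ω) :
    ∃ K : ℝ, 0 ≤ K ∧ ∀ (F : Finset ℤ) (c : ℤ → ℝ), (∀ x, |c x| ≤ 1) → ∀ s : ℝ,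
      ‖∫ a, Complex.exp ((s * ∑ x ∈ F, c x * ω x a : ℝ) * Complex.I) ∂μ
          - (Real.exp (-(s ^ 2 / 2 * ∑ x ∈ F, c x ^ 2)) : ℝ)‖
        ≤ K * F.card * (|s| ^ 3 + s ^ 4) := by
  obtain ⟨K, hK0, hK⟩ := h.exists_norm_charFun_sub_le
  refine ⟨K, hK0, fun F c hc s => ?_⟩
  have h1 : ∀ a, s * ∑ x ∈ F, c x * ω x a = ∑ x ∈ F, (s * c x) * ω x a := fun a => by
    rw [Finset.mul_sum]; exact Finset.sum_congr rfl fun x _ => by ring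
  have h2 : ((Real.exp (-(s ^ 2 / 2 * ∑ x ∈ F, c x ^ 2)) : ℝ) : ℂ)
      = ∏ x ∈ F, ((Real.exp (-((s * c x) ^ 2 / 2)) : ℝ) : ℂ) := by
    rw [← Complex.ofReal_prod, ← Real.exp_sum, Finset.sum_neg_distrib, Finset.mul_sum]
    congr 4
    funext x
    ring
  simp_rw [h1]
  rw [h.integral_exp_sum, h2]
  refine (norm_prod_sub_prod_le_sum F _ _ (fun x _ => ?_) fun x _ => ?_).trans ?_
  · refine (norm_integral_le_of_norm_le_const (C := 1) (Eventually.of_forall fun a => ?_)).trans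
      (by simp)
    exact (Complex.norm_exp_ofReal_mul_I _).le
  · rw [Complex.norm_real, Real.norm_of_nonneg (Real.exp_pos _).le, Real.exp_le_one_iff]
    exact neg_nonpos.2 (by positivity)
  · have h3 : ∀ x ∈ F, ‖∫ a, Complex.exp ((s * c x * ω x a : ℝ) * Complex.I) ∂μ
        - ((Real.exp (-((s * c x) ^ 2 / 2)) : ℝ) : ℂ)‖ ≤ K * (|s| ^ 3 + s ^ 4) := by
      intro x _
      refine (hK x (s * c x)).trans ?_
      have h4 : |s * c x| ≤ |s| := by
        rw [abs_mul]; exact mul_le_of_le_one_right (abs_nonneg _) (hc x)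
      have h5 : (s * c x) ^ 4 ≤ s ^ 4 := by
        have := pow_le_pow_left₀ (abs_nonneg _) h4 4
        rwa [Even.pow_abs (by decide), Even.pow_abs (by decide)] at this
      gcongr
    refine (Finset.sum_le_sum h3).trans (le_of_eq ?_)
    simp
    ring

/-! ### Linear forms in the scenery: moments -/

/-- The increment of `y ↦ y ^ p` from `a` to `a + b` dominates each monomial `a ^ i b ^ j` with `j ≠
0`. It closes the induction on the index set in the moment bound below, because the increments
telescope. -/
theorem pow_mul_pow_le_add_pow_sub {a b : ℝ} (ha : 0 ≤ a) (hb : 0 ≤ b) {i j p : ℕ}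
    (hj : j ≠ 0) (hp : i + j = p) : a ^ i * b ^ j ≤ (a + b) ^ p - a ^ p := by
  have h1 : b ^ j ≤ (a + b) ^ j - a ^ j := by linarith [pow_add_pow_le ha hb hj]
  have h2 : a ^ i ≤ (a + b) ^ i := pow_le_pow_left₀ ha (by linarith) i
  have h3 : 0 ≤ (a + b) ^ j - a ^ j := (pow_nonneg hb j).trans h1
  calc a ^ i * b ^ j ≤ a ^ i * ((a + b) ^ j - a ^ j) := by gcongr
    _ = a ^ i * (a + b) ^ j - a ^ p := by rw [mul_sub, ← pow_add, hp]
    _ ≤ (a + b) ^ i * (a + b) ^ j - a ^ p := by gcongr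
    _ = _ := by rw [← pow_add, hp]

theorem IsScenery.memLp_sum [IsProbabilityMeasure μ] (h : IsScenery μ ω) (F : Finset ℤ)
    (c : ℤ → ℝ) (k : ℕ) : MemLp (fun a => ∑ x ∈ F, c x * ω x a) k μ :=
  memLp_finsetSum _ fun x _ => (h.memLp x k).const_mul (c x)

/-- Even moments of a linear form in the scenery are bounded by powers of its variance. The proof is
a strong induction on the exponent and, inside it, an induction on the index set: adding one
variable and expanding the power, odd terms vanish by symmetry and the even ones are controlled by
lower moments. -/
theorem IsScenery.exists_integral_pow_sum_le [IsProbabilityMeasure μ] (h : IsScenery μ ω)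
    (p : ℕ) : ∃ K : ℝ, 0 ≤ K ∧ ∀ (F : Finset ℤ) (c : ℤ → ℝ),
      ∫ a, (∑ x ∈ F, c x * ω x a) ^ (2 * p) ∂μ ≤ K * (∑ x ∈ F, c x ^ 2) ^ p := by
  classical
  induction p using Nat.strong_induction_on with
  | _ p ih =>
  choose! K hK0 hK using ih
  let M : ℕ → ℝ := fun k => ∫ a, |ω 0 a| ^ k ∂μ
  have hM0 : ∀ k, 0 ≤ M k := fun k => integral_nonneg fun a => by positivity
  -- the coefficient of the `i`-th term of the binomial expansion when one variable is added
  let A : ℕ → ℝ := fun i => |K (p - i / 2)| * M i * ((2 * p).choose i : ℝ)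
  have hA0 : ∀ i, 0 ≤ A i := fun i =>
    mul_nonneg (mul_nonneg (abs_nonneg _) (hM0 i)) (Nat.cast_nonneg _)
  set L := ∑ i ∈ Finset.range (2 * p), A (i + 1) with hL
  have hL0 : 0 ≤ L := Finset.sum_nonneg fun i _ => hA0 _
  refine ⟨L + 1, by positivity, fun F c => ?_⟩
  induction F using Finset.induction_on with
  | empty =>
    rcases Nat.eq_zero_or_pos p with rfl | hp
    · simp [hL]
    · simp [zero_pow (show 2 * p ≠ 0 by omega), zero_pow hp.ne']
  | insert x F hx ihF =>
    set S : Ω → ℝ := fun a => ∑ y ∈ F, c y * ω y a with hS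
    set s := ∑ y ∈ F, c y ^ 2 with hs
    have hs0 : 0 ≤ s := Finset.sum_nonneg fun y _ => sq_nonneg _
    have hSL : ∀ k : ℕ, MemLp S k μ := h.memLp_sum F c
    have hindep : IndepFun (ω x) S μ := by
      have h2 := h.indep.indepFun_finset {x} F (by simpa using hx) h.meas
      have hφ : Measurable fun v : ({x} : Finset ℤ) → ℝ => v ⟨x, Finset.mem_singleton_self x⟩ :=
        measurable_pi_apply (X := fun _ : ({x} : Finset ℤ) => ℝ) _
      have h3 := h2.comp (φ := fun v : ({x} : Finset ℤ) → ℝ => v ⟨x, by simp⟩)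
        (ψ := fun v : F → ℝ => ∑ y : F, c y * v y)
        hφ (by fun_prop)
      convert! h3 using 1
      ext a
      simp only [hS, Function.comp]
      exact (Finset.sum_coe_sort F fun y => c y * ω y a).symm
    have hterm : ∀ i, ∫ a, (c x * ω x a) ^ i * S a ^ (2 * p - i) ∂μ
        = c x ^ i * (∫ a, ω x a ^ i ∂μ) * ∫ a, S a ^ (2 * p - i) ∂μ := by
      intro i
      have h1 := (hindep.comp (φ := fun y : ℝ => y ^ i) (ψ := fun y : ℝ => y ^ (2 * p - i))
        (by fun_prop) (by fun_prop)).integral_mul_eq_mul_integral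
        ((h.meas x).pow_const i).aestronglyMeasurable
        ((hSL 0).aestronglyMeasurable.pow _)
      simp only [Pi.mul_apply, Function.comp] at h1
      simp_rw [mul_pow, mul_assoc]
      rw [integral_const_mul, h1]
    have hint : ∀ i, Integrable (fun a => (c x * ω x a) ^ i * S a ^ (2 * p - i)) μ := by
      intro i
      have h1 := (hindep.comp (φ := fun y : ℝ => (c x * y) ^ i) (ψ := fun y : ℝ => y ^ (2 * p - i))
        (by fun_prop) (by fun_prop)).integrable_mul
        (by
          have := (integrable_pow_of_forall_memLp (h.memLp x) i).const_mul (c x ^ i)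
          simpa [Function.comp_def, mul_pow] using this)
        (integrable_pow_of_forall_memLp hSL _)
      exact h1
    have hbound : ∀ i ∈ Finset.range (2 * p),
        (∫ a, (c x * ω x a) ^ (i + 1) * S a ^ (2 * p - (i + 1)) ∂μ) * ((2 * p).choose (i + 1) : ℝ)
          ≤ A (i + 1) * ((s + c x ^ 2) ^ p - s ^ p) := by
      intro i hi
      have hi' := Finset.mem_range.1 hi
      have hnn : 0 ≤ (s + c x ^ 2) ^ p - s ^ p :=
        sub_nonneg.2 (pow_le_pow_left₀ hs0 (by nlinarith [sq_nonneg (c x)]) p)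
      rw [hterm]
      rcases Nat.even_or_odd (i + 1) with he | ho
      · obtain ⟨j, hj⟩ := he
        have hj1 : (i + 1) / 2 = j := by omega
        have hjp : p - j < p := by omega
        have e1 : 2 * p - (i + 1) = 2 * (p - j) := by omega
        have h1 : ∫ a, S a ^ (2 * p - (i + 1)) ∂μ ≤ |K (p - j)| * s ^ (p - j) := by
          rw [e1]
          exact (hK _ hjp F c).trans (mul_le_mul_of_nonneg_right (le_abs_self _) (by positivity))
        have h2 : ∫ a, ω x a ^ (i + 1) ∂μ = M (i + 1) := by
          change _ = ∫ a, |ω 0 a| ^ (i + 1) ∂μ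
          rw [← h.integral_abs_pow x]
          refine integral_congr_ae (Eventually.of_forall fun a => ?_)
          exact (Even.pow_abs ⟨j, hj⟩ _).symm
        have e2 : c x ^ (i + 1) = (c x ^ 2) ^ j := by rw [← pow_mul]; congr 1; omega
        rw [h2, e2]
        have h3 := pow_mul_pow_le_add_pow_sub hs0 (sq_nonneg (c x)) (i := p - j) (j := j) (p := p)
          (by omega) (by omega)
        have h4 : 0 ≤ (c x ^ 2) ^ j * M (i + 1) := mul_nonneg (by positivity) (hM0 _)
        calc _ ≤ (c x ^ 2) ^ j * M (i + 1) * (|K (p - j)| * s ^ (p - j))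
              * ((2 * p).choose (i + 1) : ℝ) := by gcongr
          _ = A (i + 1) * (s ^ (p - j) * (c x ^ 2) ^ j) := by simp only [A, hj1]; ring
          _ ≤ _ := by
              have := hA0 (i + 1)
              gcongr
      · rw [h.integral_pow_odd x ho]
        simp only [mul_zero, zero_mul]
        exact mul_nonneg (hA0 _) hnn
    have hexp : ∀ a, (∑ y ∈ insert x F, c y * ω y a) ^ (2 * p)
        = ∑ i ∈ Finset.range (2 * p + 1),
          (c x * ω x a) ^ i * S a ^ (2 * p - i) * ((2 * p).choose i : ℝ) := by
      intro a
      rw [Finset.sum_insert hx, add_pow]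
    simp_rw [hexp]
    rw [integral_finsetSum _ fun i _ => (hint i).mul_const _, Finset.sum_insert hx]
    simp_rw [integral_mul_const]
    rw [Finset.sum_range_succ', add_comm (c x ^ 2)]
    have h0 : (∫ a, (c x * ω x a) ^ 0 * S a ^ (2 * p - 0) ∂μ) * ((2 * p).choose 0 : ℝ)
        ≤ (L + 1) * s ^ p := by
      simpa using ihF
    have h1 := Finset.sum_le_sum hbound
    rw [← Finset.sum_mul, ← hL] at h1
    have h2 : s ^ p ≤ (s + c x ^ 2) ^ p :=
      pow_le_pow_left₀ hs0 (by nlinarith [sq_nonneg (c x)]) p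
    nlinarith

/-! ### Linear forms in the scenery: covariances -/

theorem IsScenery.integral_mul [IsProbabilityMeasure μ] (h : IsScenery μ ω) (x y : ℤ) :
    ∫ a, ω x a * ω y a ∂μ = if x = y then 1 else 0 := by
  split_ifs with hxy
  · subst hxy
    rw [← h.integral_sq x]
    simp_rw [sq]
  · have := (h.indep.indepFun hxy).integral_mul_eq_mul_integral (h.meas x).aestronglyMeasurable
      (h.meas y).aestronglyMeasurable
    simp only [Pi.mul_apply] at this
    rw [this, h.integral_eq_zero, zero_mul]

theorem IsScenery.integrable_mul [IsProbabilityMeasure μ] (h : IsScenery μ ω) (x y : ℤ) :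
    Integrable (fun a => ω x a * ω y a) μ :=
  MemLp.integrable_mul (p := 2) (q := 2) (h.memLp x 2) (h.memLp y 2)

theorem IsScenery.integral_sum_mul_sum [IsProbabilityMeasure μ] (h : IsScenery μ ω)
    (A B : Finset ℤ) :
    ∫ a, (∑ x ∈ A, ω x a) * (∑ y ∈ B, ω y a) ∂μ = ((A ∩ B).card : ℝ) := by
  simp_rw [Finset.sum_mul_sum]
  rw [integral_finsetSum _ fun x _ => integrable_finsetSum _ fun y _ => h.integrable_mul x y]
  simp_rw [fun x => integral_finsetSum B fun y _ => h.integrable_mul x y, h.integral_mul]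
  simp

end Scenery

/-! ### The two-replica identity -/

section Replica

variable {Ω Ω' : Type*} [MeasurableSpace Ω] [MeasurableSpace Ω'] {μ : Measure Ω}
  [IsProbabilityMeasure μ] {P : Measure Ω'} [IsProbabilityMeasure P]

/-- The two-replica identity: `E_μ |E_P Ψ|²` is the expectation, over two independent copies `w, w'`
of the path, of the correlation `E_μ[Ψ(·, w) conj Ψ(·, w')]`. Hence a bound `g` on that correlation
bounds the mean square of the quenched expectation. -/
theorem integral_norm_sq_integral_le_of_memLp {Ψ : Ω × Ω' → ℂ} (hΨ : MemLp Ψ 2 (μ.prod P))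
    {g : Ω' × Ω' → ℝ} (hg : Integrable g (P.prod P))
    (hle : ∀ᵐ p ∂(P.prod P), ‖∫ a, Ψ (a, p.1) * (starRingEnd ℂ) (Ψ (a, p.2)) ∂μ‖ ≤ g p) :
    Integrable (fun a => ‖∫ w, Ψ (a, w) ∂P‖ ^ 2) μ ∧
      ∫ a, ‖∫ w, Ψ (a, w) ∂P‖ ^ 2 ∂μ ≤ ∫ p, g p ∂(P.prod P) := by
  let Φ : Ω × (Ω' × Ω') → ℂ := fun q => Ψ (q.1, q.2.1) * (starRingEnd ℂ) (Ψ (q.1, q.2.2))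
  have hΦ : Integrable Φ (μ.prod (P.prod P)) := by
    have h1 : MemLp (fun q : Ω × (Ω' × Ω') => Ψ (q.1, q.2.1)) 2 (μ.prod (P.prod P)) :=
      hΨ.comp_measurePreserving ((MeasurePreserving.id μ).prod measurePreserving_fst)
    have h2 : MemLp (fun q : Ω × (Ω' × Ω') => Ψ (q.1, q.2.2)) 2 (μ.prod (P.prod P)) :=
      hΨ.comp_measurePreserving ((MeasurePreserving.id μ).prod measurePreserving_snd)
    exact MemLp.integrable_mul (p := 2) (q := 2) h1 h2.star
  have hsq : ∀ a, ∫ p, Φ (a, p) ∂(P.prod P) = ((‖∫ w, Ψ (a, w) ∂P‖ ^ 2 : ℝ) : ℂ) := by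
    intro a
    have := integral_prod_mul (μ := P) (ν := P) (fun w => Ψ (a, w))
      (fun w => (starRingEnd ℂ) (Ψ (a, w)))
    rw [integral_conj, Complex.mul_conj, Complex.normSq_eq_norm_sq] at this
    exact this
  have hint : Integrable (fun a => ((‖∫ w, Ψ (a, w) ∂P‖ ^ 2 : ℝ) : ℂ)) μ := by
    have := hΦ.integral_prod_left
    simpa only [hsq] using this
  have hint' : Integrable (fun a => ‖∫ w, Ψ (a, w) ∂P‖ ^ 2) μ := by
    exact hint.re
  refine ⟨hint', ?_⟩
  have hswap : ∫ a, ∫ p, Φ (a, p) ∂(P.prod P) ∂μ = ∫ p, ∫ a, Φ (a, p) ∂μ ∂(P.prod P) :=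
    integral_integral_swap (f := fun a p => Φ (a, p)) hΦ
  simp_rw [hsq] at hswap
  rw [integral_complex_ofReal] at hswap
  have h0 : 0 ≤ ∫ a, ‖∫ w, Ψ (a, w) ∂P‖ ^ 2 ∂μ := integral_nonneg fun a => by positivity
  calc _ = ‖((∫ a, ‖∫ w, Ψ (a, w) ∂P‖ ^ 2 ∂μ : ℝ) : ℂ)‖ := by
        rw [Complex.norm_real, Real.norm_of_nonneg h0]
    _ ≤ _ := by
        rw [hswap]
        exact norm_integral_le_of_norm_le hg hle

end Replica

/-! ### Increments of the normalized random walk in random scenery -/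

section Increments

variable {Ω Ω' : Type*} {ω : ℤ → Ω → ℝ} {X : ℕ → Ω' → ℤ}

theorem sceneryWalk_apply (n : ℕ) (q : Ω × Ω') :
    sceneryWalk (fun x => ω x q.1) X n q.2
      = ∑ k ∈ Finset.Icc 1 n, ω (walk X k q.2) q.1 := rfl

/-- The difference `Z_n / √n - Z_k / √k`, as a function of the scenery and the path jointly. -/
noncomputable def normalizedDiff (ω : ℤ → Ω → ℝ) (X : ℕ → Ω' → ℤ) (k n : ℕ) (q : Ω × Ω') : ℝ :=
  sceneryWalk (fun x => ω x q.1) X n q.2 / √n - sceneryWalk (fun x => ω x q.1) X k q.2 / √k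

theorem visitedRange_mono {k n : ℕ} (hkn : k ≤ n) (w : Ω') :
    visitedRange X k w ⊆ visitedRange X n w :=
  Finset.image_subset_image (Finset.Icc_subset_Icc_right hkn)

theorem normalizedDiff_eq_sum {k n : ℕ} (hkn : k ≤ n) (a : Ω) {w : Ω'} (hw : ∀ k, 0 < X k w) :
    normalizedDiff ω X k n (a, w) = ∑ x ∈ visitedRange X n w,
      ((√n)⁻¹ - if x ∈ visitedRange X k w then (√k)⁻¹ else 0) * ω x a := by
  simp only [normalizedDiff, sceneryWalk_eq_sum _ hw, sub_mul, Finset.sum_sub_distrib, ite_mul,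
    zero_mul]
  rw [← Finset.sum_filter, Finset.filter_mem_eq_inter,
    Finset.inter_eq_right.2 (visitedRange_mono hkn w), ← Finset.mul_sum, ← Finset.mul_sum]
  ring

/-- The sum of squares is exactly `2 (1 - √(k / n))`. -/
theorem sum_sq_normalizedDiff_le {k n : ℕ} (hk : 1 ≤ k) (hkn : k ≤ n) {w : Ω'}
    (hw : ∀ k, 0 < X k w) :
    ∑ x ∈ visitedRange X n w, ((√n)⁻¹ - if x ∈ visitedRange X k w then (√k)⁻¹ else 0) ^ 2
      ≤ 2 * (1 - (k : ℝ) / n) := by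
  have hk0 : (0 : ℝ) < k := by exact_mod_cast hk
  have hn0 : (0 : ℝ) < n := by exact_mod_cast hk.trans hkn
  have h1 : ∀ x, ((√n)⁻¹ - if x ∈ visitedRange X k w then (√k)⁻¹ else 0) ^ 2
      = (n : ℝ)⁻¹ + if x ∈ visitedRange X k w then (k : ℝ)⁻¹ - 2 * ((√n)⁻¹ * (√k)⁻¹) else 0 := by
    intro x
    have e1 : ((√(n : ℝ))⁻¹) ^ 2 = (n : ℝ)⁻¹ := by rw [inv_pow, Real.sq_sqrt hn0.le]
    have e2 : ((√(k : ℝ))⁻¹) ^ 2 = (k : ℝ)⁻¹ := by rw [inv_pow, Real.sq_sqrt hk0.le]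
    split_ifs
    · rw [sub_sq, e1, e2]; ring
    · simp [e1]
  simp_rw [h1]
  rw [Finset.sum_add_distrib, ← Finset.sum_filter, Finset.filter_mem_eq_inter,
    Finset.inter_eq_right.2 (visitedRange_mono hkn w)]
  simp only [Finset.sum_const, card_visitedRange hw, nsmul_eq_mul]
  have hsk := Real.sqrt_pos.2 hk0
  have hsn := Real.sqrt_pos.2 hn0
  have hle : √(k : ℝ) ≤ √n := Real.sqrt_le_sqrt (by exact_mod_cast hkn)
  set r := √(k : ℝ) / √n with hr
  have hr1 : r ≤ 1 := by rw [hr, div_le_one hsn]; exact hle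
  have hr0 : 0 ≤ r := by positivity
  have hr2 : (k : ℝ) / n = r ^ 2 := by
    rw [hr, div_pow, Real.sq_sqrt hk0.le, Real.sq_sqrt hn0.le]
  have e3 : (n : ℝ) * (n : ℝ)⁻¹ + k * ((k : ℝ)⁻¹ - 2 * ((√n)⁻¹ * (√k)⁻¹)) = 2 * (1 - r) := by
    have : (k : ℝ) * ((√n)⁻¹ * (√k)⁻¹) = r := by
      rw [hr]; nth_rewrite 1 [← Real.mul_self_sqrt hk0.le]; field_simp
    rw [mul_sub, mul_inv_cancel₀ hn0.ne', mul_inv_cancel₀ hk0.ne']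
    linarith
  rw [e3, hr2]
  nlinarith

end Increments

section Annealed

variable {Ω Ω' : Type*} [MeasurableSpace Ω] [MeasurableSpace Ω'] {μ : Measure Ω}
  {P : Measure Ω'} {ω : ℤ → Ω → ℝ} {X : ℕ → Ω' → ℤ}

theorem measurable_scenery_comp (hω : ∀ x, Measurable (ω x)) {σ : Ω' → ℤ} (hσ : Measurable σ) :
    Measurable fun q : Ω × Ω' => ω (σ q.2) q.1 := by
  have h1 : Measurable fun q : Ω × ℤ => ω q.2 q.1 := measurable_from_prod_countable_left hω
  exact h1.comp (measurable_fst.prodMk (hσ.comp measurable_snd))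

theorem IsScenery.memLp_comp [IsProbabilityMeasure μ] [IsProbabilityMeasure P]
    (h : IsScenery μ ω) {σ : Ω' → ℤ} (hσ : Measurable σ) (k : ℕ) :
    MemLp (fun q : Ω × Ω' => ω (σ q.2) q.1) k (μ.prod P) := by
  have hm := measurable_scenery_comp h.meas hσ
  refine memLp_natCast_of_integrable_abs_pow hm.aestronglyMeasurable (fun j _ => ?_) k
  rw [integrable_prod_iff' (hm.abs.pow_const j).aestronglyMeasurable]
  constructor
  · exact Eventually.of_forall fun w => by simpa using (h.memLp (σ w) j).integrable_norm_pow'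
  · have : ∀ w, ∫ a, ‖|ω (σ w) a| ^ j‖ ∂μ = ∫ a, |ω 0 a| ^ j ∂μ := fun w => by
      rw [← h.integral_abs_pow (σ w)]
      simp
    simp_rw [this]
    exact integrable_const _

theorem measurable_sceneryWalk (hω : ∀ x, Measurable (ω x)) (hX : ∀ k, Measurable (X k)) (n : ℕ) :
    Measurable fun q : Ω × Ω' => sceneryWalk (fun x => ω x q.1) X n q.2 := by
  simp_rw [sceneryWalk_apply]
  exact Finset.measurable_fun_sum _ fun k _ => measurable_scenery_comp hω (measurable_walk hX k)

theorem IsScenery.memLp_sceneryWalk [IsProbabilityMeasure μ] [IsProbabilityMeasure P]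
    (h : IsScenery μ ω) (hX : ∀ k, Measurable (X k)) (n k : ℕ) :
    MemLp (fun q : Ω × Ω' => sceneryWalk (fun x => ω x q.1) X n q.2) k (μ.prod P) := by
  simp_rw [sceneryWalk_apply]
  exact memLp_finsetSum _ fun j _ => h.memLp_comp (measurable_walk hX j) k

theorem IsScenery.memLp_normalizedDiff [IsProbabilityMeasure μ] [IsProbabilityMeasure P]
    (h : IsScenery μ ω) (hX : ∀ k, Measurable (X k)) (k n j : ℕ) :
    MemLp (normalizedDiff ω X k n) j (μ.prod P) := by
  have h1 := (h.memLp_sceneryWalk (P := P) hX n j).mul_const (√n)⁻¹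
  have h2 := (h.memLp_sceneryWalk (P := P) hX k j).mul_const (√k)⁻¹
  exact h1.sub h2

/-- For a fixed path the difference is a linear form in the scenery with variance at most
`2 (1 - k / n)`, so its moments are of the corresponding order. -/
theorem exists_integral_normalizedDiff_pow_le [IsProbabilityMeasure μ] [IsProbabilityMeasure P]
    (h : IsScenery μ ω) (hX : IsRenewalSteps P X) (p : ℕ) :
    ∃ K : ℝ, 0 ≤ K ∧ ∀ k n : ℕ, 1 ≤ k → k ≤ n →
      ∫ q, normalizedDiff ω X k n q ^ (2 * p) ∂(μ.prod P) ≤ K * (1 - (k : ℝ) / n) ^ p := by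
  obtain ⟨K, hK0, hK⟩ := h.exists_integral_pow_sum_le p
  refine ⟨K * 2 ^ p, by positivity, fun k n hk hkn => ?_⟩
  have hint : Integrable (fun q => normalizedDiff ω X k n q ^ (2 * p)) (μ.prod P) :=
    integrable_pow_of_forall_memLp (h.memLp_normalizedDiff hX.meas k n) _
  rw [integral_prod_symm _ hint]
  have hle : ∀ᵐ w ∂P, ∫ a, normalizedDiff ω X k n (a, w) ^ (2 * p) ∂μ
      ≤ K * (2 * (1 - (k : ℝ) / n)) ^ p := by
    filter_upwards [hX.pos] with w hw
    simp_rw [normalizedDiff_eq_sum hkn _ hw]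
    refine (hK _ _).trans ?_
    have h1 := sum_sq_normalizedDiff_le (X := X) hk hkn hw
    have h2 : 0 ≤ ∑ x ∈ visitedRange X n w,
      ((√n)⁻¹ - if x ∈ visitedRange X k w then (√k)⁻¹ else 0) ^ 2 :=
      Finset.sum_nonneg fun x _ => sq_nonneg _
    gcongr
  calc _ ≤ ∫ w, K * (2 * (1 - (k : ℝ) / n)) ^ p ∂P :=
        integral_mono_ae hint.integral_prod_right (integrable_const _) hle
    _ = _ := by simp [mul_pow]; ring

end Annealed

/-! ### Mean-square estimates for the quenched laws -/

/-- The random walk in random scenery `Z_n` minus the `ω`-measurable proxy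
`(ω_1 + ⋯ + ω_N) / m`, `N = ⌊n m⌋`, of its quenched mean. The proxy gives each site the weight
`1 / m`, its asymptotic probability of being visited. -/
noncomputable def centredWalk {Ω Ω' : Type*} (ω : ℤ → Ω → ℝ) (X : ℕ → Ω' → ℤ) (m : ℝ) (n : ℕ)
    (q : Ω × Ω') : ℝ :=
  sceneryWalk (fun x => ω x q.1) X n q.2 - m⁻¹ * ∑ x ∈ Finset.Icc (1 : ℤ) ⌊n * m⌋₊, ω x q.1

section CentredPath

variable {Ω Ω' : Type*} {ω : ℤ → Ω → ℝ} {X : ℕ → Ω' → ℤ}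

theorem centredWalk_eq_sub (m : ℝ) (n : ℕ) (a : Ω) {w : Ω'} (hw : ∀ k, 0 < X k w) :
    centredWalk ω X m n (a, w) = ∑ x ∈ visitedRange X n w, ω x a
      - m⁻¹ * ∑ x ∈ Finset.Icc (1 : ℤ) ⌊n * m⌋₊, ω x a := by
  rw [centredWalk, sceneryWalk_eq_sum _ hw]

theorem sum_sub_sum_eq_sum_union (A B : Finset ℤ) (r : ℝ) (f : ℤ → ℝ) :
    ∑ x ∈ A, f x - r * ∑ x ∈ B, f x
      = ∑ x ∈ A ∪ B, ((if x ∈ A then 1 else 0) - r * (if x ∈ B then 1 else 0)) * f x := by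
  simp only [sub_mul, Finset.sum_sub_distrib, mul_assoc, ite_mul, one_mul, zero_mul]
  rw [← Finset.mul_sum, ← Finset.sum_filter, ← Finset.sum_filter, Finset.filter_mem_eq_inter,
    Finset.filter_mem_eq_inter, Finset.union_inter_cancel_left, Finset.union_inter_cancel_right]

theorem sum_union_sq (A B : Finset ℤ) (r : ℝ) :
    ∑ x ∈ A ∪ B, ((if x ∈ A then (1 : ℝ) else 0) - r * (if x ∈ B then 1 else 0)) ^ 2
      = A.card - 2 * r * (A ∩ B).card + r ^ 2 * B.card := by
  have h1 : ∀ x, ((if x ∈ A then (1 : ℝ) else 0) - r * (if x ∈ B then 1 else 0)) ^ 2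
      = (if x ∈ A then 1 else 0) - 2 * r * (if x ∈ A ∩ B then 1 else 0)
        + r ^ 2 * (if x ∈ B then 1 else 0) := by
    intro x
    by_cases hA : x ∈ A <;> by_cases hB : x ∈ B
    · simp only [hA, hB, Finset.mem_inter, and_self, if_true]; ring
    all_goals simp [hA, hB]
  simp_rw [h1, Finset.sum_add_distrib, Finset.sum_sub_distrib, ← Finset.mul_sum]
  have h2 : (A ∪ B) ∩ (A ∩ B) = A ∩ B :=
    Finset.inter_eq_right.2 (Finset.inter_subset_left.trans Finset.subset_union_left)
  rw [← Finset.sum_filter, ← Finset.sum_filter, ← Finset.sum_filter, Finset.filter_mem_eq_inter,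
    Finset.filter_mem_eq_inter, Finset.filter_mem_eq_inter, Finset.union_inter_cancel_left,
    Finset.union_inter_cancel_right, h2]
  simp

theorem abs_ite_sub_mul_ite_le (A B : Finset ℤ) {r : ℝ} (hr0 : 0 ≤ r) (hr1 : r ≤ 1) (x : ℤ) :
    |(if x ∈ A then (1 : ℝ) else 0) - r * (if x ∈ B then 1 else 0)| ≤ 1 := by
  rw [abs_le]
  split_ifs <;> constructor <;> linarith

end CentredPath

theorem abs_exp_neg_sub_exp_neg_le {x y : ℝ} (hx : 0 ≤ x) (hy : 0 ≤ y) :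
    |Real.exp (-x) - Real.exp (-y)| ≤ |x - y| := by
  have key : ∀ {x y : ℝ}, 0 ≤ x → x ≤ y → |Real.exp (-x) - Real.exp (-y)| ≤ |x - y| := by
    intro x y hx hxy
    have h1 : Real.exp (-y) ≤ Real.exp (-x) := Real.exp_le_exp.2 (by linarith)
    rw [abs_of_nonneg (by linarith), abs_sub_comm, abs_of_nonneg (by linarith)]
    have h2 : Real.exp (-y) = Real.exp (-x) * Real.exp (-(y - x)) := by
      rw [← Real.exp_add]; ring_nf
    have h3 := Real.add_one_le_exp (-(y - x))
    have h4 : Real.exp (-x) ≤ 1 := Real.exp_le_one_iff.2 (by linarith)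
    have h5 := Real.exp_pos (-x)
    rw [h2]
    nlinarith
  rcases le_total x y with h | h
  · exact key hx h
  · rw [abs_sub_comm, abs_sub_comm x]
    exact key hy h

section FixedPath

variable {Ω Ω' : Type*} [MeasurableSpace Ω] {μ : Measure Ω} [IsProbabilityMeasure μ]
  {ω : ℤ → Ω → ℝ} {X : ℕ → Ω' → ℤ}

theorem abs_floor_mul_div_sq_sub_le {m : ℝ} (hm1 : 1 ≤ m) (n : ℕ) :
    |m⁻¹ ^ 2 * (⌊n * m⌋₊ : ℝ) - n / m| ≤ 1 := by
  have h3 := Nat.floor_le (a := (n : ℝ) * m) (by positivity)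
  have h4 := Nat.lt_floor_add_one ((n : ℝ) * m)
  have : (n : ℝ) / m = m⁻¹ ^ 2 * (n * m) := by field_simp
  have hm2 : m⁻¹ ≤ 1 := inv_le_one_of_one_le₀ hm1
  have hm0 : 0 ≤ m⁻¹ := by positivity
  rw [this, ← mul_sub, abs_mul, abs_of_nonneg (by positivity)]
  refine mul_le_one₀ (pow_le_one₀ hm0 hm2) (abs_nonneg _) ?_
  rw [abs_le]; constructor <;> linarith

theorem integral_centredWalk_mul (h : IsScenery μ ω) (m : ℝ) (n : ℕ) {w w' : Ω'}
    (hw : ∀ k, 0 < X k w) (hw' : ∀ k, 0 < X k w') :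
    ∫ a, centredWalk ω X m n (a, w) * centredWalk ω X m n (a, w') ∂μ
      = ((visitedRange X n w ∩ visitedRange X n w').card : ℝ)
        - m⁻¹ * ((visitedRange X n w ∩ Finset.Icc (1 : ℤ) ⌊n * m⌋₊).card : ℝ)
        - m⁻¹ * ((visitedRange X n w' ∩ Finset.Icc (1 : ℤ) ⌊n * m⌋₊).card : ℝ)
        + m⁻¹ ^ 2 * ⌊n * m⌋₊ := by
  set A := visitedRange X n w
  set B := visitedRange X n w'
  set I := Finset.Icc (1 : ℤ) ⌊n * m⌋₊
  have hI : ((I ∩ I).card : ℝ) = ⌊n * m⌋₊ := by simp [I]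
  have hi : ∀ A B : Finset ℤ, Integrable (fun a => (∑ x ∈ A, ω x a) * ∑ y ∈ B, ω y a) μ := by
    intro A B
    simp_rw [Finset.sum_mul_sum]
    exact integrable_finsetSum _ fun x _ =>
      integrable_finsetSum _ fun y _ => h.integrable_mul x y
  have hpt : ∀ a, centredWalk ω X m n (a, w) * centredWalk ω X m n (a, w')
      = (∑ x ∈ A, ω x a) * (∑ y ∈ B, ω y a) - m⁻¹ * ((∑ x ∈ A, ω x a) * ∑ y ∈ I, ω y a)
        - m⁻¹ * ((∑ x ∈ B, ω x a) * ∑ y ∈ I, ω y a)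
        + m⁻¹ ^ 2 * ((∑ x ∈ I, ω x a) * ∑ y ∈ I, ω y a) := by
    intro a
    rw [centredWalk_eq_sub _ _ _ hw, centredWalk_eq_sub _ _ _ hw']
    ring
  have j1 := (hi A B).sub ((hi A I).const_mul m⁻¹)
  have j2 := j1.sub ((hi B I).const_mul m⁻¹)
  have e1 := integral_add j2 ((hi I I).const_mul (m⁻¹ ^ 2))
  have e2 := integral_sub j1 ((hi B I).const_mul m⁻¹)
  have e3 := integral_sub (hi A B) ((hi A I).const_mul m⁻¹)
  simp only [Pi.sub_apply] at e1 e2 e3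
  simp_rw [hpt]
  rw [e1, e2, e3]
  simp only [integral_const_mul, h.integral_sum_mul_sum, hI]

/-- Characteristic functions in the scenery alone, for fixed paths. For one path, `Y_n` has variance
about `n (1 - 1 / m)`. For two paths the proxy cancels in `Y_n - Y'_n`, whose variance
`2 (n - overlap)` is about `2 n (1 - 1 / m)`: the two copies decouple in the limit. The errors are
expressed through the overlap counts. -/
theorem exists_norm_integral_exp_centredWalk_sub_le (h : IsScenery μ ω) {m : ℝ} (hm1 : 1 ≤ m) :
    ∃ K : ℝ, 0 ≤ K ∧ ∀ n : ℕ, 1 ≤ n → ∀ t : ℝ, ∀ w w' : Ω', (∀ k, 0 < X k w) →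
      (∀ k, 0 < X k w') →
      ‖∫ a, Complex.exp ((t / √n * centredWalk ω X m n (a, w) : ℝ) * Complex.I) ∂μ
          - (Real.exp (-(t ^ 2 / 2 * (1 - 1 / m))) : ℝ)‖
        ≤ K * ((|t| ^ 3 + t ^ 4) / √n) + t ^ 2 / n *
          (|((visitedRange X n w ∩ Finset.Icc (1 : ℤ) ⌊n * m⌋₊).card : ℝ) - n| + 1) ∧
      ‖∫ a, Complex.exp ((t / √n * (centredWalk ω X m n (a, w) - centredWalk ω X m n (a, w')) : ℝ)
            * Complex.I) ∂μ - (Real.exp (-(t ^ 2 / 2 * (1 - 1 / m))) : ℝ) ^ 2‖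
        ≤ K * ((|t| ^ 3 + t ^ 4) / √n) + t ^ 2 / n *
          |((visitedRange X n w ∩ visitedRange X n w').card : ℝ) - n / m| := by
  obtain ⟨K, hK0, hK⟩ := h.exists_norm_integral_exp_sum_sub_le
  refine ⟨K * (1 + m), by positivity, fun n hn t w w' hw hw' => ?_⟩
  have hn0 : (0 : ℝ) < n := by exact_mod_cast hn
  have hn1 : (1 : ℝ) ≤ n := by exact_mod_cast hn
  have hm2 : m⁻¹ ≤ 1 := inv_le_one_of_one_le₀ hm1
  have hm0 : 0 ≤ m⁻¹ := by positivity
  set σ := 1 - 1 / m with hσ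
  have hσ0 : 0 ≤ σ := by rw [hσ, one_div]; linarith
  set s := t / √(n : ℝ) with hs
  have hs2 : s ^ 2 = t ^ 2 / n := by rw [hs, div_pow, Real.sq_sqrt hn0.le]
  set A := visitedRange X n w
  set B := visitedRange X n w'
  set I := Finset.Icc (1 : ℤ) ⌊n * m⌋₊ with hI
  have hA : A.card = n := card_visitedRange hw n
  have hB : B.card = n := card_visitedRange hw' n
  have hIc : I.card = ⌊n * m⌋₊ := by simp [hI]
  have hNle : (⌊n * m⌋₊ : ℝ) ≤ n * m := Nat.floor_le (by positivity)
  -- the remainder of the Gaussian approximation for a sum over at most `n (1 + m)` sites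
  have hrem : ∀ F : Finset ℤ, (F.card : ℝ) ≤ n * (1 + m) →
      K * F.card * (|s| ^ 3 + s ^ 4) ≤ K * (1 + m) * ((|t| ^ 3 + t ^ 4) / √n) := by
    intro F hF
    have hsq0 : 0 < √(n : ℝ) := Real.sqrt_pos.2 hn0
    have hsq1 : 1 ≤ √(n : ℝ) := by rw [Real.one_le_sqrt]; exact hn1
    have e0 : √(n : ℝ) ^ 2 = n := Real.sq_sqrt hn0.le
    have e1 : |s| ^ 3 * n = |t| ^ 3 / √n := by
      rw [hs, abs_div, abs_of_pos hsq0, div_pow]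
      nth_rewrite 2 [← e0]
      field_simp
    have e2 : s ^ 4 * n ≤ t ^ 4 / √n := by
      have : s ^ 4 * n = t ^ 4 / n := by
        rw [show s ^ 4 = (s ^ 2) ^ 2 by ring, hs2]; field_simp
      rw [this]
      gcongr
      nlinarith
    have e3 : 0 ≤ |s| ^ 3 + s ^ 4 := by positivity
    calc _ ≤ K * (n * (1 + m)) * (|s| ^ 3 + s ^ 4) := by gcongr
      _ = K * (1 + m) * (|s| ^ 3 * n + s ^ 4 * n) := by ring
      _ ≤ K * (1 + m) * (|t| ^ 3 / √n + t ^ 4 / √n) := by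
          rw [e1]; gcongr
      _ = _ := by rw [add_div]
  constructor
  · have hlin : ∀ a, centredWalk ω X m n (a, w) = ∑ x ∈ A ∪ I,
        ((if x ∈ A then 1 else 0) - m⁻¹ * (if x ∈ I then 1 else 0)) * ω x a := fun a => by
      rw [centredWalk_eq_sub _ _ _ hw, sum_sub_sum_eq_sum_union A I m⁻¹ fun x => ω x a]
    simp_rw [hlin]
    have h1 := hK (A ∪ I) (fun x => (if x ∈ A then 1 else 0) - m⁻¹ * (if x ∈ I then 1 else 0))
      (abs_ite_sub_mul_ite_le A I hm0 hm2) s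
    rw [sum_union_sq, hA, hIc] at h1
    set b := ((A ∩ I).card : ℝ)
    have h2 : (((A ∪ I).card : ℕ) : ℝ) ≤ n * (1 + m) := by
      have := Finset.card_union_le A I
      rw [hA, hIc] at this
      have h3 : (((A ∪ I).card : ℕ) : ℝ) ≤ n + (⌊n * m⌋₊ : ℝ) := by exact_mod_cast this
      linarith
    have hV0 : 0 ≤ (n : ℝ) - 2 * m⁻¹ * b + m⁻¹ ^ 2 * (⌊n * m⌋₊ : ℝ) := by
      have := sum_union_sq A I m⁻¹
      rw [hA, hIc] at this
      rw [← this]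
      exact Finset.sum_nonneg fun x _ => sq_nonneg _
    have h3 : ‖((Real.exp (-(s ^ 2 / 2 * ((n : ℝ) - 2 * m⁻¹ * b
          + m⁻¹ ^ 2 * (⌊n * m⌋₊ : ℝ)))) : ℝ) : ℂ) - (Real.exp (-(t ^ 2 / 2 * σ)) : ℝ)‖
        ≤ t ^ 2 / n * (|b - n| + 1) := by
      rw [← Complex.ofReal_sub, Complex.norm_real, Real.norm_eq_abs]
      refine (abs_exp_neg_sub_exp_neg_le (by positivity) (by positivity)).trans ?_
      have e1 : s ^ 2 / 2 * ((n : ℝ) - 2 * m⁻¹ * b + m⁻¹ ^ 2 * (⌊n * m⌋₊ : ℝ)) - t ^ 2 / 2 * σ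
          = t ^ 2 / n * (-(m⁻¹ * (b - n)) + 1 / 2 * (m⁻¹ ^ 2 * (⌊n * m⌋₊ : ℝ) - n / m)) := by
        rw [hs2, hσ]
        field_simp
        ring
      rw [e1, abs_mul, abs_of_nonneg (by positivity)]
      gcongr
      refine (abs_add_le _ _).trans (add_le_add ?_ ?_)
      · rw [abs_neg, abs_mul, abs_of_nonneg hm0]
        exact mul_le_of_le_one_left (abs_nonneg _) hm2
      · rw [abs_mul, abs_of_nonneg (by norm_num : (0 : ℝ) ≤ 1 / 2)]
        have := abs_floor_mul_div_sq_sub_le hm1 n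
        linarith
    exact (norm_sub_le_norm_sub_add_norm_sub _ _ _).trans
      (add_le_add (h1.trans (hrem _ h2)) h3)
  · have hlin : ∀ a, centredWalk ω X m n (a, w) - centredWalk ω X m n (a, w') = ∑ x ∈ A ∪ B,
        ((if x ∈ A then 1 else 0) - 1 * (if x ∈ B then 1 else 0)) * ω x a := fun a => by
      rw [centredWalk_eq_sub _ _ _ hw, centredWalk_eq_sub _ _ _ hw', sub_sub_sub_cancel_right,
        ← sum_sub_sum_eq_sum_union A B 1 fun x => ω x a, one_mul]
    simp_rw [hlin]
    have h1 := hK (A ∪ B) (fun x => (if x ∈ A then 1 else 0) - 1 * (if x ∈ B then 1 else 0))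
      (abs_ite_sub_mul_ite_le A B zero_le_one le_rfl) s
    rw [sum_union_sq, hA, hB] at h1
    set b := ((A ∩ B).card : ℝ)
    have h2 : (((A ∪ B).card : ℕ) : ℝ) ≤ n * (1 + m) := by
      have := Finset.card_union_le A B
      rw [hA, hB] at this
      have h3 : (((A ∪ B).card : ℕ) : ℝ) ≤ n + n := by exact_mod_cast this
      nlinarith
    have hV0 : 0 ≤ (n : ℝ) - 2 * 1 * b + 1 ^ 2 * n := by
      have := sum_union_sq A B 1
      rw [hA, hB] at this
      rw [← this]
      exact Finset.sum_nonneg fun x _ => sq_nonneg _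
    have h3 : ‖((Real.exp (-(s ^ 2 / 2 * ((n : ℝ) - 2 * 1 * b + 1 ^ 2 * n))) : ℝ) : ℂ)
          - (Real.exp (-(t ^ 2 / 2 * σ)) : ℝ) ^ 2‖ ≤ t ^ 2 / n * |b - n / m| := by
      have e0 : ((Real.exp (-(t ^ 2 / 2 * σ)) : ℝ) : ℂ) ^ 2 = (Real.exp (-(t ^ 2 * σ)) : ℝ) := by
        rw [← Complex.ofReal_pow, ← Real.exp_nat_mul]
        congr 2
        push_cast; ring
      rw [e0, ← Complex.ofReal_sub, Complex.norm_real, Real.norm_eq_abs]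
      refine (abs_exp_neg_sub_exp_neg_le (by positivity) (by positivity)).trans ?_
      have e1 : s ^ 2 / 2 * ((n : ℝ) - 2 * 1 * b + 1 ^ 2 * n) - t ^ 2 * σ
          = -(t ^ 2 / n * (b - n / m)) := by
        rw [hs2, hσ]
        field_simp
        ring
      rw [e1, abs_neg, abs_mul, abs_of_nonneg (by positivity)]
    exact (norm_sub_le_norm_sub_add_norm_sub _ _ _).trans
      (add_le_add (h1.trans (hrem _ h2)) h3)

end FixedPath

section CentredWalk

variable {Ω Ω' : Type*} [MeasurableSpace Ω] [MeasurableSpace Ω'] {μ : Measure Ω}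
  [IsProbabilityMeasure μ] {P : Measure Ω'} [IsProbabilityMeasure P]
  {ω : ℤ → Ω → ℝ} {X : ℕ → Ω' → ℤ}

theorem measurable_centredWalk (hω : ∀ x, Measurable (ω x)) (hX : ∀ k, Measurable (X k)) (m : ℝ)
    (n : ℕ) : Measurable (centredWalk ω X m n) := by
  refine (measurable_sceneryWalk hω hX n).sub (Measurable.const_mul ?_ _)
  exact Finset.measurable_fun_sum _ fun x _ => (hω x).comp measurable_fst

theorem memLp_centredWalk (h : IsScenery μ ω) (hX : ∀ k, Measurable (X k)) (m : ℝ) (n k : ℕ) :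
    MemLp (centredWalk ω X m n) k (μ.prod P) := by
  refine (h.memLp_sceneryWalk hX n k).sub (MemLp.const_mul ?_ _)
  exact memLp_finsetSum _ fun x _ => (h.memLp x k).comp_fst P

theorem integrable_overlapError (hX : IsRenewalSteps P X)
    (hsq : Integrable (fun w => (X 0 w : ℝ) ^ 2) P) (n N : ℕ) (a : ℝ) :
    Integrable (fun p : Ω' × Ω' =>
      |((visitedRange X n p.1 ∩ visitedRange X n p.2).card : ℝ) - a|
        + |((visitedRange X n p.1 ∩ Finset.Icc (1 : ℤ) N).card : ℝ) - n|
        + |((visitedRange X n p.2 ∩ Finset.Icc (1 : ℤ) N).card : ℝ) - n| + 1) (P.prod P) := by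
  have h2 := integrable_abs_card_inter_Icc_sub hX hsq n N
  exact (((integrable_abs_overlap_sub hX n a).add (h2.comp_fst P)).add (h2.comp_snd P)).add
    (integrable_const 1)

/-- The overlap counts that occur as errors in the two-replica computations are `O(n ^ (3 / 4))` in
mean. -/
theorem exists_integral_overlapError_le (hX : IsRenewalSteps P X)
    (haper : IsAperiodic (P.map (X 0)).support)
    (hint : Integrable (fun w => (X 0 w : ℝ)) P) (hsq : Integrable (fun w => (X 0 w : ℝ) ^ 2) P)
    {m : ℝ} (hm : m = ∫ w, (X 0 w : ℝ) ∂P) :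
    ∃ C : ℝ, 0 ≤ C ∧ ∀ n : ℕ, 1 ≤ n →
      ∫ p, (|((visitedRange X n p.1 ∩ visitedRange X n p.2).card : ℝ) - n / m|
        + |((visitedRange X n p.1 ∩ Finset.Icc (1 : ℤ) ⌊n * m⌋₊).card : ℝ) - n|
        + |((visitedRange X n p.2 ∩ Finset.Icc (1 : ℤ) ⌊n * m⌋₊).card : ℝ) - n| + 1) ∂(P.prod P)
      ≤ C * (n : ℝ) ^ (3 / 4 : ℝ) := by
  obtain ⟨C₁, h1, hC₁⟩ := exists_integral_abs_overlap_sub_le hX haper hint hsq hm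
  obtain ⟨C₂, h2, hC₂⟩ := exists_integral_abs_card_inter_Icc_sub_le hX hint hsq hm
  refine ⟨C₁ + 2 * C₂ + 1, by positivity, fun n hn => ?_⟩
  have hn1 : (1 : ℝ) ≤ n := by exact_mod_cast hn
  have hpow1 : 1 ≤ (n : ℝ) ^ (3 / 4 : ℝ) := Real.one_le_rpow hn1 (by norm_num)
  have hpow2 : √(n : ℝ) ≤ (n : ℝ) ^ (3 / 4 : ℝ) := by
    rw [Real.sqrt_eq_rpow]
    exact Real.rpow_le_rpow_of_exponent_le hn1 (by norm_num)
  have i1 := integrable_abs_overlap_sub hX n (n / m)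
  have i2 := integrable_abs_card_inter_Icc_sub hX hsq n ⌊n * m⌋₊
  have j1 := i1.add (i2.comp_fst P)
  have j2 := j1.add (i2.comp_snd P)
  have e1 := integral_add j2 (integrable_const (μ := P.prod P) (1 : ℝ))
  have e2 := integral_add j1 (i2.comp_snd P)
  have e3 := integral_add i1 (i2.comp_fst P)
  simp only [Pi.add_apply] at e1 e2 e3
  rw [e1, e2, e3, integral_fun_fst (μ := P) (ν := P)
      (fun w => |((visitedRange X n w ∩ Finset.Icc (1 : ℤ) ⌊n * m⌋₊).card : ℝ) - n|),
    integral_fun_snd (μ := P) (ν := P)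
      (fun w => |((visitedRange X n w ∩ Finset.Icc (1 : ℤ) ⌊n * m⌋₊).card : ℝ) - n|)]
  simp only [probReal_univ, integral_const, smul_eq_mul, mul_one]
  have h3 := hC₁ n hn
  have h4 := hC₂ n hn
  have h5 := mul_le_mul_of_nonneg_left hpow2 h2
  linarith

/-- The proxy in `centredWalk` approximates the quenched mean of `Z_n` within `O(n ^ (3 / 8))` in
`L²(μ)`, which is negligible at the scale `√n`. -/
theorem exists_integral_sq_integral_centredWalk_le (h : IsScenery μ ω) (hX : IsRenewalSteps P X)
    (haper : IsAperiodic (P.map (X 0)).support)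
    (hint : Integrable (fun w => (X 0 w : ℝ)) P) (hsq : Integrable (fun w => (X 0 w : ℝ) ^ 2) P)
    {m : ℝ} (hm : m = ∫ w, (X 0 w : ℝ) ∂P) :
    ∃ C : ℝ, 0 ≤ C ∧ ∀ n : ℕ, 1 ≤ n →
      Integrable (fun a => (∫ w, centredWalk ω X m n (a, w) ∂P) ^ 2) μ ∧
      ∫ a, (∫ w, centredWalk ω X m n (a, w) ∂P) ^ 2 ∂μ ≤ C * (n : ℝ) ^ (3 / 4 : ℝ) := by
  have hm1 : 1 ≤ m := hm ▸ one_le_mean hX hint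
  obtain ⟨C, hC0, hC⟩ := exists_integral_overlapError_le hX haper hint hsq hm
  refine ⟨C, hC0, fun n hn => ?_⟩
  have hΨ : MemLp (fun q : Ω × Ω' => (centredWalk ω X m n q : ℂ)) 2 (μ.prod P) :=
    (memLp_centredWalk h hX.meas m n 2).ofReal
  have key := integral_norm_sq_integral_le_of_memLp hΨ
    (integrable_overlapError hX hsq n ⌊n * m⌋₊ (n / m)) (by
      filter_upwards [ae_prod_pos hX] with p hp
      have h1 : ∀ a, (centredWalk ω X m n (a, p.1) : ℂ)
          * (starRingEnd ℂ) (centredWalk ω X m n (a, p.2) : ℂ)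
          = ((centredWalk ω X m n (a, p.1) * centredWalk ω X m n (a, p.2) : ℝ) : ℂ) := by
        intro a; simp
      simp_rw [h1]
      rw [integral_complex_ofReal, Complex.norm_real, Real.norm_eq_abs,
        integral_centredWalk_mul h m n hp.1 hp.2]
      have h2 := abs_floor_mul_div_sq_sub_le hm1 n
      have hm2 : m⁻¹ ≤ 1 := inv_le_one_of_one_le₀ hm1
      have hm0 : 0 ≤ m⁻¹ := by positivity
      set a := ((visitedRange X n p.1 ∩ visitedRange X n p.2).card : ℝ)
      set b := ((visitedRange X n p.1 ∩ Finset.Icc (1 : ℤ) ⌊n * m⌋₊).card : ℝ)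
      set c := ((visitedRange X n p.2 ∩ Finset.Icc (1 : ℤ) ⌊n * m⌋₊).card : ℝ)
      have h3 : a - m⁻¹ * b - m⁻¹ * c + m⁻¹ ^ 2 * (⌊n * m⌋₊ : ℝ)
          = (a - n / m) + (-(m⁻¹ * (b - n)) + -(m⁻¹ * (c - n)))
            + (m⁻¹ ^ 2 * (⌊n * m⌋₊ : ℝ) - n / m) := by
        field_simp
        ring
      have h4 : ∀ y : ℝ, |-(m⁻¹ * y)| ≤ |y| := fun y => by
        rw [abs_neg, abs_mul, abs_of_nonneg hm0]
        exact mul_le_of_le_one_left (abs_nonneg _) hm2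
      rw [h3]
      calc _ ≤ |a - n / m| + |-(m⁻¹ * (b - n)) + -(m⁻¹ * (c - n))|
            + |m⁻¹ ^ 2 * (⌊n * m⌋₊ : ℝ) - n / m| := abs_add_three _ _ _
        _ ≤ |a - n / m| + (|b - n| + |c - n|) + 1 := by
            gcongr
            exact (abs_add_le _ _).trans (add_le_add (h4 _) (h4 _))
        _ = _ := by ring)
  have h5 : ∀ a, ‖∫ w, (centredWalk ω X m n (a, w) : ℂ) ∂P‖ ^ 2
      = (∫ w, centredWalk ω X m n (a, w) ∂P) ^ 2 := by
    intro a
    rw [integral_complex_ofReal, Complex.norm_real, Real.norm_eq_abs, sq_abs]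
  simp only [h5] at key
  exact ⟨key.1, key.2.trans (hC n hn)⟩

/-- The quenched characteristic function of `Y_n / √n` is close to the Gaussian one in mean square,
by the two-replica identity for `exp(i t Y_n / √n) - g` with `g` the Gaussian characteristic
function: the correlation of two copies is `g² - g · g - g · g + g²` up to errors. -/
theorem exists_integral_norm_sq_charFun_sub_le (h : IsScenery μ ω) (hX : IsRenewalSteps P X)
    (haper : IsAperiodic (P.map (X 0)).support)
    (hint : Integrable (fun w => (X 0 w : ℝ)) P) (hsq : Integrable (fun w => (X 0 w : ℝ) ^ 2) P)
    {m : ℝ} (hm : m = ∫ w, (X 0 w : ℝ) ∂P) (t : ℝ) :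
    ∃ C : ℝ, 0 ≤ C ∧ ∀ n : ℕ, 1 ≤ n →
      Integrable (fun a => ‖∫ w, Complex.exp ((t / √n * centredWalk ω X m n (a, w) : ℝ)
        * Complex.I) ∂P - (Real.exp (-(t ^ 2 / 2 * (1 - 1 / m))) : ℝ)‖ ^ 2) μ ∧
      ∫ a, ‖∫ w, Complex.exp ((t / √n * centredWalk ω X m n (a, w) : ℝ) * Complex.I) ∂P
        - (Real.exp (-(t ^ 2 / 2 * (1 - 1 / m))) : ℝ)‖ ^ 2 ∂μ ≤ C * (n : ℝ) ^ (-(1 / 4) : ℝ) := by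
  have hm1 : 1 ≤ m := hm ▸ one_le_mean hX hint
  obtain ⟨C, hC0, hC⟩ := exists_integral_overlapError_le hX haper hint hsq hm
  obtain ⟨K, hK0, hK⟩ := exists_norm_integral_exp_centredWalk_sub_le (X := X) h hm1
  refine ⟨3 * (K * (|t| ^ 3 + t ^ 4)) + 2 * t ^ 2 * C, by positivity, fun n hn => ?_⟩
  have hn0 : (0 : ℝ) < n := by exact_mod_cast hn
  have hn1 : (1 : ℝ) ≤ n := by exact_mod_cast hn
  set g : ℝ := Real.exp (-(t ^ 2 / 2 * (1 - 1 / m))) with hg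
  have hg0 : 0 ≤ g := (Real.exp_pos _).le
  have hg1 : g ≤ 1 := by
    rw [hg, Real.exp_le_one_iff]
    have : 1 / m ≤ 1 := by rw [div_le_one (by linarith)]; exact hm1
    have : 0 ≤ t ^ 2 / 2 * (1 - 1 / m) := mul_nonneg (by positivity) (by linarith)
    linarith
  set Y := centredWalk ω X m n with hY
  have hYm : Measurable Y := measurable_centredWalk h.meas hX.meas m n
  let e : Ω × Ω' → ℂ := fun q => Complex.exp ((t / √n * Y q : ℝ) * Complex.I)
  have hem : Measurable e := by fun_prop
  have hen : ∀ q, ‖e q‖ = 1 := fun q => Complex.norm_exp_ofReal_mul_I _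
  have hΨ : MemLp (fun q => e q - (g : ℂ)) 2 (μ.prod P) :=
    (MemLp.of_bound hem.aestronglyMeasurable 1 (Eventually.of_forall fun q => (hen q).le)).sub
      (memLp_const _)
  set R := 3 * (K * ((|t| ^ 3 + t ^ 4) / √n)) with hR
  have herr := integrable_overlapError hX hsq n ⌊n * m⌋₊ (n / m)
  have key := integral_norm_sq_integral_le_of_memLp hΨ
    ((integrable_const R).add (herr.const_mul (2 * t ^ 2 / n))) (by
      filter_upwards [ae_prod_pos hX] with p hp
      have k1 := (hK n hn t p.1 p.2 hp.1 hp.2)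
      have k2 := (hK n hn t p.2 p.1 hp.2 hp.1).1
      rw [← hY, ← hg] at k1
      rw [← hY, ← hg] at k2
      have ie : ∀ w, Integrable (fun a => e (a, w)) μ := fun w =>
        Integrable.of_bound (hem.comp measurable_prodMk_right).aestronglyMeasurable 1
          (Eventually.of_forall fun a => (hen _).le)
      have ies : ∀ w, Integrable (fun a => (starRingEnd ℂ) (e (a, w))) μ := fun w =>
        Integrable.of_bound
          (Complex.continuous_conj.comp_aestronglyMeasurable (ie w).aestronglyMeasurable) 1
          (Eventually.of_forall fun a => by rw [RCLike.norm_conj]; exact (hen _).le)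
      have hee : ∀ a, e (a, p.1) * (starRingEnd ℂ) (e (a, p.2))
          = Complex.exp ((t / √n * (Y (a, p.1) - Y (a, p.2)) : ℝ) * Complex.I) := by
        intro a
        simp only [e]
        rw [← Complex.exp_conj, ← Complex.exp_add]
        congr 1
        simp
        ring
      have iee : Integrable (fun a => e (a, p.1) * (starRingEnd ℂ) (e (a, p.2))) μ := by
        refine Integrable.of_bound (C := 1) ((ie p.1).aestronglyMeasurable.mul
          (ies p.2).aestronglyMeasurable) (Eventually.of_forall fun a => ?_)
        rw [hee]
        exact (Complex.norm_exp_ofReal_mul_I _).le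
      have hval : ∫ a, (e (a, p.1) - (g : ℂ)) * (starRingEnd ℂ) (e (a, p.2) - (g : ℂ)) ∂μ
          = (∫ a, e (a, p.1) * (starRingEnd ℂ) (e (a, p.2)) ∂μ - (g : ℂ) ^ 2)
            - g * (∫ a, e (a, p.1) ∂μ - g) - g * (starRingEnd ℂ) (∫ a, e (a, p.2) ∂μ - g) := by
        have h1 : ∀ a, (e (a, p.1) - (g : ℂ)) * (starRingEnd ℂ) (e (a, p.2) - (g : ℂ))
            = e (a, p.1) * (starRingEnd ℂ) (e (a, p.2)) - g * e (a, p.1)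
              - g * (starRingEnd ℂ) (e (a, p.2)) + (g : ℂ) ^ 2 := by
          intro a
          rw [map_sub, Complex.conj_ofReal]
          ring
        have j1 := iee.sub ((ie p.1).const_mul (g : ℂ))
        have j2 := j1.sub ((ies p.2).const_mul (g : ℂ))
        have e1 := integral_add j2 (integrable_const (μ := μ) ((g : ℂ) ^ 2))
        have e2 := integral_sub j1 ((ies p.2).const_mul (g : ℂ))
        have e3 := integral_sub iee ((ie p.1).const_mul (g : ℂ))
        simp only [Pi.sub_apply] at e1 e2 e3
        simp_rw [h1]
        rw [e1, e2, e3, integral_const_mul, integral_const_mul, integral_conj]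
        simp
        ring
      rw [hval]
      simp_rw [hee]
      have b1 : ‖(g : ℂ) * (∫ a, e (a, p.1) ∂μ - g)‖ ≤ ‖∫ a, e (a, p.1) ∂μ - g‖ := by
        rw [norm_mul, Complex.norm_real, Real.norm_of_nonneg hg0]
        exact mul_le_of_le_one_left (norm_nonneg _) hg1
      have b2 : ‖(g : ℂ) * (starRingEnd ℂ) (∫ a, e (a, p.2) ∂μ - g)‖
          ≤ ‖∫ a, e (a, p.2) ∂μ - g‖ := by
        rw [norm_mul, Complex.norm_real, Real.norm_of_nonneg hg0, RCLike.norm_conj]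
        exact mul_le_of_le_one_left (norm_nonneg _) hg1
      have b3 := (norm_sub_le ((∫ a, Complex.exp ((t / √n * (Y (a, p.1) - Y (a, p.2)) : ℝ)
        * Complex.I) ∂μ - (g : ℂ) ^ 2) - g * (∫ a, e (a, p.1) ∂μ - g))
        (g * (starRingEnd ℂ) (∫ a, e (a, p.2) ∂μ - g))).trans
        (add_le_add (norm_sub_le _ _) le_rfl)
      refine b3.trans ?_
      have k11 := k1.1
      have k12 := k1.2
      have k13 := k2
      change ‖∫ a, e (a, p.1) ∂μ - g‖ ≤ _ at k11
      change ‖∫ a, e (a, p.2) ∂μ - g‖ ≤ _ at k13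
      have hc : 0 ≤ t ^ 2 / n := by positivity
      have hrr : 2 * t ^ 2 / n = 2 * (t ^ 2 / n) := by ring
      simp only [Pi.add_apply, hrr, hR]
      have hov := mul_nonneg hc (abs_nonneg
        (((visitedRange X n p.1 ∩ visitedRange X n p.2).card : ℝ) - n / m))
      have hov1 := mul_nonneg hc (abs_nonneg
        (((visitedRange X n p.1 ∩ Finset.Icc (1 : ℤ) ⌊n * m⌋₊).card : ℝ) - n))
      have hov2 := mul_nonneg hc (abs_nonneg
        (((visitedRange X n p.2 ∩ Finset.Icc (1 : ℤ) ⌊n * m⌋₊).card : ℝ) - n))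
      linarith)
  have hfin : ∀ a, ∫ w, (e (a, w) - (g : ℂ)) ∂P = ∫ w, e (a, w) ∂P - g := by
    intro a
    have : Integrable (fun w => e (a, w)) P :=
      Integrable.of_bound (hem.comp measurable_prodMk_left).aestronglyMeasurable 1
        (Eventually.of_forall fun w => (hen _).le)
    rw [integral_sub this (integrable_const _)]
    simp
  simp only [hfin] at key
  refine ⟨key.1, key.2.trans ?_⟩
  have e1 := integral_add (integrable_const (μ := P.prod P) R) (herr.const_mul (2 * t ^ 2 / n))
  simp only [Pi.add_apply] at e1 ⊢
  rw [e1, integral_const, probReal_univ, one_smul, integral_const_mul]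
  have h1 := mul_le_mul_of_nonneg_left (hC n hn) (by positivity : 0 ≤ 2 * t ^ 2 / n)
  have h2 : 2 * t ^ 2 / n * (C * (n : ℝ) ^ (3 / 4 : ℝ))
      = 2 * t ^ 2 * C * (n : ℝ) ^ (-(1 / 4) : ℝ) := by
    have : (n : ℝ) ^ (-(1 / 4) : ℝ) = (n : ℝ) ^ (3 / 4 : ℝ) / n := by
      rw [← Real.rpow_sub_one hn0.ne']; norm_num
    rw [this]; ring
  have h3 : (√(n : ℝ))⁻¹ ≤ (n : ℝ) ^ (-(1 / 4) : ℝ) := by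
    rw [Real.sqrt_eq_rpow, ← Real.rpow_neg hn0.le]
    exact Real.rpow_le_rpow_of_exponent_le hn1 (by norm_num)
  have h4 : R ≤ 3 * (K * (|t| ^ 3 + t ^ 4)) * (n : ℝ) ^ (-(1 / 4) : ℝ) := by
    have : R = 3 * (K * (|t| ^ 3 + t ^ 4)) * (√(n : ℝ))⁻¹ := by rw [hR]; ring
    rw [this]
    gcongr
  rw [h2] at h1
  linarith

end CentredWalk

/-! ### Convergence of characteristic functions -/

theorem ae_tendsto_zero_of_summable_integral {Ω : Type*} [MeasurableSpace Ω] {μ : Measure Ω}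
    {f : ℕ → Ω → ℝ} (hf0 : ∀ n a, 0 ≤ f n a) (hf : ∀ n, Integrable (f n) μ) {b : ℕ → ℝ}
    (hb : Summable b) (hfb : ∀ n, ∫ a, f n a ∂μ ≤ b n) :
    ∀ᵐ a ∂μ, Tendsto (fun n => f n a) atTop (𝓝 0) := by
  have hb0 : ∀ n, 0 ≤ b n := fun n => (integral_nonneg (hf0 n)).trans (hfb n)
  have hm : ∀ n, AEMeasurable (fun a => ENNReal.ofReal (f n a)) μ :=
    fun n => (hf n).aestronglyMeasurable.aemeasurable.ennreal_ofReal
  have h1 : ∫⁻ a, ∑' n, ENNReal.ofReal (f n a) ∂μ ≠ ⊤ := by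
    rw [lintegral_tsum hm]
    refine ne_top_of_le_ne_top hb.tsum_ofReal_ne_top (ENNReal.tsum_le_tsum fun n => ?_)
    rw [← ofReal_integral_eq_lintegral_ofReal (hf n) (Eventually.of_forall (hf0 n))]
    exact ENNReal.ofReal_le_ofReal (hfb n)
  filter_upwards [ae_lt_top' (AEMeasurable.tsum hm) h1] with a ha
  have h2 := ENNReal.tendsto_atTop_zero_of_tsum_ne_top ha.ne
  have h3 := (ENNReal.tendsto_toReal ENNReal.zero_ne_top).comp h2
  simpa [Function.comp_def, ENNReal.toReal_ofReal (hf0 _ _)] using h3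

section CharFun

/-- The classical increment inequality, from Cauchy-Schwarz. It holds with no moment assumption. -/
theorem norm_charFun_sub_le (ν : Measure ℝ) [IsProbabilityMeasure ν] (t s : ℝ) :
    ‖charFun ν t - charFun ν s‖ ≤ √(2 * (1 - (charFun ν (t - s)).re)) := by
  have hint : ∀ r : ℝ, Integrable (fun x : ℝ => Complex.exp (r * x * Complex.I)) ν := by
    intro r
    refine Integrable.of_bound (by fun_prop) 1 (Eventually.of_forall fun x => ?_)
    rw [← Complex.ofReal_mul, Complex.norm_exp_ofReal_mul_I]
  have hnorm : ∀ r x : ℝ, ‖Complex.exp (r * x * Complex.I) - 1‖ ^ 2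
      = 2 * (1 - (Complex.exp (r * x * Complex.I)).re) := by
    intro r x
    rw [← Complex.ofReal_mul, ← Complex.normSq_eq_norm_sq, Complex.normSq_apply, Complex.sub_re,
      Complex.sub_im, Complex.exp_ofReal_mul_I_re, Complex.exp_ofReal_mul_I_im, Complex.one_re,
      Complex.one_im]
    nlinarith [Real.sin_sq_add_cos_sq (r * x)]
  have hL : MemLp (fun x : ℝ => ‖Complex.exp (((t - s : ℝ) : ℂ) * x * Complex.I) - 1‖) 2 ν := by
    refine MemLp.of_bound (by fun_prop) 2 (Eventually.of_forall fun x => ?_)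
    rw [norm_norm]
    refine (norm_sub_le _ _).trans ?_
    rw [← Complex.ofReal_mul, Complex.norm_exp_ofReal_mul_I]; norm_num
  calc ‖charFun ν t - charFun ν s‖
      = ‖∫ x : ℝ, (Complex.exp (t * x * Complex.I) - Complex.exp (s * x * Complex.I)) ∂ν‖ := by
        rw [charFun_apply_real, charFun_apply_real, ← integral_sub (hint t) (hint s)]
    _ ≤ ∫ x : ℝ, ‖Complex.exp (t * x * Complex.I) - Complex.exp (s * x * Complex.I)‖ ∂ν :=
        norm_integral_le_integral_norm _
    _ = ∫ x : ℝ, |‖Complex.exp (((t - s : ℝ) : ℂ) * x * Complex.I) - 1‖| ∂ν := by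
        refine integral_congr_ae (Eventually.of_forall fun x => ?_)
        have : Complex.exp (t * x * Complex.I) - Complex.exp (s * x * Complex.I)
            = Complex.exp ((s * x : ℝ) * Complex.I)
              * (Complex.exp (((t - s : ℝ) : ℂ) * x * Complex.I) - 1) := by
          rw [mul_sub, ← Complex.exp_add, mul_one]
          push_cast
          ring_nf
        simp only [this, norm_mul, Complex.norm_exp_ofReal_mul_I, one_mul, abs_norm]
    _ ≤ √(∫ x : ℝ, ‖Complex.exp (((t - s : ℝ) : ℂ) * x * Complex.I) - 1‖ ^ 2 ∂ν) :=
        integral_abs_le_sqrt hL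
    _ = √(2 * (1 - (charFun ν (t - s)).re)) := by
        congr 1
        simp_rw [hnorm]
        have hre : ∫ x : ℝ, (Complex.exp (((t - s : ℝ) : ℂ) * x * Complex.I)).re ∂ν
            = (charFun ν (t - s)).re := by
          rw [charFun_apply_real]
          exact integral_re (hint (t - s))
        have hre' : Integrable
            (fun x : ℝ => (Complex.exp (((t - s : ℝ) : ℂ) * x * Complex.I)).re) ν :=
          (hint (t - s)).re
        rw [integral_const_mul, integral_sub (integrable_const _) hre', hre]
        simp

/-- Almost everywhere convergence of characteristic functions to a characteristic function is
convergence everywhere. Given `t`, almost every `s` is such that both `s` and `t - s` are points of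
convergence; with `s` close to `t`, the increment inequality controls the passage from `s` to `t`
through the value at `t - s`. -/
theorem tendsto_charFun_of_ae {ν : ℕ → Measure ℝ} [∀ n, IsProbabilityMeasure (ν n)]
    {ν₀ : Measure ℝ} [IsProbabilityMeasure ν₀]
    (h : ∀ᵐ t : ℝ, Tendsto (fun n => charFun (ν n) t) atTop (𝓝 (charFun ν₀ t))) (t : ℝ) :
    Tendsto (fun n => charFun (ν n) t) atTop (𝓝 (charFun ν₀ t)) := by
  rw [Metric.tendsto_atTop']
  intro ε hε
  have hc : Continuous (charFun ν₀) := continuous_charFun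
  set F : ℝ → ℝ := fun s => √(2 * (1 - (charFun ν₀ (t - s)).re)) + ‖charFun ν₀ s - charFun ν₀ t‖
    with hF
  have hFc : Continuous F := by fun_prop
  have hFt : F t = 0 := by simp [hF]
  have hgood : ∀ᵐ s : ℝ, Tendsto (fun n => charFun (ν n) s) atTop (𝓝 (charFun ν₀ s)) ∧
      Tendsto (fun n => charFun (ν n) (t - s)) atTop (𝓝 (charFun ν₀ (t - s))) :=
    h.and ((Measure.measurePreserving_sub_left volume t).quasiMeasurePreserving.ae h)
  have hopen : IsOpen {s | F s < ε} := isOpen_lt hFc continuous_const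
  obtain ⟨s, hs, hs1, hs2⟩ := (Measure.dense_of_ae hgood).inter_open_nonempty _ hopen
    ⟨t, by simp [hFt, hε]⟩
  have hlim : Tendsto (fun n => √(2 * (1 - (charFun (ν n) (t - s)).re))
      + ‖charFun (ν n) s - charFun ν₀ s‖ + ‖charFun ν₀ s - charFun ν₀ t‖) atTop (𝓝 (F s)) := by
    have e1 : Tendsto (fun n => √(2 * (1 - (charFun (ν n) (t - s)).re))) atTop
        (𝓝 (√(2 * (1 - (charFun ν₀ (t - s)).re)))) :=
      ((((Complex.continuous_re.tendsto _).comp hs2).const_sub 1).const_mul 2).sqrt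
    have e2 : Tendsto (fun n => ‖charFun (ν n) s - charFun ν₀ s‖) atTop (𝓝 0) := by
      simpa using (hs1.sub_const (charFun ν₀ s)).norm
    simpa [hF] using (e1.add e2).add_const ‖charFun ν₀ s - charFun ν₀ t‖
  obtain ⟨N, hN⟩ := eventually_atTop.1 (hlim.eventually_lt_const hs)
  refine ⟨N, fun n hn => lt_of_le_of_lt ?_ (hN n hn.le)⟩
  rw [dist_eq_norm]
  calc ‖charFun (ν n) t - charFun ν₀ t‖
      = ‖(charFun (ν n) t - charFun (ν n) s) + (charFun (ν n) s - charFun ν₀ s)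
          + (charFun ν₀ s - charFun ν₀ t)‖ := by congr 1; ring
    _ ≤ _ := norm_add₃_le.trans (by gcongr; exact norm_charFun_sub_le _ _ _)

theorem norm_charFun_map_sub_le {Ω' : Type*} [MeasurableSpace Ω'] {P : Measure Ω'}
    [IsProbabilityMeasure P] {f g : Ω' → ℝ} (hf : AEMeasurable f P) (hg : AEMeasurable g P)
    (hfg : Integrable (fun w => f w - g w) P) (t : ℝ) :
    ‖charFun (P.map f) t - charFun (P.map g) t‖ ≤ |t| * ∫ w, |f w - g w| ∂P := by
  have hint : ∀ {u : Ω' → ℝ}, AEMeasurable u P →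
      Integrable (fun w => Complex.exp (t * u w * Complex.I)) P := by
    intro u hu
    refine Integrable.of_bound (by fun_prop) 1 (Eventually.of_forall fun x => ?_)
    rw [← Complex.ofReal_mul, Complex.norm_exp_ofReal_mul_I]
  have hmap : ∀ {u : Ω' → ℝ}, AEMeasurable u P →
      charFun (P.map u) t = ∫ w, Complex.exp (t * u w * Complex.I) ∂P := by
    intro u hu
    rw [charFun_apply_real, integral_map hu (by fun_prop)]
  rw [hmap hf, hmap hg, ← integral_sub (hint hf) (hint hg), ← integral_const_mul]
  refine norm_integral_le_of_norm_le (hfg.abs.const_mul _) (Eventually.of_forall fun w => ?_)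
  have : Complex.exp (t * f w * Complex.I) - Complex.exp (t * g w * Complex.I)
      = Complex.exp ((t * g w : ℝ) * Complex.I)
        * (Complex.exp (Complex.I * ((t * (f w - g w) : ℝ) : ℂ)) - 1) := by
    rw [mul_sub, ← Complex.exp_add, mul_one]
    push_cast
    ring_nf
  rw [this, norm_mul, Complex.norm_exp_ofReal_mul_I, one_mul, ← abs_mul]
  exact Real.norm_exp_I_mul_ofReal_sub_one_le

end CharFun

/-! ### Almost sure convergence along fifth powers and between them -/

/-- Between consecutive fifth powers the ratio to the lower one is close to `1`, by Bernoulli's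
inequality. -/
theorem one_sub_pow_five_div_le {k n : ℕ} (hk : k ^ 5 ≤ n) (hn : n < (k + 1) ^ 5) :
    1 - ((k ^ 5 : ℕ) : ℝ) / n ≤ 5 / (k + 1) := by
  have hk0 : (0 : ℝ) < k + 1 := by positivity
  have hn' : (n : ℝ) ≤ (k + 1) ^ 5 := by exact_mod_cast hn.le
  have hB : 1 - 5 / ((k : ℝ) + 1) ≤ ((k : ℝ) / (k + 1)) ^ 5 := by
    have := one_add_mul_le_pow (a := -(1 / ((k : ℝ) + 1)))
      (by have : 1 / ((k : ℝ) + 1) ≤ 1 := by rw [div_le_one hk0]; linarith [k.cast_nonneg (α := ℝ)]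
          linarith) 5
    have e : 1 + -(1 / ((k : ℝ) + 1)) = k / (k + 1) := by field_simp; ring
    rw [e] at this
    refine le_trans (le_of_eq ?_) this
    push_cast; ring
  rcases Nat.eq_zero_or_pos n with rfl | hn0
  · have : k = 0 := by simpa using hk
    subst this; norm_num
  · have hn0' : (0 : ℝ) < n := by exact_mod_cast hn0
    have h2 : ((k : ℝ) / (k + 1)) ^ 5 ≤ ((k ^ 5 : ℕ) : ℝ) / n := by
      rw [div_pow]; push_cast
      gcongr
    linarith

/-- Along fifth powers the rate `n ^ (-1 / 4)` becomes the summable `k ^ (-5 / 4)`. -/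
theorem summable_sampled : Summable fun k : ℕ => (((k + 1) ^ 5 : ℕ) : ℝ) ^ (-(1 / 4) : ℝ) := by
  have h1 : Summable fun k : ℕ => ((k + 1 : ℕ) : ℝ) ^ (-(5 / 4) : ℝ) :=
    (summable_nat_add_iff 1).2 (Real.summable_nat_rpow.2 (by norm_num))
  refine h1.congr fun k => ?_
  rw [Nat.cast_pow, ← Real.rpow_natCast_mul (by positivity)]
  norm_num

section Quenched

variable {Ω Ω' : Type*} [MeasurableSpace Ω] [MeasurableSpace Ω'] {μ : Measure Ω} {P : Measure Ω'}
  [IsProbabilityMeasure μ] [IsProbabilityMeasure P] {ω : ℤ → Ω → ℝ} {X : ℕ → Ω' → ℤ}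

theorem ae_integrable_sceneryWalk (h : IsScenery μ ω) (hX : ∀ k, Measurable (X k)) :
    ∀ᵐ a ∂μ, ∀ n : ℕ, Integrable (sceneryWalk (fun x => ω x a) X n) P := by
  refine ae_all_iff.2 fun n => ?_
  have h1 : Integrable (fun q : Ω × Ω' => sceneryWalk (fun x => ω x q.1) X n q.2) (μ.prod P) :=
    memLp_one_iff_integrable.1 (by exact_mod_cast h.memLp_sceneryWalk hX n 1)
  exact h1.prod_right_ae

theorem integral_abs_pow_le {f : Ω' → ℝ} (hf : Integrable f P) {p : ℕ} (hp : Even p)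
    (hfp : Integrable (fun w => f w ^ p) P) : (∫ w, |f w| ∂P) ^ p ≤ ∫ w, f w ^ p ∂P := by
  have := (hp.convexOn_pow (𝕜 := ℝ)).map_integral_le (μ := P) (f := fun w => |f w|)
    (continuous_pow p).continuousOn isClosed_univ (by simp) hf.abs
    (by simpa [Function.comp_def, hp.pow_abs] using hfp)
  simpa [hp.pow_abs] using this

/-- Almost surely, `Z_n / √n` stays close in `L¹(P)` to its value at the largest fifth power up to
`n`. -/
theorem ae_tendsto_integral_abs_normalizedDiff (h : IsScenery μ ω) (hX : IsRenewalSteps P X) :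
    ∀ᵐ a ∂μ, Tendsto (fun n : ℕ => ∫ w, |normalizedDiff ω X (Nat.nthRoot 5 n ^ 5) n (a, w)| ∂P)
      atTop (𝓝 0) := by
  -- The relative gap to the fifth power is `O(n ^ (-1 / 5))`, so the moment of order `20` is
  -- `O(n⁻²)`, which is summable.
  obtain ⟨K, hK0, hK⟩ := exists_integral_normalizedDiff_pow_le h hX 10
  have hint : ∀ k n : ℕ, Integrable (fun q => normalizedDiff ω X k n q ^ (2 * 10)) (μ.prod P) :=
    fun k n => integrable_pow_of_forall_memLp (h.memLp_normalizedDiff hX.meas k n) _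
  have hint1 : ∀ k n : ℕ, Integrable (normalizedDiff ω X k n) (μ.prod P) :=
    fun k n => memLp_one_iff_integrable.1
      (by exact_mod_cast h.memLp_normalizedDiff (P := P) hX.meas k n 1)
  have hev : Even (2 * 10) := by decide
  have hb : Summable fun n : ℕ => K * 5 ^ 10 * (1 / ((n + 1 : ℕ) : ℝ) ^ 2) :=
    ((summable_nat_add_iff 1).2 (Real.summable_one_div_nat_pow.2 one_lt_two)).mul_left _
  have hle : ∀ n : ℕ, ∫ a, ∫ w,
      normalizedDiff ω X (Nat.nthRoot 5 (n + 1) ^ 5) (n + 1) (a, w) ^ (2 * 10) ∂P ∂μ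
        ≤ K * 5 ^ 10 * (1 / ((n + 1 : ℕ) : ℝ) ^ 2) := by
    intro n
    set k := Nat.nthRoot 5 (n + 1) with hk
    have hkn : k ^ 5 ≤ n + 1 := Nat.pow_nthRoot_le (.inl (by norm_num))
    have hnk : n + 1 < (k + 1) ^ 5 := Nat.lt_pow_nthRoot_add_one (by norm_num) _
    have hk1 : 1 ≤ k := by
      by_contra hc
      have : k = 0 := by omega
      rw [this] at hnk; simp at hnk
    rw [← integral_prod _ (hint _ _)]
    have hn0 : (0 : ℝ) < (n + 1 : ℕ) := by positivity
    have h0 : 0 ≤ 1 - ((k ^ 5 : ℕ) : ℝ) / (n + 1 : ℕ) := by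
      rw [sub_nonneg, div_le_one hn0]; exact_mod_cast hkn
    refine (hK _ _ (Nat.one_le_pow _ _ hk1) hkn).trans ?_
    rw [mul_assoc]
    refine mul_le_mul_of_nonneg_left ?_ hK0
    calc (1 - ((k ^ 5 : ℕ) : ℝ) / (n + 1 : ℕ)) ^ 10 ≤ (5 / ((k : ℝ) + 1)) ^ 10 :=
          pow_le_pow_left₀ h0 (one_sub_pow_five_div_le hkn hnk) _
      _ = 5 ^ 10 * (1 / ((((k + 1) ^ 5 : ℕ) : ℝ)) ^ 2) := by
          rw [div_pow]; push_cast; ring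
      _ ≤ _ := by
          have : ((n + 1 : ℕ) : ℝ) ≤ ((k + 1) ^ 5 : ℕ) := by exact_mod_cast hnk.le
          gcongr
  have h1 := ae_tendsto_zero_of_summable_integral (μ := μ)
    (fun n a => integral_nonneg fun w => hev.pow_nonneg _)
    (fun n => (hint (Nat.nthRoot 5 (n + 1) ^ 5) (n + 1)).integral_prod_left) hb hle
  have h2 : ∀ᵐ a ∂μ, ∀ k n : ℕ, Integrable (fun w => normalizedDiff ω X k n (a, w)) P :=
    ae_all_iff.2 fun k => ae_all_iff.2 fun n => (hint1 k n).prod_right_ae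
  have h3 : ∀ᵐ a ∂μ, ∀ k n : ℕ,
      Integrable (fun w => normalizedDiff ω X k n (a, w) ^ (2 * 10)) P :=
    ae_all_iff.2 fun k => ae_all_iff.2 fun n => (hint k n).prod_right_ae
  filter_upwards [h1, h2, h3] with a ha1 ha2 ha3
  rw [← tendsto_add_atTop_iff_nat 1]
  have h4 := squeeze_zero (fun n => pow_nonneg (integral_nonneg fun w => abs_nonneg _) _)
    (fun n => integral_abs_pow_le (ha2 (Nat.nthRoot 5 (n + 1) ^ 5) (n + 1)) hev (ha3 _ _)) ha1
  have h5 := h4.rpow_const (p := ((2 * 10 : ℕ) : ℝ)⁻¹) (.inr (by positivity))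
  rw [Real.zero_rpow (by norm_num)] at h5
  refine h5.congr fun n => ?_
  exact Real.pow_rpow_inv_natCast (integral_nonneg fun w => abs_nonneg _) (by norm_num)

/-- The exceptional null set of sceneries depends on `t`; by Fubini's theorem, almost every scenery
is good for almost every `t`. -/
theorem ae_ae_tendsto_charFun (h : IsScenery μ ω) (hX : IsRenewalSteps P X)
    (haper : IsAperiodic (P.map (X 0)).support)
    (hint : Integrable (fun w => (X 0 w : ℝ)) P) (hsq : Integrable (fun w => (X 0 w : ℝ) ^ 2) P)
    {m : ℝ} (hm : m = ∫ w, (X 0 w : ℝ) ∂P) :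
    ∀ᵐ a ∂μ, ∀ᵐ t : ℝ, Tendsto (fun k : ℕ => ∫ w, Complex.exp
      ((t / √(k ^ 5 : ℕ) * centredWalk ω X m (k ^ 5) (a, w) : ℝ) * Complex.I) ∂P) atTop
      (𝓝 (Real.exp (-(t ^ 2 / 2 * (1 - 1 / m))) : ℝ)) := by
  have hmeas : ∀ k : ℕ, Measurable fun q : Ω × ℝ => ∫ w, Complex.exp
      ((q.2 / √(k ^ 5 : ℕ) * centredWalk ω X m (k ^ 5) (q.1, w) : ℝ) * Complex.I) ∂P := by
    intro k
    have hY := measurable_centredWalk h.meas hX.meas m (k ^ 5)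
    have : Measurable fun r : (Ω × ℝ) × Ω' => Complex.exp
      ((r.1.2 / √(k ^ 5 : ℕ) * centredWalk ω X m (k ^ 5) (r.1.1, r.2) : ℝ) * Complex.I) := by
      have h2 : Measurable fun r : (Ω × ℝ) × Ω' => centredWalk ω X m (k ^ 5) (r.1.1, r.2) :=
        hY.comp (by fun_prop)
      fun_prop
    exact this.stronglyMeasurable.integral_prod_right'.measurable
  refine (Measure.ae_ae_comm ?_).2 (Eventually.of_forall fun t => ?_)
  · have h1 : MeasurableSet {q : Ω × ℝ | Tendsto (fun k : ℕ => (∫ w, Complex.exp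
      ((q.2 / √(k ^ 5 : ℕ) * centredWalk ω X m (k ^ 5) (q.1, w) : ℝ) * Complex.I) ∂P)
        - (Real.exp (-(q.2 ^ 2 / 2 * (1 - 1 / m))) : ℝ)) atTop (𝓝 0)} :=
      measurableSet_tendsto _ fun k => (hmeas k).sub (by fun_prop)
    simpa only [tendsto_sub_nhds_zero_iff] using h1
  · obtain ⟨C, hC0, hC⟩ := exists_integral_norm_sq_charFun_sub_le h hX haper hint hsq hm t
    have hb : Summable fun k : ℕ => C * (((k + 1) ^ 5 : ℕ) : ℝ) ^ (-(1 / 4) : ℝ) :=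
      summable_sampled.mul_left C
    have h1 := ae_tendsto_zero_of_summable_integral (fun k a => sq_nonneg _)
      (fun k => (hC ((k + 1) ^ 5) (Nat.one_le_pow _ _ k.succ_pos)).1) hb
      (fun k => (hC ((k + 1) ^ 5) (Nat.one_le_pow _ _ k.succ_pos)).2)
    filter_upwards [h1] with a ha
    rw [← tendsto_add_atTop_iff_nat 1, ← tendsto_sub_nhds_zero_iff,
      tendsto_zero_iff_norm_tendsto_zero]
    simpa [Real.sqrt_sq] using ha.sqrt

/-- Along fifth powers, the quenched mean of the centred walk is almost surely `o(√n)`. -/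
theorem ae_tendsto_integral_centredWalk (h : IsScenery μ ω) (hX : IsRenewalSteps P X)
    (haper : IsAperiodic (P.map (X 0)).support)
    (hint : Integrable (fun w => (X 0 w : ℝ)) P) (hsq : Integrable (fun w => (X 0 w : ℝ) ^ 2) P)
    {m : ℝ} (hm : m = ∫ w, (X 0 w : ℝ) ∂P) :
    ∀ᵐ a ∂μ, Tendsto (fun k : ℕ => |∫ w, centredWalk ω X m (k ^ 5) (a, w) ∂P| / √(k ^ 5 : ℕ))
      atTop (𝓝 0) := by
  obtain ⟨C, hC0, hC⟩ := exists_integral_sq_integral_centredWalk_le h hX haper hint hsq hm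
  have hb : Summable fun k : ℕ => C * (((k + 1) ^ 5 : ℕ) : ℝ) ^ (-(1 / 4) : ℝ) :=
    summable_sampled.mul_left C
  have h1 := ae_tendsto_zero_of_summable_integral (μ := μ) (f := fun k a =>
      (∫ w, centredWalk ω X m ((k + 1) ^ 5) (a, w) ∂P) ^ 2 / ((k + 1) ^ 5 : ℕ))
    (fun k a => by positivity)
    (fun k => (hC ((k + 1) ^ 5) (Nat.one_le_pow _ _ k.succ_pos)).1.div_const _) hb
    (fun k => by
      have hn0 : (0 : ℝ) < ((k + 1) ^ 5 : ℕ) := by positivity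
      rw [integral_div, div_le_iff₀ hn0]
      refine (hC ((k + 1) ^ 5) (Nat.one_le_pow _ _ k.succ_pos)).2.trans (le_of_eq ?_)
      rw [mul_assoc, ← Real.rpow_add_one hn0.ne']
      norm_num)
  filter_upwards [h1] with a ha
  rw [← tendsto_add_atTop_iff_nat 1]
  have := ha.sqrt
  simp_rw [Real.sqrt_div (sq_nonneg _), Real.sqrt_sq_eq_abs, Real.sqrt_zero] at this
  exact this

end Quenched

/-! ### The quenched limit law -/

section Limit

variable {Ω Ω' : Type*} [MeasurableSpace Ω'] {P : Measure Ω'}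
  [IsProbabilityMeasure P] {ω : ℤ → Ω → ℝ} {X : ℕ → Ω' → ℤ}

/-- Passing from the centred and normalized `Z_n` to the centred walk at an earlier time `k` changes
the variable by the increment, its quenched mean, and the quenched mean of the centred walk. -/
theorem integral_abs_normalized_sub_le {a : Ω} {k n : ℕ} {m : ℝ}
    (hk : Integrable (sceneryWalk (fun x => ω x a) X k) P)
    (hn : Integrable (sceneryWalk (fun x => ω x a) X n) P) :
    Integrable (fun w => (sceneryWalk (fun x => ω x a) X n w
      - ∫ w', sceneryWalk (fun x => ω x a) X n w' ∂P) / √n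
      - (√k)⁻¹ * centredWalk ω X m k (a, w)) P ∧
    ∫ w, |(sceneryWalk (fun x => ω x a) X n w - ∫ w', sceneryWalk (fun x => ω x a) X n w' ∂P) / √n
      - (√k)⁻¹ * centredWalk ω X m k (a, w)| ∂P
    ≤ 2 * ∫ w, |normalizedDiff ω X k n (a, w)| ∂P
      + |∫ w, centredWalk ω X m k (a, w) ∂P| / √k := by
  set Zn := sceneryWalk (fun x => ω x a) X n with hZn
  set Zk := sceneryWalk (fun x => ω x a) X k with hZk
  set c := m⁻¹ * ∑ x ∈ Finset.Icc (1 : ℤ) ⌊k * m⌋₊, ω x a with hc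
  have hY : ∀ w, centredWalk ω X m k (a, w) = Zk w - c := fun w => rfl
  have hD : ∀ w, normalizedDiff ω X k n (a, w) = Zn w / √n - Zk w / √k := fun w => rfl
  simp_rw [hY, hD]
  have hDi : Integrable (fun w => Zn w / √n - Zk w / √k) P :=
    (hn.div_const _).sub (hk.div_const _)
  have hED : ∫ w, (Zn w / √n - Zk w / √k) ∂P = (∫ w, Zn w ∂P) / √n - (∫ w, Zk w ∂P) / √k := by
    rw [integral_sub (hn.div_const _) (hk.div_const _), integral_div, integral_div]
  have hEY : ∫ w, (Zk w - c) ∂P = (∫ w, Zk w ∂P) - c := by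
    rw [integral_sub hk (integrable_const _)]; simp
  have hid : ∀ w, (Zn w - ∫ w', Zn w' ∂P) / √n - (√k)⁻¹ * (Zk w - c)
      = (Zn w / √n - Zk w / √k) - ((∫ w, (Zn w / √n - Zk w / √k) ∂P)
        + (∫ w, (Zk w - c) ∂P) / √k) := by
    intro w
    rw [hED, hEY]
    ring
  simp_rw [hid]
  refine ⟨hDi.sub (integrable_const _), ?_⟩
  set A := ∫ w, (Zn w / √n - Zk w / √k) ∂P with hA
  set B := ∫ w, (Zk w - c) ∂P with hB
  have hAle : |A| ≤ ∫ w, |Zn w / √n - Zk w / √k| ∂P := abs_integral_le_integral_abs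
  calc ∫ w, |(Zn w / √n - Zk w / √k) - (A + B / √k)| ∂P
      ≤ ∫ w, (|Zn w / √n - Zk w / √k| + (|A| + |B| / √k)) ∂P := by
        refine integral_mono (hDi.sub (integrable_const _)).abs
          (hDi.abs.add (integrable_const _)) fun w => ?_
        refine (abs_sub _ _).trans (add_le_add le_rfl ((abs_add_le _ _).trans ?_))
        rw [abs_div, abs_of_nonneg (Real.sqrt_nonneg _)]
    _ = ∫ w, |Zn w / √n - Zk w / √k| ∂P + (|A| + |B| / √k) := by
        rw [integral_add hDi.abs (integrable_const _)]; simp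
    _ ≤ _ := by linarith

theorem tendsto_nthRoot_atTop {r : ℕ} (hr : r ≠ 0) : Tendsto (Nat.nthRoot r) atTop atTop := by
  refine tendsto_atTop.2 fun b => ?_
  filter_upwards [eventually_ge_atTop (b ^ r)] with n hn
  by_contra hc
  have h1 := Nat.lt_pow_nthRoot_add_one hr n
  have h2 : (Nat.nthRoot r n + 1) ^ r ≤ b ^ r := Nat.pow_le_pow_left (by omega) r
  omega

/-- For a fixed good scenery, the characteristic function of the normalized `Z_n` converges wherever
that of the centred walk converges along fifth powers. -/
theorem tendsto_charFun_normalized_sceneryWalk {a : Ω} {m : ℝ} {v : ℝ}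
    (hZ : ∀ n, Integrable (sceneryWalk (fun x => ω x a) X n) P)
    (hD : Tendsto (fun n : ℕ => ∫ w, |normalizedDiff ω X (Nat.nthRoot 5 n ^ 5) n (a, w)| ∂P)
      atTop (𝓝 0))
    (hY : Tendsto (fun k : ℕ => |∫ w, centredWalk ω X m (k ^ 5) (a, w) ∂P| / √(k ^ 5 : ℕ))
      atTop (𝓝 0))
    {t : ℝ} (hφ : Tendsto (fun k : ℕ => ∫ w, Complex.exp
      ((t / √(k ^ 5 : ℕ) * centredWalk ω X m (k ^ 5) (a, w) : ℝ) * Complex.I) ∂P) atTop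
      (𝓝 v)) :
    Tendsto (fun n : ℕ => charFun (P.map fun w => (sceneryWalk (fun x => ω x a) X n w
      - ∫ w', sceneryWalk (fun x => ω x a) X n w' ∂P) / √n) t) atTop (𝓝 v) := by
  have hroot : Tendsto (Nat.nthRoot 5) atTop atTop := tendsto_nthRoot_atTop (by norm_num)
  have hYm : ∀ k : ℕ, AEMeasurable (fun w => (√k)⁻¹ * centredWalk ω X m k (a, w)) P := fun k =>
    AEMeasurable.const_mul ((hZ k).aestronglyMeasurable.aemeasurable.sub_const
      (m⁻¹ * ∑ x ∈ Finset.Icc (1 : ℤ) ⌊k * m⌋₊, ω x a)) _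
  have hWm : ∀ n : ℕ, AEMeasurable (fun w => (sceneryWalk (fun x => ω x a) X n w
      - ∫ w', sceneryWalk (fun x => ω x a) X n w' ∂P) / √n) P := fun n =>
    ((hZ n).aestronglyMeasurable.aemeasurable.sub_const _).div_const _
  have hchar : ∀ k : ℕ, charFun (P.map fun w => (√k)⁻¹ * centredWalk ω X m k (a, w)) t
      = ∫ w, Complex.exp ((t / √k * centredWalk ω X m k (a, w) : ℝ) * Complex.I) ∂P := by
    intro k
    rw [charFun_apply_real, integral_map (hYm k) (by fun_prop)]
    refine integral_congr_ae (Eventually.of_forall fun w => ?_)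
    simp only
    push_cast
    congr 1
    ring
  have h1 := hφ.comp hroot
  refine (tendsto_iff_of_dist ?_).1 h1
  refine squeeze_zero (fun n => dist_nonneg) (fun n => ?_)
    (g := fun n => |t| * (2 * ∫ w, |normalizedDiff ω X (Nat.nthRoot 5 n ^ 5) n (a, w)| ∂P
      + |∫ w, centredWalk ω X m (Nat.nthRoot 5 n ^ 5) (a, w) ∂P| / √(Nat.nthRoot 5 n ^ 5 : ℕ))) ?_
  · obtain ⟨hi, hle⟩ := integral_abs_normalized_sub_le (m := m) (hZ (Nat.nthRoot 5 n ^ 5)) (hZ n)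
    rw [dist_comm, dist_eq_norm, Function.comp_apply, ← hchar]
    exact (norm_charFun_map_sub_le (hWm n) (hYm _) hi t).trans
      (mul_le_mul_of_nonneg_left hle (abs_nonneg t))
  · simpa using ((hD.const_mul 2).add (hY.comp hroot)).const_mul |t|

theorem charFun_gaussianReal_toNNReal {σ : ℝ} (hσ : 0 ≤ σ) (t : ℝ) :
    charFun (gaussianReal 0 σ.toNNReal) t = (Real.exp (-(t ^ 2 / 2 * σ)) : ℝ) := by
  rw [charFun_gaussianReal, Real.coe_toNNReal _ hσ]
  push_cast
  congr 1
  ring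

end Limit

theorem theorem1
    {Ω Ω' : Type*} [MeasurableSpace Ω] [MeasurableSpace Ω']
    (μ : Measure Ω) [IsProbabilityMeasure μ]
    (P : Measure Ω') [IsProbabilityMeasure P]
    -- the scenery: i.i.d. real random variables indexed by `ℤ`
    (ω : ℤ → Ω → ℝ) (hω_meas : ∀ x, Measurable (ω x))
    (hω_indep : iIndepFun ω μ) (hω_ident : ∀ x, IdentDistrib (ω x) (ω 0) μ μ)
    -- the steps of the walk: i.i.d. integer random variables
    (X : ℕ → Ω' → ℤ) (hX_meas : ∀ k, Measurable (X k))
    (hX_indep : iIndepFun X P) (hX_ident : ∀ k, IdentDistrib (X k) (X 0) P P)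
    -- the support of the step law is an aperiodic set of positive integers
    (hX_pos : ∀ k ∈ (P.map (X 0)).support, 0 < k)
    (hX_aper : IsAperiodic (P.map (X 0)).support)
    -- finite first moment `m` and finite second moment of the steps
    (hX_int : Integrable (fun w => (X 0 w : ℝ)) P)
    (m : ℝ) (hm : m = ∫ w, (X 0 w : ℝ) ∂P)
    (hX_sq : Integrable (fun w => (X 0 w : ℝ) ^ 2) P)
    -- the scenery is symmetric, has moments of all orders, and has unit variance
    (hω_symm : IdentDistrib (ω 0) (fun a => -ω 0 a) μ μ)
    (hω_mom : ∀ k : ℕ, 1 ≤ k → Integrable (fun a => |ω 0 a| ^ k) μ)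
    (hω_var : ∫ a, (ω 0 a) ^ 2 ∂μ = 1) :
    ∀ᵐ a ∂μ,
      (∀ n : ℕ, Integrable (sceneryWalk (fun x => ω x a) X n) P) ∧
      TendstoInDistribution
        (fun (n : ℕ) (w : Ω') =>
          (sceneryWalk (fun x => ω x a) X n w - ∫ w', sceneryWalk (fun x => ω x a) X n w' ∂P)
            / Real.sqrt n)
        atTop (fun z : ℝ => z) (fun _ => P) (gaussianReal 0 (Real.toNNReal (1 - 1 / m))) := by
  have hS : IsScenery μ ω :=
    ⟨hω_meas, hω_indep, hω_ident, hω_symm, hω_mom, hω_var⟩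
  have hpos0 : ∀ᵐ w ∂P, 0 < X 0 w := by
    have h1 : ∀ᵐ k ∂(P.map (X 0)), 0 < k := by
      filter_upwards [Measure.support_mem_ae] with k hk using hX_pos k hk
    exact ae_of_ae_map (hX_meas 0).aemeasurable h1
  have hR : IsRenewalSteps P X := ⟨hX_meas, hX_indep, hX_ident, ae_all_iff.2 fun k =>
    (hX_ident k).symm.ae_snd (p := fun z => 0 < z) (MeasurableSet.of_discrete) hpos0⟩
  have hm1 : 1 ≤ m := hm ▸ one_le_mean hR hX_int
  have hσ : 0 ≤ 1 - 1 / m := sub_nonneg.2 (div_le_one_of_le₀ hm1 (by linarith))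
  filter_upwards [ae_integrable_sceneryWalk (P := P) hS hR.meas,
    ae_tendsto_integral_abs_normalizedDiff (P := P) hS hR,
    ae_tendsto_integral_centredWalk hS hR hX_aper hX_int hX_sq hm,
    ae_ae_tendsto_charFun hS hR hX_aper hX_int hX_sq hm] with a hZ hD hY hφ
  have hW : ∀ n : ℕ, AEMeasurable (fun w => (sceneryWalk (fun x => ω x a) X n w
      - ∫ w', sceneryWalk (fun x => ω x a) X n w' ∂P) / Real.sqrt n) P := fun n =>
    ((hZ n).aestronglyMeasurable.aemeasurable.sub_const _).div_const _
  refine ⟨hZ, hW, aemeasurable_id', ?_⟩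
  refine ProbabilityMeasure.tendsto_iff_tendsto_charFun.2 fun t => ?_
  have hmap : ((gaussianReal 0 (Real.toNNReal (1 - 1 / m))).map fun z : ℝ => z)
      = gaussianReal 0 (Real.toNNReal (1 - 1 / m)) := Measure.map_id'
  simp only [ProbabilityMeasure.coe_mk, hmap]
  have : ∀ n, IsProbabilityMeasure (P.map fun w => (sceneryWalk (fun x => ω x a) X n w
      - ∫ w', sceneryWalk (fun x => ω x a) X n w' ∂P) / Real.sqrt n) :=
    fun n => Measure.isProbabilityMeasure_map (hW n)
  refine tendsto_charFun_of_ae ?_ t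
  filter_upwards [hφ] with t ht
  rw [charFun_gaussianReal_toNNReal hσ]
  exact tendsto_charFun_normalized_sceneryWalk hZ hD hY ht
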